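/- Let $M$ be a smooth manifold and $T^*[1]M$ the degree-one symplectic N-manifold whose graded algebra of functions $C(T^*[1]M)$ consists of the multivector fields on $M$, with the wedge product and with Poisson bracket $\{\cdot,\cdot\}$ the Schouten bracket. A graded submanifold $\mathcal C=E^\circ[1]$ of $T^*[1]M$ is given by a closed embedded submanifold $C\subset M$ and a smooth vector subbundle $E\to C$ of $TM|_C$; its vanishing ideal $\mathcal I_{\mathcal C}$ is the ideal generated by the functions on $M$ vanishing on $C$ and the vector fields $X$ on $M$ with $X|_C\subset E$. For a homogeneous ideal $\mathcal I$ put $\mathcal N(\mathcal I)=\{F:\{F,\mathcal I\}\subset\mathcal I\}$. The graded submanifold $\mathcal C$ is coisotropic if $\{\mathcal I_{\mathcal C},\mathcal I_{\mathcal C}\}\subset\mathcal I_{\mathcal C}$. It is presymplectic if locally on $C$ there are homogeneous generators $\phi_1,\dots,\phi_r$ of $\mathcal I_{\mathcal C}$ for which the matrix $(\{\phi_i,\phi_j\} \bmod \mathcal I_{\mathcal C})$ has constant rank, i.e. near each point of $C$ it can be brought, by switching columns and adding $C(T^*[1]M)/\mathcal I_{\mathcal C}$-multiples of columns to other columns,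 to the form $(\star\;\,0)$, where the columns of $\star$ are linearly independent at every point of $C$ in that neighbourhood. Let $\pi$ be a Poisson structure on $M$, i.e. let $\mathcal S=\pi$ be a function of degree $2$ on $T^*[1]M$ with $\{\mathcal S,\mathcal S\}=0$. Let $\mathcal C=E^\circ[1]$ be a presymplectic submanifold of $T^*[1]M$ with smooth presymplectic quotient: there is a smooth manifold $\underline C=C/(E\cap TC)$ and a surjective submersion $pr\colon C\to\underline C$ whose fibres are the leaves of $E\cap TC$. The presymplectic quotient is then $\underline{\mathcal C}=T^*[1]\underline C$, with algebra of functions $\mathcal N(\mathcal I_{\mathcal C})/(\mathcal N(\mathcal I_{\mathcal C})\cap\mathcal I_{\mathcal C})$, the class of $F\in\mathcal N(\mathcal I_{\mathcal C})$ of degree $k$ corresponding to the $k$-vector field $\underline F$ on $\underline C$ with $F(\hat f_1,\dots,\hat f_k)|_C=pr^*\big(\underline F(f_1,\dots,f_k)\big)$ for all $f_i\in C^\infty(\underline C)$ and all $\hat f_i\in\mathcal N(\mathcal I_{\mathcal C})$ of degree $0$ with $\hat f_i|_C=pr^*f_i$. Let $\mathcal A=D^\circ[1]$ be a coisotropic submanifold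 of $T^*[1]M$ with body $A$, containing $\mathcal C$ (i.e. $\mathcal I_{\mathcal A}\subset\mathcal I_{\mathcal C}$), such that 1. $D|_C\cap TC$ has constant rank; 2. $E\cap TA|_C$ has constant rank; 3. the flows of the vector fields $Y\in\Gamma(D)$ on $A$ that are tangent to $C$ at the points of $C$ preserve $E\cap TA|_C$. (In 1 and 2 it suffices that the rank is locally constant on $C$.) Put $\mathcal N_{\mathcal C}(\mathcal I_{\mathcal A})=\{F:\{F,\mathcal I_{\mathcal A}\}\subset\mathcal I_{\mathcal C}\}$. If $$\mathcal S\in\mathcal N(\mathcal I_{\mathcal C})+\mathcal I_{\mathcal C},\qquad \{\mathcal S,\mathcal I_{\mathcal A}\}\subset\mathcal I_{\mathcal C},\qquad \{\mathcal S,(\mathcal I_{\mathcal C}\cap\mathcal N_{\mathcal C}(\mathcal I_{\mathcal A}))_0\}\subset\mathcal I_{\mathcal C},$$ where the subscript $0$ denotes the degree-zero part, then $\mathcal S$ descends to $\underline{\mathcal C}$, and $\{\underline{\mathcal S},\underline{\mathcal S}\}=0$. That is: there is a unique multivector field $\underline{\mathcal S}$ on $\underline C$ corresponding to the class of some $F\in\mathcal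 N(\mathcal I_{\mathcal C})$ with $F-\mathcal S\in\mathcal I_{\mathcal C}$; it is a bivector field and $\{\underline{\mathcal S},\underline{\mathcal S}\}=0$ on $T^*[1]\underline C$; moreover $\{F,F\}\in\mathcal I_{\mathcal C}$ for every $F\in\mathcal N(\mathcal I_{\mathcal C})$ with $F-\mathcal S\in\mathcal I_{\mathcal C}$. -/

import Mathlib

open scoped Manifold ContDiff Topology Pointwise

noncomputable section

namespace GradedReduction

/-! ## Functions on the degree one N-manifold `T^*[1]M`

A function of degree `k` on `T^*[1]M` is a `k`-vector field on `M`, that is, an alternating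
`k`-linear operation on smooth functions which is a derivation in each argument. -/

/-- The algebra of smooth real functions on an `n`-dimensional manifold. -/
abbrev SmoothFun (n : ℕ) (M : Type*) [TopologicalSpace M]
    [ChartedSpace (EuclideanSpace ℝ (Fin n)) M] : Type _ :=
  C^∞⟮𝓡 n, M; ℝ⟯

/-- Sequences `(P 0, P 1, …)` of alternating `ℝ`-multilinear operations on smooth functions,
`P k` having `k` arguments. -/
abbrev Cochain (n : ℕ) (M : Type*) [TopologicalSpace M]
    [ChartedSpace (EuclideanSpace ℝ (Fin n)) M] : Type _ :=
  ∀ k : ℕ, (SmoothFun n M) [⋀^Fin k]→ₗ[ℝ] (SmoothFun n M)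

/-- The Leibniz rule in each argument. -/
def IsMultiderivation {A : Type*} [CommRing A] [Algebra ℝ A] {k : ℕ}
    (P : A [⋀^Fin k]→ₗ[ℝ] A) : Prop :=
  ∀ (v : Fin k → A) (i : Fin k) (a b : A),
    P (Function.update v i (a * b)) =
      a * P (Function.update v i b) + b * P (Function.update v i a)

section Operations

variable {A : Type*} [CommRing A] [Algebra ℝ A]

/-- The exterior product, `(P ∧ Q)(a₁, …, aₚ₊ᵩ) = ∑ sgn(σ) P(aσ₁, …, aσₚ) Q(aσₚ₊₁, …, aσₚ₊ᵩ)`,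
summed over the `(p, q)`-shuffles. -/
def wedgeHom {p q : ℕ} (P : A [⋀^Fin p]→ₗ[ℝ] A) (Q : A [⋀^Fin q]→ₗ[ℝ] A) :
    A [⋀^Fin (p + q)]→ₗ[ℝ] A :=
  ((LinearMap.mul' ℝ A).compAlternatingMap (P.domCoprod Q)).domDomCongr finSumFinEquiv

/-- The multilinear map `(a₁, …, aᵩ, b₁, …, bₚ) ↦ P(Q(a₁, …, aᵩ), b₁, …, bₚ)`. -/
def insertMultilinear {p q : ℕ} (P : A [⋀^Fin (p + 1)]→ₗ[ℝ] A) (Q : A [⋀^Fin q]→ₗ[ℝ] A) :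
    MultilinearMap ℝ (fun _ : Fin q ⊕ Fin p => A) A :=
  MultilinearMap.uncurrySum
    ((AlternatingMap.toMultilinearMapLM (S := ℝ) ∘ₗ P.curryLeft).compMultilinearMap
      Q.toMultilinearMap)

/-- The insertion of `Q` into `P`,
`(P ∘ Q)(a₁, …, aᵩ₊ₚ) = ∑ sgn(σ) P(Q(aσ₁, …, aσᵩ), aσᵩ₊₁, …, aσᵩ₊ₚ)`, summed over the
`(q, p)`-shuffles; written here as the sum over all permutations divided by `q! p!`. -/
def insertHom {p q : ℕ} (P : A [⋀^Fin (p + 1)]→ₗ[ℝ] A) (Q : A [⋀^Fin q]→ₗ[ℝ] A) :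
    A [⋀^Fin (q + p)]→ₗ[ℝ] A :=
  (((q.factorial : ℝ) * (p.factorial : ℝ))⁻¹ •
    MultilinearMap.alternatization (insertMultilinear P Q)).domDomCongr finSumFinEquiv

end Operations

variable {n : ℕ} {M : Type*} [TopologicalSpace M] [ChartedSpace (EuclideanSpace ℝ (Fin n)) M]

/-- The product of functions on `T^*[1]M`. -/
def wedge (P Q : Cochain n M) : Cochain n M := fun m =>
  ∑ x : {x : ℕ × ℕ // x ∈ Finset.HasAntidiagonal.antidiagonal m},
    (wedgeHom (P x.1.1) (Q x.1.2)).domDomCongr (finCongr (Finset.HasAntidiagonal.mem_antidiagonal.1 x.2))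

/-- The Poisson bracket of functions on `T^*[1]M`, which is the Schouten bracket: for `P` of
degree `p` and `Q` of degree `q` it is `P ∘ Q - (-1)^((p-1)(q-1)) Q ∘ P`, of degree `p + q - 1`.
In the second sum, `x.1.1` is the degree of `P` and `x.1.2 + 1` is the degree of `Q`. -/
def bracket (P Q : Cochain n M) : Cochain n M := fun m =>
  ∑ x : {x : ℕ × ℕ // x ∈ Finset.HasAntidiagonal.antidiagonal m},
    ((insertHom (P (x.1.2 + 1)) (Q x.1.1)).domDomCongr
        (finCongr (Finset.HasAntidiagonal.mem_antidiagonal.1 x.2)) -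
      ((-1 : ℝ) ^ ((x.1.1 + 1) * x.1.2)) •
        (insertHom (Q (x.1.2 + 1)) (P x.1.1)).domDomCongr
          (finCongr (Finset.HasAntidiagonal.mem_antidiagonal.1 x.2)))

variable (n M) in
/-- The functions on `T^*[1]M`: the multivector fields on `M`. (On an `n`-dimensional manifold the
components of degree `> n` of a multivector field are zero.) -/
def functions : Submodule ℝ (Cochain n M) where
  carrier := {P | ∀ k, IsMultiderivation (P k)}
  add_mem' := by
    intro P Q hP hQ k v i a b
    simp only [Pi.add_apply, AlternatingMap.add_apply, hP k v i a b, hQ k v i a b]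
    ring
  zero_mem' := by
    intro k v i a b
    simp
  smul_mem' := by
    intro c P hP k v i a b
    simp only [Pi.smul_apply, AlternatingMap.smul_apply, hP k v i a b, smul_add,
      mul_smul_comm]

/-- `P` is homogeneous of degree `k`. -/
def IsHomogeneous (k : ℕ) (P : Cochain n M) : Prop := ∀ j, j ≠ k → P j = 0

/-- A smooth function on `M`, seen as a function of degree `0` on `T^*[1]M`. -/
def ofFun (f : SmoothFun n M) : Cochain n M :=
  Pi.single 0 (AlternatingMap.constOfIsEmpty ℝ (SmoothFun n M) (Fin 0) f)

/-- `P` and `Q` have the same restriction to `V ⊆ M`. -/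
def EqOver (V : Set M) (P Q : Cochain n M) : Prop :=
  ∀ (k : ℕ) (f : Fin k → SmoothFun n M), ∀ x ∈ V, P k f x = Q k f x

/-- The ideal generated by a set `G` of functions on `T^*[1]M`. (For homogeneous generators, left
ideals are two-sided.) -/
def idealSpan (G : Set (Cochain n M)) : Submodule ℝ (Cochain n M) :=
  Submodule.span ℝ {P | ∃ a ∈ functions n M, ∃ g ∈ G, P = wedge a g}

/-- The functions on `T^*[1]M` which locally belong to the ideal generated by `G`, that is, the
global sections of the ideal sheaf generated by `G`. -/
def idealSheafSpan (G : Set (Cochain n M)) : Submodule ℝ (Cochain n M) where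
  carrier := {P | P ∈ functions n M ∧ ∀ x : M, ∃ V ∈ 𝓝 x, ∃ Q ∈ idealSpan G, EqOver V P Q}
  add_mem' := by
    rintro P P' ⟨hP, h⟩ ⟨hP', h'⟩
    refine ⟨Submodule.add_mem _ hP hP', fun x => ?_⟩
    obtain ⟨V, hV, Q, hQ, e⟩ := h x
    obtain ⟨V', hV', Q', hQ', e'⟩ := h' x
    refine ⟨V ∩ V', Filter.inter_mem hV hV', Q + Q', Submodule.add_mem _ hQ hQ', ?_⟩
    intro k f y hy
    simp [e k f y hy.1, e' k f y hy.2]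
  zero_mem' := ⟨Submodule.zero_mem _, fun _ =>
    ⟨Set.univ, Filter.univ_mem, 0, Submodule.zero_mem _, fun _ _ _ _ => rfl⟩⟩
  smul_mem' := by
    rintro c P ⟨hP, h⟩
    refine ⟨Submodule.smul_mem _ c hP, fun x => ?_⟩
    obtain ⟨V, hV, Q, hQ, e⟩ := h x
    refine ⟨V, hV, c • Q, Submodule.smul_mem _ c hQ, ?_⟩
    intro k f y hy
    simp [e k f y hy]

/-- The functions `F` on `T^*[1]M` with `{F, I} ⊆ J`. -/
def relNormalizer (J I : Submodule ℝ (Cochain n M)) : Set (Cochain n M) :=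
  {F | F ∈ functions n M ∧ ∀ G ∈ I, bracket F G ∈ J}

/-- The Poisson normalizer of `I`: the functions `F` on `T^*[1]M` with `{F, I} ⊆ I`. -/
def normalizer (I : Submodule ℝ (Cochain n M)) : Set (Cochain n M) := relNormalizer I I

/-! ## Graded submanifolds -/

variable [IsManifold (𝓡 n) ∞ M]

variable (n M) in
/-- A graded submanifold `E°[1]` of `T^*[1]M`: a closed embedded submanifold `C` of `M` (the body)
together with a smooth subbundle `E → C` of `TM` restricted to `C`. The values of `fiber` outside
the body are irrelevant. -/
structure GradedSubmanifold where
  body : Set M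
  isClosed_body : IsClosed body
  dim : ℕ
  charted : ChartedSpace (EuclideanSpace ℝ (Fin dim)) body
  isManifold : IsManifold (𝓡 dim) ∞ body
  isSmoothEmbedding : Manifold.IsSmoothEmbedding (𝓡 dim) (𝓡 n) ∞ (Subtype.val : body → M)
  fiber : ∀ x : M, Submodule ℝ (TangentSpace (𝓡 n) x)
  exists_frame : ∀ x : body, ∃ U ∈ 𝓝 x, ∃ (r : ℕ)
    (s : Fin r → ∀ y : body, TangentSpace (𝓡 n) (y : M)),
    (∀ i, ContMDiffOn (𝓡 dim) (𝓡 n).tangent ∞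
      (fun y : body => (⟨(y : M), s i y⟩ : TangentBundle (𝓡 n) M)) U) ∧
    ∀ y ∈ U, LinearIndependent ℝ (fun i => s i y) ∧
      Submodule.span ℝ (Set.range fun i => s i y) = fiber (y : M)

namespace GradedSubmanifold

attribute [instance] GradedSubmanifold.charted GradedSubmanifold.isManifold

/-- The differential `T_y C → T_y M` of the inclusion of the body. -/
def inclDeriv (𝒞 : GradedSubmanifold n M) (y : 𝒞.body) :
    TangentSpace (𝓡 𝒞.dim) y →L[ℝ] TangentSpace (𝓡 n) (y : M) :=
  mfderiv (𝓡 𝒞.dim) (𝓡 n) (Subtype.val : 𝒞.body → M) y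

/-- The tangent space `T_x C` of the body, as a subspace of `T_x M` (zero if `x` is not in the
body). -/
def tangent (𝒞 : GradedSubmanifold n M) (x : M) : Submodule ℝ (TangentSpace (𝓡 n) x) :=
  ⨆ h : x ∈ 𝒞.body, LinearMap.range (𝒞.inclDeriv ⟨x, h⟩).toLinearMap

/-- The degree zero generators of the vanishing ideal: smooth functions on `M` vanishing on `C`. -/
def vanishingFunctions (𝒞 : GradedSubmanifold n M) : Set (Cochain n M) :=
  {P | ∃ f : SmoothFun n M, (∀ x ∈ 𝒞.body, f x = 0) ∧ P = ofFun f}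

/-- The degree one generators of the vanishing ideal: vector fields `X` on `M` whose value at each
`x ∈ C` is a vector `v ∈ E_x`. -/
def tangentFields (𝒞 : GradedSubmanifold n M) : Set (Cochain n M) :=
  {X | X ∈ functions n M ∧ IsHomogeneous 1 X ∧
    ∀ x ∈ 𝒞.body, ∃ v ∈ 𝒞.fiber x, ∀ f : SmoothFun n M,
      X 1 ![f] x = (mfderiv (𝓡 n) 𝓘(ℝ, ℝ) f x v : ℝ)}

/-- The vanishing ideal of a graded submanifold. -/
def ideal (𝒞 : GradedSubmanifold n M) : Submodule ℝ (Cochain n M) :=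
  idealSheafSpan (𝒞.vanishingFunctions ∪ 𝒞.tangentFields)

/-- A graded submanifold is coisotropic if its vanishing ideal is closed under the bracket. -/
def IsCoisotropic (𝒜 : GradedSubmanifold n M) : Prop :=
  ∀ F ∈ 𝒜.ideal, ∀ G ∈ 𝒜.ideal, bracket F G ∈ 𝒜.ideal

end GradedSubmanifold

/-- `ColumnEquiv A B`: the square matrix `B` with entries functions on `T^*[1]M` is obtained from
`A` by successively adding to a column a multiple of another column. -/
inductive ColumnEquiv {r : ℕ} : Matrix (Fin r) (Fin r) (Cochain n M) →
    Matrix (Fin r) (Fin r) (Cochain n M) → Prop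
  | refl (A : Matrix (Fin r) (Fin r) (Cochain n M)) : ColumnEquiv A A
  | add (A B : Matrix (Fin r) (Fin r) (Cochain n M)) (j k : Fin r) (a : Cochain n M) :
      ColumnEquiv A B → j ≠ k → a ∈ functions n M →
      ColumnEquiv A (B.updateCol j fun i => B i j + wedge (B i k) a)

namespace GradedSubmanifold

/-- The matrix `A`, with entries taken modulo the vanishing ideal, has constant rank on the part
`V ∩ C` of the body: by adding multiples of columns to other columns it can be brought to a form in
which the columns not in `T` vanish on `V` modulo the ideal, while the columns in `T` are linearly
independent at every point of `V ∩ C`. (The value at a point of the body is the value of the degree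
zero part. Instead of switching columns the set `T` is left arbitrary.) -/
def HasConstantRankOn (𝒞 : GradedSubmanifold n M) (V : Set M) {r : ℕ}
    (A : Matrix (Fin r) (Fin r) (Cochain n M)) : Prop :=
  ∃ (B : Matrix (Fin r) (Fin r) (Cochain n M)) (T : Set (Fin r)), ColumnEquiv A B ∧
    (∀ j ∉ T, ∀ i, ∃ Q ∈ 𝒞.ideal, EqOver V (B i j) Q) ∧
    ∀ x ∈ V, x ∈ 𝒞.body → LinearIndependent ℝ (fun (j : T) (i : Fin r) => (B i j 0 ![] x : ℝ))

/-- The functions `φ i` are homogeneous elements of the vanishing ideal which generate it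
over `V`. -/
def AreHomogeneousGeneratorsOn (𝒞 : GradedSubmanifold n M) (V : Set M) {r : ℕ}
    (φ : Fin r → Cochain n M) : Prop :=
  (∀ i, φ i ∈ 𝒞.ideal ∧ ∃ k, IsHomogeneous k (φ i)) ∧
    ∀ ψ ∈ 𝒞.ideal, ∃ a : Fin r → Cochain n M, (∀ i, a i ∈ functions n M) ∧
      EqOver V ψ (∑ i, wedge (a i) (φ i))

/-- A graded submanifold is presymplectic if locally its vanishing ideal has homogeneous generators
`φ i` for which the matrix `{φ i, φ j}` modulo the ideal has constant rank. -/
def IsPresymplectic (𝒞 : GradedSubmanifold n M) : Prop :=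
  ∀ x ∈ 𝒞.body, ∃ V ∈ 𝓝 x, ∃ (r : ℕ) (φ : Fin r → Cochain n M),
    𝒞.AreHomogeneousGeneratorsOn V φ ∧
      𝒞.HasConstantRankOn V (Matrix.of fun i j => bracket (φ i) (φ j))

/-- The dimension of the subspaces `W x`, for `x` in the body, is locally constant. -/
def HasConstantRank (𝒞 : GradedSubmanifold n M)
    (W : ∀ x : M, Submodule ℝ (TangentSpace (𝓡 n) x)) : Prop :=
  ∀ x ∈ 𝒞.body, ∀ᶠ y in 𝓝[𝒞.body] x, Module.finrank ℝ (W y) = Module.finrank ℝ (W x)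

/-- `φ` is a smooth local flow, defined on `(-ε, ε) × U`, of the vector field `Y` on the body. -/
def IsLocalFlow (𝒜 : GradedSubmanifold n M) (Y : ∀ a : 𝒜.body, TangentSpace (𝓡 𝒜.dim) a)
    (ε : ℝ) (U : Set 𝒜.body) (φ : ℝ → 𝒜.body → 𝒜.body) : Prop :=
  0 < ε ∧ IsOpen U ∧
  ContMDiffOn (𝓘(ℝ, ℝ).prod (𝓡 𝒜.dim)) (𝓡 𝒜.dim) ∞ (fun p : ℝ × 𝒜.body => φ p.1 p.2)
    (Set.Ioo (-ε) ε ×ˢ U) ∧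
  ∀ a ∈ U, φ 0 a = a ∧ IsMIntegralCurveOn (fun t => φ t a) Y (Set.Ioo (-ε) ε)

/-- The flows of the vector fields `Y` on `A` which take values in `D` and are tangent to `C` at
the points of `C` preserve `E ∩ TA|_C`, where `𝒞 = E°[1]` and `𝒜 = D°[1]`. -/
def FlowsPreserve (𝒜 𝒞 : GradedSubmanifold n M) : Prop :=
  ∀ Y : ∀ a : 𝒜.body, TangentSpace (𝓡 𝒜.dim) a,
    ContMDiff (𝓡 𝒜.dim) (𝓡 𝒜.dim).tangent ∞
      (fun a => (⟨a, Y a⟩ : TangentBundle (𝓡 𝒜.dim) 𝒜.body)) →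
    (∀ a : 𝒜.body, 𝒜.inclDeriv a (Y a) ∈ 𝒜.fiber a) →
    (∀ a : 𝒜.body, (a : M) ∈ 𝒞.body → 𝒜.inclDeriv a (Y a) ∈ 𝒞.tangent a) →
    ∀ (ε : ℝ) (U : Set 𝒜.body) (φ : ℝ → 𝒜.body → 𝒜.body), 𝒜.IsLocalFlow Y ε U φ →
      ∀ t ∈ Set.Ioo (-ε) ε, ∀ a ∈ U, (a : M) ∈ 𝒞.body →
        ∀ w : TangentSpace (𝓡 𝒜.dim) a, 𝒜.inclDeriv a w ∈ 𝒞.fiber a →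
          𝒜.inclDeriv (φ t a) (mfderiv (𝓡 𝒜.dim) (𝓡 𝒜.dim) (φ t) a w) ∈ 𝒞.fiber (φ t a)

/-- The compatibility conditions between `𝒞 = E°[1]` and `𝒜 = D°[1]`: `D|_C ∩ TC` and
`E ∩ TA|_C` have constant rank, and the flows of the sections of `D` tangent to `C` preserve
`E ∩ TA|_C`. -/
structure Compatible (𝒞 𝒜 : GradedSubmanifold n M) : Prop where
  constantRank_inf_tangent_body : 𝒞.HasConstantRank fun x => 𝒜.fiber x ⊓ 𝒞.tangent x
  constantRank_fiber_inf : 𝒞.HasConstantRank fun x => 𝒞.fiber x ⊓ 𝒜.tangent x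
  flowsPreserve : FlowsPreserve 𝒜 𝒞

/-! ## The presymplectic quotient -/

section Quotient

variable {q : ℕ} {Q : Type*} [TopologicalSpace Q] [ChartedSpace (EuclideanSpace ℝ (Fin q)) Q]

variable (q) in
/-- The manifold `Q`, with projection `pr`, is the quotient of the body `C` by the distribution
`E ∩ TC`: `pr` is a surjective submersion whose fibers are the leaves of `E ∩ TC`. In this case the
presymplectic quotient of `𝒞` is `T^*[1]Q`. -/
structure IsSmoothQuotient (𝒞 : GradedSubmanifold n M) (pr : 𝒞.body → Q) : Prop where
  surjective : Function.Surjective pr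
  isSubmersion : Manifold.IsSubmersion (𝓡 𝒞.dim) (𝓡 q) ∞ pr
  ker_eq : ∀ (y : 𝒞.body) (w : TangentSpace (𝓡 𝒞.dim) y),
    mfderiv (𝓡 𝒞.dim) (𝓡 q) pr y w = 0 ↔ 𝒞.inclDeriv y w ∈ 𝒞.fiber y
  isConnected_fiber : ∀ z : Q, IsConnected (pr ⁻¹' {z})

/-- The function `G` on `T^*[1]Q` corresponds to the class of `F ∈ N(I)` in `N(I) / (N(I) ∩ I)`: the
values of `F` on functions in `N(I)` which on `C` are pullbacks of functions `f i` on `Q` are, on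
`C`, the pullbacks of the values of `G` on the functions `f i`. -/
def ReducesTo (𝒞 : GradedSubmanifold n M) (pr : 𝒞.body → Q) (F : Cochain n M)
    (G : Cochain q Q) : Prop :=
  ∀ (k : ℕ) (g : Fin k → SmoothFun n M) (f : Fin k → SmoothFun q Q),
    (∀ i, ofFun (g i) ∈ normalizer 𝒞.ideal) → (∀ i, ∀ y : 𝒞.body, g i y = f i (pr y)) →
    ∀ y : 𝒞.body, F k g y = G k f (pr y)

/-- The function `S` on `T^*[1]M` descends to the function `G` on the presymplectic quotient: the
restriction of `S` to `𝒞`, i.e. its class modulo the vanishing ideal, is the class of an element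
`F` of the normalizer, and `F` corresponds to `G`. -/
def DescendsTo (𝒞 : GradedSubmanifold n M) (pr : 𝒞.body → Q) (S : Cochain n M)
    (G : Cochain q Q) : Prop :=
  ∃ F ∈ normalizer 𝒞.ideal, F - S ∈ 𝒞.ideal ∧ 𝒞.ReducesTo pr F G

end Quotient

end GradedSubmanifold

end GradedReduction

end

/-!
# Reduction of Poisson structures to presymplectic quotients

Let `𝒞 = E°[1]` and `𝒜 = D°[1]`, with bodies `C ⊆ A`. Call a function on `M` basic if its
differential annihilates `E` along `C`.

**The vanishing ideal.** A multivector field belongs to the vanishing ideal of `𝒞` if and only if,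
at the points of `C`, it vanishes on all functions whose differentials annihilate `E`
(`apply_eq_zero_of_mem_ideal`, `mem_ideal_of_apply_eq_zero`). For the nontrivial direction the
multivector field is expanded near a point of `C` along a family of vector fields, some of which
form a frame of `E`, while the coefficients of the products of the others are its values on
covectors annihilating `E`. The values of a multivector field at a point only depend on the
differentials of its arguments, by Hadamard's lemma. It follows that the basic functions are the
functions of degree zero in the normalizer, that `C ⊆ A` and `D ⊆ E` along `C`, and that two
multivector fields which agree modulo the ideal agree along `C` on basic functions.

**The quotient.** The basic functions restrict on `C` to the pullbacks of the functions on the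
quotient. That they do is the descent of functions which are constant along the connected fibers of
a submersion (`IsSmoothQuotient.exists_descent`). Conversely, every function on the quotient has a
basic lift (`IsSmoothQuotient.exists_lift`): the correction that makes the differential of an
extension annihilate `E` solves a linear system, whose rank is constant because `E ∩ TC` is the
kernel of the differential of the projection (`exists_smooth_solution`). If `F` is in the
normalizer, its bivector part preserves basic functions, and it only depends on their
restrictions to `C`. Hence it induces a bivector field on the quotient (`IsSmoothQuotient.exists_bivector`).

**The Jacobi identity** (`jacobiator_eq_zero`). Let `F` be in the normalizer and equal to `S` modulo
the ideal. On basic functions `F` and `S` agree along `C`, but `S(f, g)` need not be basic, so that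
the Jacobi identity of `S` does not apply directly. Three facts remedy this at a point `c` of `C`.

* The Hamiltonian vectors of basic functions lie in `TC + D` (`exists_hamiltonianVector`). This
  is the meaning of `{S, (I_𝒞 ∩ N_𝒞(I_𝒜))₀} ⊆ I_𝒞`, because `D ∩ TC` has constant rank and every
  covector annihilating `TC + D` is therefore the differential of a function in
  `(I_𝒞 ∩ N_𝒞(I_𝒜))₀`.
* Let `X i` be sections of `D` spanning a complement of `TC` in `TC + D` at `c`. A lift `f` can be
  modified to second order such that `X i (X j f)` vanishes at `c` (`exists_adjusted`). The
  matrix of these second derivatives is symmetric, as `𝒜` is coisotropic.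
* For such lifts `{S, X i} ∈ I_𝒞` shows that `X i (S(f, g))` vanishes at `c`. Then `S(f, g)` and the
  basic function `F(f, g)` agree on `C`, and their differentials agree on `TC + D`, so that
  `S(S(f, g), h) = S(F(f, g), h) = F(F(f, g), h)` at `c`.

So the Jacobi identity of `S` at `c` gives that of the reduced bracket.

**The class of `S`** (`bracket_self_mem_ideal`). The bivector part `F₂` of `F` is in the normalizer
and `F - F₂` is in the ideal, so that only `{F₂, F₂}` matters. It vanishes along `C` if one of the
arguments is a function `κ` which vanishes on `C`, since `{F₂, {F₂, κ}}` is in the ideal, and on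
basic functions by the Jacobi identity. The differentials of these two kinds of functions span the
covectors annihilating `E`.
-/

open scoped Manifold ContDiff Topology Pointwise

noncomputable section

namespace GradedReduction

/-! ### Evaluation of products and brackets -/

section

section Algebra

variable {A : Type*} [CommRing A] [Algebra ℝ A]

theorem wedgeHom_apply {p q : ℕ} (P : A [⋀^Fin p]→ₗ[ℝ] A) (Q : A [⋀^Fin q]→ₗ[ℝ] A)
    (f : Fin (p + q) → A) :
    wedgeHom P Q f = ((p.factorial : ℝ) * (q.factorial : ℝ))⁻¹ •
      ∑ σ : Equiv.Perm (Fin (p + q)), Equiv.Perm.sign σ •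
        (P (fun i => f (σ (Fin.castAdd q i))) * Q (fun i => f (σ (Fin.natAdd p i)))) := by
  have h := MultilinearMap.domCoprod_alternization_eq P Q
  have h2 : P.domCoprod Q = ((p.factorial : ℝ) * (q.factorial : ℝ))⁻¹ •
      MultilinearMap.alternatization
        (MultilinearMap.domCoprod (P : MultilinearMap ℝ (fun _ : Fin p => A) A)
          (Q : MultilinearMap ℝ (fun _ : Fin q => A) A)) := by
    rw [h, Fintype.card_fin, Fintype.card_fin, ← Nat.cast_smul_eq_nsmul ℝ, smul_smul,
      Nat.cast_mul, inv_mul_cancel₀, one_smul]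
    positivity
  rw [wedgeHom, h2, ← Equiv.sum_comp (finSumFinEquiv (m := p) (n := q)).permCongr]
  simp [MultilinearMap.alternatization_apply, map_sum, Units.smul_def, -zsmul_eq_mul]

theorem insertHom_apply {p q : ℕ} (P : A [⋀^Fin (p + 1)]→ₗ[ℝ] A) (Q : A [⋀^Fin q]→ₗ[ℝ] A)
    (f : Fin (q + p) → A) :
    insertHom P Q f = ((q.factorial : ℝ) * (p.factorial : ℝ))⁻¹ •
      ∑ σ : Equiv.Perm (Fin (q + p)), Equiv.Perm.sign σ •
        P (Fin.cons (Q fun i => f (σ (Fin.castAdd p i))) (fun i => f (σ (Fin.natAdd q i)))) := by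
  rw [← Equiv.sum_comp (finSumFinEquiv (m := q) (n := p)).permCongr]
  simp [insertHom, MultilinearMap.alternatization_apply, insertMultilinear, -zsmul_eq_mul]

/-- If the multilinear map defining an insertion is already alternating, no antisymmetrization is
needed. -/
theorem insertHom_eq_of_alternating {p q : ℕ} (P : A [⋀^Fin (p + 1)]→ₗ[ℝ] A)
    (Q : A [⋀^Fin q]→ₗ[ℝ] A) (R : A [⋀^Fin q ⊕ Fin p]→ₗ[ℝ] A)
    (h : insertMultilinear P Q = R) (hpq : (q + p).factorial = q.factorial * p.factorial)
    (f : Fin (q + p) → A) :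
    insertHom P Q f = R fun i => f (finSumFinEquiv i) := by
  have : (0 : ℝ) < (q.factorial : ℝ) * (p.factorial : ℝ) := by positivity
  simp only [insertHom, h, AlternatingMap.coe_alternatization, Fintype.card_sum, Fintype.card_fin,
    hpq]
  rw [← Nat.cast_smul_eq_nsmul ℝ, smul_smul, Nat.cast_mul, inv_mul_cancel₀ this.ne', one_smul]
  rfl

theorem insertHom_zero_right {p : ℕ} (P : A [⋀^Fin (p + 1)]→ₗ[ℝ] A) (Q : A [⋀^Fin 0]→ₗ[ℝ] A)
    (f : Fin (0 + p) → A) :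
    insertHom P Q f = P (Fin.cons (Q ![]) fun i => f (Fin.cast (by simp) i)) := by
  rw [insertHom_eq_of_alternating P Q
    ((P.curryLeft (Q ![])).domDomCongr (Equiv.emptySum (Fin 0) (Fin p)).symm) _ (by simp)]
  · simp only [AlternatingMap.domDomCongr_apply, AlternatingMap.curryLeft_apply_apply]
    congr 2
    funext i
    simp only [Function.comp_apply]
    congr 1
    ext; simp
  · apply MultilinearMap.ext
    intro v
    have : (fun i => v (Sum.inl i)) = (![] : Fin 0 → A) := Subsingleton.elim _ _
    simp [insertMultilinear, this]
    congr 1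

theorem insertHom_one_one (P : A [⋀^Fin (1 + 1)]→ₗ[ℝ] A) (Q : A [⋀^Fin 1]→ₗ[ℝ] A) (f g : A) :
    insertHom P Q ![f, g] = P ![Q ![f], g] - P ![Q ![g], f] := by
  have e (σ : Equiv.Perm (Fin (1 + 1))) : P (Fin.cons (Q fun i => ![f, g] (σ (Fin.castAdd 1 i)))
      (fun i => ![f, g] (σ (Fin.natAdd 1 i)))) = P ![Q ![![f, g] (σ 0)], ![f, g] (σ 1)] := by
    congr 1
    ext i
    fin_cases i
    · simp
      congr 3
      ext i
      fin_cases i; rfl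
    · rfl
  rw [insertHom_apply]
  simp only [e]
  rw [show (Finset.univ : Finset (Equiv.Perm (Fin (1 + 1)))) = {1, Equiv.swap 0 1} from by decide]
  rw [Finset.sum_pair (by decide)]
  simp [sub_eq_add_neg]

/-- Insertion into a derivation needs no antisymmetrization, the inserted operation being
alternating in all the arguments. -/
theorem insertHom_zero_left {q : ℕ} (P : A [⋀^Fin (0 + 1)]→ₗ[ℝ] A) (Q : A [⋀^Fin q]→ₗ[ℝ] A)
    (f : Fin (q + 0) → A) :
    insertHom P Q f = P ![Q f] := by
  have e (σ : Equiv.Perm (Fin (q + 0))) :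
      P (Fin.cons (Q fun i => f (σ (Fin.castAdd 0 i))) (fun i => f (σ (Fin.natAdd q i)))) =
      Equiv.Perm.sign σ • P ![Q f] := by
    have h1 : (Q fun i => f (σ (Fin.castAdd 0 i))) = Equiv.Perm.sign σ • Q f := Q.map_perm f σ
    have h2 : (Fin.cons (Q fun i => f (σ (Fin.castAdd 0 i))) (fun i => f (σ (Fin.natAdd q i))) :
      Fin (0 + 1) → A) = Function.update ![Q f] 0 (Equiv.Perm.sign σ • Q f) := by
      funext i; fin_cases i; exact h1
    rw [h2]
    rcases Int.units_eq_one_or (Equiv.Perm.sign σ) with h | h <;> simp only [h]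
    · rw [one_smul, one_smul]
      congr 1
      funext i; fin_cases i; rfl
    · simp only [Units.smul_def, Units.val_neg, Units.val_one, neg_smul, one_smul,
        AlternatingMap.map_update_neg]
      congr 2
      funext i; fin_cases i; rfl
  rw [insertHom_apply]
  simp only [e, smul_smul, Int.units_mul_self, one_smul]
  rw [Finset.sum_const, Finset.card_univ, Fintype.card_perm, Fintype.card_fin,
    ← Nat.cast_smul_eq_nsmul ℝ, smul_smul]
  have : (0 : ℝ) < (q.factorial : ℝ) := by positivity
  simp [this.ne']

/-- The three shuffles, each of which is the class of two permutations. -/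
theorem insertHom_one_two (P : A [⋀^Fin (1 + 1)]→ₗ[ℝ] A) (Q : A [⋀^Fin 2]→ₗ[ℝ] A) (f g h : A) :
    insertHom P Q ![f, g, h] =
      P ![Q ![f, g], h] + P ![Q ![g, h], f] + P ![Q ![h, f], g] := by
  have e (σ : Equiv.Perm (Fin (2 + 1))) :
      P (Fin.cons (Q fun i => ![f, g, h] (σ (Fin.castAdd 1 i)))
      (fun i => ![f, g, h] (σ (Fin.natAdd 2 i)))) =
      P ![Q ![![f, g, h] (σ 0), ![f, g, h] (σ 1)], ![f, g, h] (σ 2)] := by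
    congr 1
    ext i
    fin_cases i
    · simp
      congr 3
      ext i
      fin_cases i <;> rfl
    · rfl
  have sw (a b c : A) : P ![Q ![b, a], c] = - P ![Q ![a, b], c] := by
    have h1 : Q ![b, a] = - Q ![a, b] := by
      rw [← Q.map_swap ![a, b] (show (0 : Fin 2) ≠ 1 by decide)]
      congr 1; ext i; fin_cases i <;> rfl
    have h2 := P.map_update_neg ![Q ![a, b], c] 0 (Q ![a, b])
    rw [← h1] at h2
    convert h2 using 2
    · funext i; fin_cases i <;> rfl
    · congr 1
      funext i; fin_cases i <;> rfl
  rw [insertHom_apply]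
  simp only [e]
  rw [show (Finset.univ : Finset (Equiv.Perm (Fin (2 + 1)))) =
    {1, Equiv.swap 0 1, Equiv.swap 0 2, Equiv.swap 1 2, Equiv.swap 0 1 * Equiv.swap 1 2,
      Equiv.swap 1 2 * Equiv.swap 0 1} from by decide]
  rw [Finset.sum_insert (by decide), Finset.sum_insert (by decide), Finset.sum_insert (by decide),
    Finset.sum_insert (by decide), Finset.sum_insert (by decide), Finset.sum_singleton]
  simp [Equiv.swap_apply_def, Equiv.Perm.sign_mul]
  have r1 := sw f g h
  have r2 := sw g h f
  have r3 := sw h f g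
  rw [r1, r2, r3]
  module

theorem insertHom_zero_fst {p q : ℕ} (Q : A [⋀^Fin q]→ₗ[ℝ] A) :
    insertHom (0 : A [⋀^Fin (p + 1)]→ₗ[ℝ] A) Q = 0 := by
  ext f; simp [insertHom_apply]

theorem insertHom_zero_snd {p q : ℕ} (P : A [⋀^Fin (p + 1)]→ₗ[ℝ] A) :
    insertHom P (0 : A [⋀^Fin q]→ₗ[ℝ] A) = 0 := by
  ext f
  rw [insertHom_apply, Finset.sum_eq_zero, smul_zero]; · rfl
  intro σ _
  rw [P.map_coord_zero 0 (by simp), smul_zero]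

end Algebra

section Brackets

variable {n : ℕ} {M : Type*} [TopologicalSpace M] [ChartedSpace (EuclideanSpace ℝ (Fin n)) M]

@[simp] theorem ofFun_zero (g : SmoothFun n M) (v : Fin 0 → SmoothFun n M) :
    ofFun g 0 v = g := by
  simp [ofFun]

theorem isHomogeneous_ofFun (g : SmoothFun n M) : IsHomogeneous 0 (ofFun g) := by
  intro j hj
  simp [ofFun, hj]

@[simp] theorem ofFun_succ (g : SmoothFun n M) (m : ℕ) : ofFun g (m + 1) = 0 :=
  isHomogeneous_ofFun g _ (Nat.succ_ne_zero m)

theorem bracket_ofFun_right (P : Cochain n M) (g : SmoothFun n M) (m : ℕ)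
    (f : Fin m → SmoothFun n M) :
    bracket P (ofFun g) m f = P (m + 1) (Fin.cons g f) := by
  rw [bracket, Fintype.sum_eq_single ⟨(0, m), by simp⟩]
  · simp [insertHom_zero_right, insertHom_zero_fst]
  · rintro ⟨⟨a, b⟩, h⟩ hne
    obtain _ | a := a
    · simp at h; simp [h] at hne
    · simp [insertHom_zero_fst, insertHom_zero_snd]

theorem bracket_ofFun_left (P : Cochain n M) (g : SmoothFun n M) (m : ℕ)
    (f : Fin m → SmoothFun n M) :
    bracket (ofFun g) P m f = - ((-1 : ℝ) ^ m • P (m + 1) (Fin.cons g f)) := by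
  rw [bracket, Fintype.sum_eq_single ⟨(0, m), by simp⟩]
  · simp [insertHom_zero_right, insertHom_zero_fst]
  · rintro ⟨⟨a, b⟩, h⟩ hne
    obtain _ | a := a
    · simp at h; simp [h] at hne
    · simp [insertHom_zero_fst, insertHom_zero_snd]

theorem bracket_vectorField_one (P X : Cochain n M) (hX : IsHomogeneous 1 X)
    (f : SmoothFun n M) :
    bracket P X 1 ![f] = P 1 ![X 1 ![f]] - X 1 ![P 1 ![f]] := by
  rw [bracket, Fintype.sum_eq_single ⟨(1, 0), by simp⟩]
  · simp [insertHom_zero_left]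
  · rintro ⟨⟨a, b⟩, h⟩ hne
    have h : a + b = 1 := by simpa using h
    have ha : a ≠ 1 := by rintro rfl; simp at h; simp [h] at hne
    simp [hX a ha, hX (b + 1) (by omega), insertHom_zero_fst, insertHom_zero_snd]

theorem bracket_vectorField_two (P X : Cochain n M) (hX : IsHomogeneous 1 X)
    (f g : SmoothFun n M) :
    bracket P X 2 ![f, g] =
      P 2 ![X 1 ![f], g] - P 2 ![X 1 ![g], f] - X 1 ![P 2 ![f, g]] := by
  rw [bracket, Fintype.sum_eq_add ⟨(1, 1), by simp⟩ ⟨(2, 0), by simp⟩ (by simp)]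
  · have h1 := insertHom_one_one (P 2) (X 1) f g
    have h2 := insertHom_zero_left (X 1) (P 2) ![f, g]
    simp [hX 2 (by simp), insertHom_zero_fst, insertHom_zero_snd]
    rw [sub_eq_add_neg]
    exact congr($h1 + -$h2)
  · rintro ⟨⟨a, b⟩, h⟩ ⟨hne, hne2⟩
    have h : a + b = 2 := by simpa using h
    have ha : a ≠ 1 := by
      rintro rfl
      have : b = 1 := by omega
      simp [this] at hne
    have ha : a ≠ 2 := by rintro rfl; simp at h; simp [h] at hne2
    have ha : a = 0 := by omega
    simp [hX a (by omega), hX (b + 1) (by omega), insertHom_zero_fst, insertHom_zero_snd]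

theorem bracket_self_of_ne (P : Cochain n M) (hP : IsHomogeneous 2 P) (m : ℕ) (hm : m ≠ 3) :
    bracket P P m = 0 := by
  rw [bracket]
  apply Finset.sum_eq_zero
  rintro ⟨⟨a, b⟩, h⟩ -
  have h : a + b = m := by simpa using h
  by_cases ha : a = 2
  · simp [hP (b + 1) (by omega), insertHom_zero_fst]
  · simp [hP a ha, insertHom_zero_snd]

/-- The bracket of a bivector field with itself is twice its Jacobiator. -/
theorem bracket_self_three (P : Cochain n M) (hP : IsHomogeneous 2 P) (f g h : SmoothFun n M) :
    bracket P P 3 ![f, g, h] = (2 : ℝ) •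
      (P 2 ![P 2 ![f, g], h] + P 2 ![P 2 ![g, h], f] + P 2 ![P 2 ![h, f], g]) := by
  rw [bracket, Fintype.sum_eq_single ⟨(2, 1), by simp⟩]
  · have h1 := insertHom_one_two (P 2) (P 2) f g h
    norm_num
    rw [← two_smul ℝ, ← smul_add, ← smul_add]
    exact congr((2 : ℝ) • $h1)
  · rintro ⟨⟨a, b⟩, h⟩ hne
    have h : a + b = 3 := by simpa using h
    have ha : a ≠ 2 := by
      rintro rfl
      have : b = 1 := by omega
      simp [this] at hne
    simp [hP a ha, insertHom_zero_snd]

end Brackets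

end

/-! ### Exterior products of derivations -/

section

section Algebra
variable {A : Type*} [CommRing A] [Algebra ℝ A]

theorem insertHom_add_fst {p q : ℕ} (P P' : A [⋀^Fin (p + 1)]→ₗ[ℝ] A) (Q : A [⋀^Fin q]→ₗ[ℝ] A) :
    insertHom (P + P') Q = insertHom P Q + insertHom P' Q := by
  ext f; simp [insertHom_apply, Finset.sum_add_distrib]

theorem insertHom_add_snd {p q : ℕ} (P : A [⋀^Fin (p + 1)]→ₗ[ℝ] A) (Q Q' : A [⋀^Fin q]→ₗ[ℝ] A) :
    insertHom P (Q + Q') = insertHom P Q + insertHom P Q' := by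
  ext f
  have h (x y : A) (v : Fin p → A) : P (Fin.cons (x + y) v) = P (Fin.cons x v) + P (Fin.cons y v) :=
    P.toMultilinearMap.cons_add v x y
  simp [insertHom_apply, Finset.sum_add_distrib, h]

/-- A derivation, seen as an alternating map of one argument. -/
def derivHom (D : Derivation ℝ A A) : A [⋀^Fin 1]→ₗ[ℝ] A :=
  AlternatingMap.ofSubsingleton ℝ A A (0 : Fin 1) D.toLinearMap

@[simp] theorem derivHom_apply (D : Derivation ℝ A A) (v : Fin 1 → A) : derivHom D v = D (v 0) :=
  rfl

/-- The exterior product of derivations, `f ↦ det (eₐ(f_b))`. -/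
def multiField {m : ℕ} (e : Fin m → Derivation ℝ A A) : A [⋀^Fin m]→ₗ[ℝ] A :=
  { ((Matrix.detRowAlternating (n := Fin m) (R := A)).toMultilinearMap.restrictScalars
      ℝ).compLinearMap (fun _ => LinearMap.pi fun a => (e a).toLinearMap) with
    map_eq_zero_of_eq' := fun f i j h hij => Matrix.det_zero_of_row_eq hij (by simp [h]) }

theorem multiField_eq_det {m : ℕ} (e : Fin m → Derivation ℝ A A) (f : Fin m → A) :
    multiField e f = Matrix.det (Matrix.of fun b a => e a (f b)) := rfl

theorem multiField_apply {m : ℕ} (e : Fin m → Derivation ℝ A A) (f : Fin m → A) :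
    multiField e f = ∑ σ : Equiv.Perm (Fin m), Equiv.Perm.sign σ • ∏ a, e a (f (σ a)) := by
  rw [multiField_eq_det, Matrix.det_apply]; rfl

theorem isMultiderivation_multiField {m : ℕ} (e : Fin m → Derivation ℝ A A) :
    IsMultiderivation (multiField e) := by
  intro v i a b
  have h (x : A) : (Matrix.of fun b a => e a (Function.update v i x b)) =
      (Matrix.of fun b a => e a (v b)).updateRow i (fun a => e a x) := by
    ext j k
    by_cases hj : j = i
    · subst hj; simp
    · simp [hj]
  simp only [multiField_eq_det, h]
  rw [← Matrix.det_updateRow_smul, ← Matrix.det_updateRow_smul, ← Matrix.det_updateRow_add]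
  congr 2
  ext k
  simp

theorem multiField_comp_perm {m : ℕ} (e : Fin m → Derivation ℝ A A) (τ : Equiv.Perm (Fin m)) :
    multiField (e ∘ τ) = (Equiv.Perm.sign τ : ℤ) • multiField e := by
  ext f
  have := Matrix.det_permute' τ (Matrix.of fun b a => e a (f b))
  rw [AlternatingMap.smul_apply, multiField_eq_det, multiField_eq_det, zsmul_eq_mul, ← this]
  rfl

theorem multiField_eq_zero {m : ℕ} (e : Fin m → Derivation ℝ A A) (h : ¬ Function.Injective e) :
    multiField e = 0 := by
  simp only [Function.Injective, not_forall] at h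
  obtain ⟨i, j, hij, hne⟩ := h
  ext f
  rw [multiField_eq_det, Matrix.det_zero_of_column_eq hne (fun k => by simp [hij])]
  rfl

/-- The expansion of the determinant along its last column. -/
theorem wedgeHom_multiField {m : ℕ} (e : Fin m → Derivation ℝ A A) (D : Derivation ℝ A A) :
    wedgeHom (multiField e) (derivHom D) = multiField (Fin.snoc (α := fun _ => _) e D) := by
  ext f
  rw [wedgeHom_apply]
  -- the sum over `σ` is reindexed by `σ ↦ σ ∘ (τ ⊔ 1)`, so that each `τ` contributes a determinant
  have key (τ : Equiv.Perm (Fin m)) :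
      ∑ σ : Equiv.Perm (Fin (m + 1)), Equiv.Perm.sign σ • ((Equiv.Perm.sign τ •
        ∏ a, e a (f (σ (Fin.castAdd 1 (τ a))))) * D (f (σ (Fin.natAdd m 0)))) =
      multiField (Fin.snoc (α := fun _ => Derivation ℝ A A) e D) f := by
    set t : Equiv.Perm (Fin (m + 1)) := finSumFinEquiv.permCongr (Equiv.Perm.sumCongr τ 1) with ht
    have hs : Equiv.Perm.sign t = Equiv.Perm.sign τ := by
      simp [ht, Equiv.Perm.sign_permCongr]
    rw [multiField_apply]
    conv_rhs => rw [← Equiv.sum_comp (Equiv.mulRight t)]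
    refine Finset.sum_congr rfl fun σ _ => ?_
    simp only [Equiv.coe_mulRight, Equiv.Perm.sign_mul, hs, Fin.prod_univ_castSucc,
      Fin.snoc_castSucc, Fin.snoc_last]
    rw [smul_mul_assoc, smul_smul]
    congr 2
    · refine Finset.prod_congr rfl fun a _ => ?_
      congr 2
      simp only [Equiv.Perm.mul_apply]
      congr 1
      have : finSumFinEquiv.symm (Fin.castSucc a) = (Sum.inl a : Fin m ⊕ Fin 1) :=
        finSumFinEquiv_symm_apply_castAdd a
      simp [ht, Equiv.permCongr_apply, this]
    · simp only [Equiv.Perm.mul_apply]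
      congr 3
      have : finSumFinEquiv.symm (Fin.last m) = (Sum.inr 0 : Fin m ⊕ Fin 1) :=
        finSumFinEquiv_symm_last
      simp [ht, Equiv.permCongr_apply, this]
  have h2 : ∀ σ : Equiv.Perm (Fin (m + 1)), Equiv.Perm.sign σ •
      ((multiField e) (fun i => f (σ (Fin.castAdd 1 i))) *
        (derivHom D) (fun i => f (σ (Fin.natAdd m i)))) =
      ∑ τ : Equiv.Perm (Fin m), Equiv.Perm.sign σ • ((Equiv.Perm.sign τ •
        ∏ a, e a (f (σ (Fin.castAdd 1 (τ a))))) * D (f (σ (Fin.natAdd m 0)))) := by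
    intro σ
    rw [multiField_apply, Finset.sum_mul, Finset.smul_sum]; rfl
  simp only [h2]
  rw [Finset.sum_comm]
  simp only [key]
  rw [Finset.sum_const, Finset.card_univ, Fintype.card_perm, Fintype.card_fin,
    ← Nat.cast_smul_eq_nsmul ℝ, smul_smul]
  have : (0 : ℝ) < (m.factorial : ℝ) := by positivity
  simp [this.ne']

end Algebra

section Cochains
variable {n : ℕ} {M : Type*} [TopologicalSpace M] [ChartedSpace (EuclideanSpace ℝ (Fin n)) M]

theorem bracket_add_right (P Q Q' : Cochain n M) :
    bracket P (Q + Q') = bracket P Q + bracket P Q' := by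
  funext m
  simp only [bracket, Pi.add_apply, insertHom_add_fst, insertHom_add_snd]
  rw [← Finset.sum_add_distrib]
  refine Finset.sum_congr rfl fun x _ => ?_
  ext f : 1
  simp only [AlternatingMap.add_apply, AlternatingMap.sub_apply, AlternatingMap.smul_apply,
    AlternatingMap.domDomCongr_apply, smul_add]
  abel

/-- Graded antisymmetry of the bracket with a bivector field. -/
theorem bracket_comm_of_bivector (P Q : Cochain n M) (hQ : IsHomogeneous 2 Q) (m : ℕ) :
    bracket P Q m = - ((-1 : ℝ) ^ m • bracket Q P m) := by
  simp only [bracket]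
  rw [Finset.smul_sum, ← Finset.sum_neg_distrib]
  refine Finset.sum_congr rfl fun ⟨⟨a, b⟩, h⟩ _ => ?_
  have h : a + b = m := by simpa using h
  subst h
  by_cases ha : a = 2 <;> by_cases hb : b = 1
  · subst ha hb
    have e1 : (-1 : ℝ) ^ ((2 + 1) * 1) = -1 := by norm_num
    ext f : 1
    simp only [AlternatingMap.sub_apply, AlternatingMap.smul_apply, AlternatingMap.neg_apply,
      AlternatingMap.domDomCongr_apply, e1]
    module
  · subst ha
    have e : (-1 : ℝ) ^ (2 + b) * (-1 : ℝ) ^ ((2 + 1) * b) = 1 := by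
      rw [← pow_add]
      exact Even.neg_one_pow ⟨2 * b + 1, by ring⟩
    rw [hQ (b + 1) (by omega)]
    ext f : 1
    simp only [insertHom_zero_fst, AlternatingMap.sub_apply, AlternatingMap.smul_apply,
      AlternatingMap.neg_apply, AlternatingMap.domDomCongr_apply, AlternatingMap.zero_apply,
      smul_zero, sub_zero, zero_sub, smul_neg, neg_neg, smul_smul, e, one_smul]
  · subst hb
    rw [hQ a ha]
    simp [insertHom_zero_snd]
  · rw [hQ a ha, hQ (b + 1) (by omega)]
    simp [insertHom_zero_fst, insertHom_zero_snd]

/-- The degree `m` part of `{P₂, Q}` only involves the degree `m - 1` part of `Q`. -/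
theorem bracket_single_two (P Q : Cochain n M) (m : ℕ) :
    bracket (Pi.single 2 (P 2)) Q (m + 1) = bracket P (Pi.single m (Q m)) (m + 1) := by
  simp only [bracket]
  refine Finset.sum_congr rfl fun ⟨⟨a, b⟩, h⟩ _ => ?_
  have h : a + b = m + 1 := by simpa using h
  have h1 : insertHom ((Pi.single 2 (P 2) : Cochain n M) (b + 1)) (Q a) =
      insertHom (P (b + 1)) ((Pi.single m (Q m) : Cochain n M) a) := by
    by_cases hb : b + 1 = 2
    · obtain rfl : b = 1 := by omega
      obtain rfl : a = m := by omega
      simp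
    · have : a ≠ m := by omega
      simp [hb, this, insertHom_zero_fst, insertHom_zero_snd]
  have h2 : insertHom (Q (b + 1)) ((Pi.single 2 (P 2) : Cochain n M) a) =
      insertHom ((Pi.single m (Q m) : Cochain n M) (b + 1)) (P a) := by
    by_cases hb : a = 2
    · subst hb
      obtain rfl : b + 1 = m := by omega
      simp
    · have : b + 1 ≠ m := by omega
      simp [hb, this, insertHom_zero_fst, insertHom_zero_snd]
  simp only [h1, h2]

theorem bracket_single_two_zero (P Q : Cochain n M) :
    bracket (Pi.single 2 (P 2)) Q 0 = 0 := by
  simp only [bracket]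
  refine Finset.sum_eq_zero fun ⟨⟨a, b⟩, h⟩ _ => ?_
  have h : a + b = 0 := by simpa using h
  have ha : a ≠ 2 := by omega
  have hb : b + 1 ≠ 2 := by omega
  simp [ha, hb, insertHom_zero_fst, insertHom_zero_snd]

/-- The vector field on `M` given by a derivation of the algebra of functions. -/
def ofDeriv (D : Derivation ℝ (SmoothFun n M) (SmoothFun n M)) : Cochain n M :=
  Pi.single 1 (derivHom D)

@[simp] theorem ofDeriv_one (D : Derivation ℝ (SmoothFun n M) (SmoothFun n M)) :
    ofDeriv D 1 = derivHom D := by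
  simp [ofDeriv]

theorem isHomogeneous_single (m : ℕ) (P : (SmoothFun n M) [⋀^Fin m]→ₗ[ℝ] (SmoothFun n M)) :
    IsHomogeneous m (Pi.single m P : Cochain n M) := by
  intro j hj; simp [hj]

theorem single_mem_functions {m : ℕ} {P : (SmoothFun n M) [⋀^Fin m]→ₗ[ℝ] (SmoothFun n M)}
    (hP : IsMultiderivation P) : (Pi.single m P : Cochain n M) ∈ functions n M := by
  intro k
  by_cases h : k = m
  · subst h; simpa using hP
  · intro v i a b
    simp [h]

theorem ofDeriv_mem_functions (D : Derivation ℝ (SmoothFun n M) (SmoothFun n M)) :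
    ofDeriv D ∈ functions n M := by
  refine single_mem_functions ?_
  intro v i a b
  obtain rfl : i = 0 := Subsingleton.elim _ _
  simp

theorem ofFun_mem_functions (g : SmoothFun n M) : ofFun g ∈ functions n M :=
  single_mem_functions fun _ i => i.elim0

theorem wedge_ofFun (P : Cochain n M) (g : SmoothFun n M) (m : ℕ) (f : Fin m → SmoothFun n M) :
    wedge P (ofFun g) m f = P m f * g := by
  rw [wedge, Fintype.sum_eq_single ⟨(m, 0), by simp⟩]
  · rw [AlternatingMap.domDomCongr_apply, wedgeHom_apply]
    have h (σ : Equiv.Perm (Fin (m + 0))) : Equiv.Perm.sign σ • (P m (fun i => f (σ i)) * g) =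
        P m f * g := by
      have := (P m).map_perm f σ
      rw [Function.comp_def] at this
      rw [this, smul_mul_assoc, smul_smul, Int.units_mul_self, one_smul]
    have h2 : ∀ σ : Equiv.Perm (Fin (m + 0)), Equiv.Perm.sign σ •
      (P m (fun i => (f ∘ finCongr (by simp)) (σ (Fin.castAdd 0 i))) *
        ofFun g 0 (fun i => (f ∘ finCongr (by simp)) (σ (Fin.natAdd m i)))) = P m f * g := by
      intro σ
      rw [ofFun_zero]
      exact h σ
    simp only [h2]
    rw [Finset.sum_const, Finset.card_univ, Fintype.card_perm, Fintype.card_fin,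
      ← Nat.cast_smul_eq_nsmul ℝ, smul_smul]
    have : (0 : ℝ) < (m.factorial : ℝ) := by positivity
    simp [this.ne']
  · rintro ⟨⟨a, b⟩, h⟩ hne
    obtain _ | b := b
    · simp at h; simp [h] at hne
    · ext f : 1
      simp [wedgeHom_apply]

theorem wedge_single_ofDeriv {m : ℕ} (P : (SmoothFun n M) [⋀^Fin m]→ₗ[ℝ] (SmoothFun n M))
    (D : Derivation ℝ (SmoothFun n M) (SmoothFun n M)) :
    wedge (Pi.single m P) (ofDeriv D) = Pi.single (m + 1) (wedgeHom P (derivHom D)) := by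
  funext k
  by_cases hk : k = m + 1
  · subst hk
    rw [wedge, Fintype.sum_eq_single ⟨(m, 1), by simp⟩]
    · ext f : 1
      simp
    · rintro ⟨⟨a, b⟩, h⟩ hne
      have h : a + b = m + 1 := by simpa using h
      have ha : a ≠ m := by
        rintro rfl
        obtain rfl : b = 1 := by omega
        simp at hne
      ext f : 1
      simp [ha, wedgeHom_apply]
  · rw [Pi.single_eq_of_ne hk, wedge]
    refine Finset.sum_eq_zero fun ⟨⟨a, b⟩, h⟩ _ => ?_
    have h : a + b = k := by simpa using h
    ext f : 1
    by_cases ha : a = m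
    · have hb : b ≠ 1 := by omega
      simp [wedgeHom_apply, ofDeriv, hb]
    · simp [wedgeHom_apply, ha]

end Cochains

end

/-! ### Hadamard's lemma -/

section

section Hadamard

universe u

/-- Differentiation under the integral sign: an integral over `[0, 1]` depends smoothly on
parameters. -/
theorem contDiff_intervalIntegral_nat {E : Type u} [NormedAddCommGroup E] [NormedSpace ℝ E]
    [FiniteDimensional ℝ E] (k : ℕ) :
    ∀ {G : Type u} [NormedAddCommGroup G] [NormedSpace ℝ G] [CompleteSpace G]
      {F : E × ℝ → G}, ContDiff ℝ k F → ContDiff ℝ k fun u => ∫ t in (0 : ℝ)..1, F (u, t) := by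
  induction k with
  | zero =>
    intro G _ _ _ F hF
    have hF : Continuous F := hF.continuous
    refine contDiff_zero.2 ?_
    exact intervalIntegral.continuous_parametric_intervalIntegral_of_continuous' (by fun_prop) _ _
  | succ k ih =>
    intro G _ _ _ F hF
    have hF1 : ContDiff ℝ 1 F := hF.of_le (by norm_cast; omega)
    have hFc : Continuous F := hF.continuous
    set F' : E × ℝ → E →L[ℝ] G := fun p => (fderiv ℝ F p).comp (ContinuousLinearMap.inl ℝ E ℝ)
      with hF'
    have hF'c : ContDiff ℝ k F' := by
      have : ContDiff ℝ k (fderiv ℝ F) := hF.fderiv_right (by norm_cast)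
      fun_prop
    have hF'cont : Continuous F' := hF'c.continuous
    have hd (u : E) (t : ℝ) : HasFDerivAt (fun x => F (x, t)) (F' (u, t)) u := by
      have h1 : HasFDerivAt F (fderiv ℝ F (u, t)) (u, t) :=
        (hF1.differentiable (by simp) _).hasFDerivAt
      exact h1.comp u (hasFDerivAt_prodMk_left u t)
    have key (u : E) : HasFDerivAt (fun x => ∫ t in (0 : ℝ)..1, F (x, t))
        (∫ t in (0 : ℝ)..1, F' (u, t)) u := by
      obtain ⟨C, hC⟩ := ((isCompact_closedBall u 1).prod (isCompact_Icc (a := (0 : ℝ))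
        (b := 1))).exists_bound_of_continuousOn hF'cont.continuousOn
      refine intervalIntegral.hasFDerivAt_integral_of_dominated_of_fderiv_le
        (F' := fun x t => F' (x, t)) (bound := fun _ => C)
        (Metric.closedBall_mem_nhds u one_pos) ?_ ?_ ?_ ?_ ?_ ?_
      · exact Filter.Eventually.of_forall fun x => (by fun_prop :
          Continuous fun t => F (x, t)).aestronglyMeasurable
      · exact (by fun_prop : Continuous fun t => F (u, t)).intervalIntegrable _ _
      · exact (by fun_prop : Continuous fun t => F' (u, t)).aestronglyMeasurable
      · refine Filter.Eventually.of_forall fun t ht x hx => hC _ ⟨hx, ?_⟩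
        rw [Set.uIoc_of_le zero_le_one] at ht
        exact ⟨ht.1.le, ht.2⟩
      · exact intervalIntegrable_const
      · exact Filter.Eventually.of_forall fun t _ x _ => hd x t
    rw [Nat.cast_succ, contDiff_succ_iff_fderiv]
    refine ⟨fun u => (key u).differentiableAt, by simp, ?_⟩
    have : fderiv ℝ (fun x => ∫ t in (0 : ℝ)..1, F (x, t)) =
        fun u => ∫ t in (0 : ℝ)..1, F' (u, t) :=
      funext fun u => (key u).fderiv
    rw [this]
    exact ih hF'c

/-- Hadamard's lemma: `f u = f a + G u (u - a)` with `G` smooth. -/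
theorem exists_hadamard {E : Type} [NormedAddCommGroup E] [NormedSpace ℝ E]
    [FiniteDimensional ℝ E] {f : E → ℝ} (hf : ContDiff ℝ ∞ f) (a : E) :
    ∃ G : E → E →L[ℝ] ℝ, ContDiff ℝ ∞ G ∧ G a = fderiv ℝ f a ∧ ∀ u, f u = f a + G u (u - a) := by
  set F : E × ℝ → E →L[ℝ] ℝ := fun p => fderiv ℝ f (a + p.2 • (p.1 - a)) with hF
  have hf' : ContDiff ℝ ∞ (fderiv ℝ f) := hf.fderiv_right (by simp)
  have hFs : ContDiff ℝ ∞ F := by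
    refine hf'.comp ?_
    fun_prop
  refine ⟨fun u => ∫ t in (0 : ℝ)..1, F (u, t), ?_, by simp [hF], fun u => ?_⟩
  · exact contDiff_infty.2 fun k => contDiff_intervalIntegral_nat k
      (hFs.of_le (mod_cast le_top))
  · have hd (t : ℝ) : HasDerivAt (fun t : ℝ => f (a + t • (u - a))) (F (u, t) (u - a)) t := by
      have h1 : HasFDerivAt f (fderiv ℝ f (a + t • (u - a))) (a + t • (u - a)) :=
        (hf.differentiable (by simp) _).hasFDerivAt
      have h2 : HasDerivAt (fun t : ℝ => a + t • (u - a)) (u - a) t := by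
        simpa using ((hasDerivAt_id t).smul_const (u - a)).const_add a
      exact h1.comp_hasDerivAt t h2
    have hcont : Continuous fun t => F (u, t) := hFs.continuous.comp (by fun_prop)
    have h3 := intervalIntegral.integral_eq_sub_of_hasDerivAt (a := 0) (b := 1)
      (fun t _ => hd t)
      ((by fun_prop : Continuous fun t => F (u, t) (u - a)).intervalIntegrable _ _)
    rw [ContinuousLinearMap.intervalIntegral_apply (hcont.intervalIntegrable _ _), h3]
    simp

end Hadamard

end

/-! ### Differentials of functions -/

section

section Differential

variable {n : ℕ} {M : Type*} [TopologicalSpace M] [ChartedSpace (EuclideanSpace ℝ (Fin n)) M]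

theorem mdifferentiableAt_smoothFun (f : SmoothFun n M) (x : M) :
    MDifferentiableAt (𝓡 n) 𝓘(ℝ, ℝ) f x :=
  (f.contMDiff x).mdifferentiableAt (by simp)

/-- The differential of functions at the point `x`, as a linear map to the cotangent space. -/
def dAt (x : M) : SmoothFun n M →ₗ[ℝ] (TangentSpace (𝓡 n) x →L[ℝ] ℝ) where
  toFun f := (mfderiv (𝓡 n) 𝓘(ℝ, ℝ) f x : _)
  map_add' f g :=
    mfderiv_add (mdifferentiableAt_smoothFun f x) (mdifferentiableAt_smoothFun g x)
  map_smul' c f := const_smul_mfderiv (mdifferentiableAt_smoothFun f x) c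

theorem dAt_apply (x : M) (f : SmoothFun n M) (v : TangentSpace (𝓡 n) x) :
    dAt x f v = (mfderiv (𝓡 n) 𝓘(ℝ, ℝ) f x v : ℝ) := rfl

theorem dAt_mul (x : M) (f g : SmoothFun n M) :
    dAt x (f * g) = f x • dAt x g + g x • dAt x f :=
  ((mdifferentiableAt_smoothFun f x).hasMFDerivAt.mul
    (mdifferentiableAt_smoothFun g x).hasMFDerivAt).mfderiv

theorem dAt_congr {x : M} {f g : SmoothFun n M} (h : f =ᶠ[𝓝 x] g) : dAt x f = dAt x g :=
  h.mfderiv_eq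

theorem dAt_const (x : M) (c : ℝ) : dAt x (algebraMap ℝ (SmoothFun n M) c) = 0 :=
  mfderiv_const

variable [IsManifold (𝓡 n) ∞ M]

theorem exists_bump [T2Space M] {x : M} {U : Set M} (hU : U ∈ 𝓝 x) :
    ∃ χ : SmoothFun n M, χ =ᶠ[𝓝 x] (1 : M → ℝ) ∧ tsupport χ ⊆ U := by
  obtain ⟨b, -, hb⟩ := (SmoothBumpFunction.nhds_basis_tsupport (I := 𝓡 n) x).mem_iff.1 hU
  exact ⟨⟨b, b.contMDiff⟩, b.eventuallyEq_one, hb⟩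

omit [IsManifold (𝓡 n) ∞ M] in
/-- A cutoff with support in `U` makes a smooth function on `U` global. -/
theorem exists_smoothFun_eq_mul {U : Set M} (hU : IsOpen U) {χ : SmoothFun n M}
    (hχ : tsupport χ ⊆ U) {g : M → ℝ} (hg : ContMDiffOn (𝓡 n) 𝓘(ℝ, ℝ) ∞ g U) :
    ∃ f : SmoothFun n M, ∀ y, f y = χ y * g y := by
  refine ⟨⟨fun y => χ y * g y, contMDiff_of_tsupport fun y hy => ?_⟩, fun y => rfl⟩
  have hy : y ∈ U := hχ (closure_mono (Function.support_mul_subset_left _ _) hy)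
  exact (χ.contMDiff y).mul ((hg y hy).contMDiffAt (hU.mem_nhds hy))

theorem exists_smoothFun_eventuallyEq [T2Space M] {x : M} {U : Set M} (hU : IsOpen U) (hx : x ∈ U)
    {g : M → ℝ} (hg : ContMDiffOn (𝓡 n) 𝓘(ℝ, ℝ) ∞ g U) :
    ∃ f : SmoothFun n M, f =ᶠ[𝓝 x] g := by
  obtain ⟨χ, h1, h2⟩ := exists_bump (n := n) (hU.mem_nhds hx)
  obtain ⟨f, hf⟩ := exists_smoothFun_eq_mul hU h2 hg
  refine ⟨f, ?_⟩
  filter_upwards [h1] with y hy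
  simp [hf, hy]

theorem contMDiffOn_extChartAt_coord (x : M) (k : Fin n) :
    ContMDiffOn (𝓡 n) 𝓘(ℝ, ℝ) ∞ (fun y => extChartAt (𝓡 n) x y k) (extChartAt (𝓡 n) x).source := by
  have h := contMDiffOn_extChartAt (I := 𝓡 n) (n := ∞) (x := x)
  have h2 : ContMDiff 𝓘(ℝ, EuclideanSpace ℝ (Fin n)) 𝓘(ℝ, ℝ) ∞
      (fun u : EuclideanSpace ℝ (Fin n) => u k) := by
    rw [contMDiff_iff_contDiff]; fun_prop
  rw [extChartAt_source]
  exact h2.comp_contMDiffOn h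

theorem contDiffOn_comp_extChartAt_symm (f : SmoothFun n M) (x : M) :
    ContDiffOn ℝ ∞ (f ∘ (extChartAt (𝓡 n) x).symm) (extChartAt (𝓡 n) x).target := by
  rw [← contMDiffOn_iff_contDiffOn]
  exact f.contMDiff.comp_contMDiffOn (contMDiffOn_extChartAt_symm x)

/-- The tangent vector at `y` of the `l`-th coordinate line of the chart at `x`; it is meaningful
for `y` in the domain of the chart only, as `ContinuousLinearMap.inverse` is zero on maps which
are not invertible. -/
def coordVector (x y : M) (l : Fin n) : TangentSpace (𝓡 n) y :=
  (mfderiv (𝓡 n) 𝓘(ℝ, EuclideanSpace ℝ (Fin n)) (extChartAt (𝓡 n) x) y).inverse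
    (EuclideanSpace.single l (1 : ℝ))

theorem fderiv_comp_extChartAt_symm (f : SmoothFun n M) {x y : M}
    (hy : y ∈ (extChartAt (𝓡 n) x).source) (l : Fin n) :
    fderiv ℝ (f ∘ (extChartAt (𝓡 n) x).symm) (extChartAt (𝓡 n) x y)
      (EuclideanSpace.single l (1 : ℝ)) = dAt y f (coordVector x y l) := by
  set φ := extChartAt (𝓡 n) x with hφ
  have hinv : (mfderiv (𝓡 n) 𝓘(ℝ, EuclideanSpace ℝ (Fin n)) φ y).IsInvertible :=
    isInvertible_mfderiv_extChartAt hy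
  have h1 : MDifferentiableAt (𝓡 n) 𝓘(ℝ, EuclideanSpace ℝ (Fin n)) φ y :=
    mdifferentiableAt_extChartAt (by rwa [← extChartAt_source (I := 𝓡 n)])
  have h2 : DifferentiableAt ℝ (f ∘ φ.symm) (φ y) :=
    ((contDiffOn_comp_extChartAt_symm f x).contDiffAt
      ((isOpen_extChartAt_target x).mem_nhds (φ.map_source hy))).differentiableAt (by simp)
  have h3 : f =ᶠ[𝓝 y] (f ∘ φ.symm) ∘ φ := by
    filter_upwards [(isOpen_extChartAt_source (I := 𝓡 n) x).mem_nhds hy] with z hz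
    simp only [Function.comp_apply]
    rw [φ.left_inv hz]
  have h4 (v : TangentSpace (𝓡 n) y) : dAt y f v = fderiv ℝ (f ∘ φ.symm) (φ y)
      (mfderiv (𝓡 n) 𝓘(ℝ, EuclideanSpace ℝ (Fin n)) φ y v) := by
    rw [dAt_apply, h3.mfderiv_eq, ← mfderiv_eq_fderiv,
      mfderiv_comp y h2.mdifferentiableAt h1]
    rfl
  rw [h4]
  congr 1
  obtain ⟨e, he⟩ := hinv
  rw [coordVector, ← hφ, ← he, ContinuousLinearMap.inverse_equiv]
  exact (e.apply_symm_apply _).symm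

/-- A system of global functions `y` and derivations `∂` which near `x` are local coordinates and
the corresponding coordinate vector fields. -/
theorem exists_localCoordinates [T2Space M] (x : M) :
    ∃ (y : Fin n → SmoothFun n M) (D : Fin n → Derivation ℝ (SmoothFun n M) (SmoothFun n M)),
      ∀ᶠ z in 𝓝 x, ∃ b : Module.Basis (Fin n) ℝ (TangentSpace (𝓡 n) z),
        (∀ l f, D l f z = dAt z f (b l)) ∧ ∀ l k, dAt z (y k) (b l) = if l = k then 1 else 0 := by
  set φ := extChartAt (𝓡 n) x with hφ
  have hso : IsOpen φ.source := isOpen_extChartAt_source x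
  obtain ⟨χ, h1, h2⟩ := exists_bump (n := n) (hso.mem_nhds (mem_extChartAt_source (I := 𝓡 n) x))
  choose y hy using fun k : Fin n => exists_smoothFun_eq_mul hso h2
    (contMDiffOn_extChartAt_coord x k)
  have hD (l : Fin n) (f : SmoothFun n M) : ∃ g : SmoothFun n M, ∀ z,
      g z = χ z * dAt z f (coordVector x z l) := by
    refine exists_smoothFun_eq_mul hso h2 ?_
    have h3 : ContDiffOn ℝ ∞ (fun u => fderiv ℝ (f ∘ φ.symm) u
        (EuclideanSpace.single l (1 : ℝ))) φ.target :=
      ((contDiffOn_comp_extChartAt_symm f x).fderiv_of_isOpen (isOpen_extChartAt_target x)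
        (by simp)).clm_apply contDiffOn_const
    have h4 := contMDiffOn_extChartAt (I := 𝓡 n) (n := ∞) (x := x)
    rw [← extChartAt_source (I := 𝓡 n)] at h4
    refine (h3.contMDiffOn.comp h4 fun z hz => φ.map_source hz).congr fun z hz => ?_
    exact (fderiv_comp_extChartAt_symm f hz l).symm
  choose D hD using hD
  have hleib (l : Fin n) (f g : SmoothFun n M) : D l (f * g) = f • D l g + g • D l f := by
    ext z
    simp [hD, dAt_mul]
    ring
  refine ⟨y, fun l => Derivation.mk'
    { toFun := D l
      map_add' := fun f g => by ext z; simp [hD, mul_add]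
      map_smul' := fun c f => by ext z; simp [hD]; ring } (hleib l), ?_⟩
  filter_upwards [h1.eventually_nhds, hso.mem_nhds (mem_extChartAt_source (I := 𝓡 n) x)]
    with z hz hzs
  have hz1 : χ z = 1 := hz.self_of_nhds
  obtain ⟨e, he⟩ : (mfderiv (𝓡 n) 𝓘(ℝ, EuclideanSpace ℝ (Fin n)) φ z).IsInvertible :=
    isInvertible_mfderiv_extChartAt hzs
  refine ⟨(EuclideanSpace.basisFun (Fin n) ℝ).toBasis.map
      (e.symm.toLinearEquiv : EuclideanSpace ℝ (Fin n) ≃ₗ[ℝ] TangentSpace (𝓡 n) z), ?_, ?_⟩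
  all_goals
    have hb (l : Fin n) : ((EuclideanSpace.basisFun (Fin n) ℝ).toBasis.map
      (e.symm.toLinearEquiv : EuclideanSpace ℝ (Fin n) ≃ₗ[ℝ] TangentSpace (𝓡 n) z)) l =
        coordVector x z l := by
      rw [coordVector, ← hφ, ← he, ContinuousLinearMap.inverse_equiv]
      have h0 : (EuclideanSpace.basisFun (Fin n) ℝ).toBasis l = EuclideanSpace.single l 1 := by simp
      exact (Module.Basis.map_apply _ _ _).trans (congrArg e.symm h0)
  · intro l f
    rw [hb]
    change D l f z = _
    rw [hD, hz1, one_mul]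
  · intro l k
    rw [hb, ← fderiv_comp_extChartAt_symm _ hzs]
    have h5 : (y k ∘ φ.symm) =ᶠ[𝓝 (φ z)] fun u => u k := by
      have h6 : ContinuousAt φ.symm (φ z) := continuousAt_extChartAt_symm' hzs
      have h7 : Filter.Tendsto φ.symm (𝓝 (φ z)) (𝓝 z) := by
        have := h6.tendsto
        rwa [φ.left_inv hzs] at this
      filter_upwards [h7.eventually hz,
        (isOpen_extChartAt_target x).mem_nhds (φ.map_source hzs)] with u hu hut
      simp only [Function.comp_apply, hy, hu, Pi.one_apply, one_mul]
      rw [← hφ, φ.right_inv hut]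
    rw [h5.fderiv_eq]
    have : (fun u : EuclideanSpace ℝ (Fin n) => u k) = EuclideanSpace.proj (𝕜 := ℝ) k := rfl
    rw [this, ContinuousLinearMap.fderiv]
    simp [eq_comm]

end Differential

end

/-! ### Point derivations and multiderivations -/

section

theorem smoothFun_sum_apply {n : ℕ} {M : Type*} [TopologicalSpace M]
    [ChartedSpace (EuclideanSpace ℝ (Fin n)) M] {ι : Type*} (s : Finset ι)
    (f : ι → SmoothFun n M) (x : M) : (∑ i ∈ s, f i) x = ∑ i ∈ s, f i x :=
  map_sum (ContMDiffMap.evalRingHom (I := 𝓡 n) (n := ∞) (R := ℝ) x) f s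

theorem smoothFun_prod_apply {n : ℕ} {M : Type*} [TopologicalSpace M]
    [ChartedSpace (EuclideanSpace ℝ (Fin n)) M] {ι : Type*} (s : Finset ι)
    (f : ι → SmoothFun n M) (x : M) : (∏ i ∈ s, f i) x = ∏ i ∈ s, f i x :=
  map_prod (ContMDiffMap.evalRingHom (I := 𝓡 n) (n := ∞) (R := ℝ) x) f s

section PointDerivation

variable {n : ℕ} {M : Type*} [TopologicalSpace M] [ChartedSpace (EuclideanSpace ℝ (Fin n)) M]
  [IsManifold (𝓡 n) ∞ M] [T2Space M]

/-- Point derivations are local: if `f` vanishes on the support of a bump function `χ`, then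
`χ * f = 0`. -/
theorem pointDerivation_eq_zero_of_eventuallyEq {x : M} {D : SmoothFun n M →ₗ[ℝ] ℝ}
    (hD : ∀ f g, D (f * g) = f x * D g + g x * D f) {f : SmoothFun n M}
    (hf : f =ᶠ[𝓝 x] (0 : M → ℝ)) : D f = 0 := by
  obtain ⟨χ, h1, h2⟩ := exists_bump (n := n) hf
  have h3 : χ * f = 0 := by
    ext y
    by_cases hy : y ∈ tsupport χ
    · have : f y = 0 := h2 hy
      simp [this]
    · simp [image_eq_zero_of_notMem_tsupport hy]
  have h4 := hD χ f
  have h5 : f x = 0 := hf.self_of_nhds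
  rw [h3, map_zero, h1.self_of_nhds, h5] at h4
  simpa using h4.symm

omit [IsManifold (𝓡 n) ∞ M] [T2Space M] in
theorem pointDerivation_one {x : M} {D : SmoothFun n M →ₗ[ℝ] ℝ}
    (hD : ∀ f g, D (f * g) = f x * D g + g x * D f) : D 1 = 0 := by
  have := hD 1 1
  simp at this
  exact this

/-- A derivation at a point only depends on the differential. -/
theorem pointDerivation_eq_zero {x : M} {D : SmoothFun n M →ₗ[ℝ] ℝ}
    (hD : ∀ f g, D (f * g) = f x * D g + g x * D f) {f : SmoothFun n M}
    (hf : dAt x f = 0) : D f = 0 := by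
  set φ := extChartAt (𝓡 n) x with hφ
  have hso : IsOpen φ.source := isOpen_extChartAt_source x
  have hxs : x ∈ φ.source := mem_extChartAt_source (I := 𝓡 n) x
  have hto : IsOpen φ.target := isOpen_extChartAt_target x
  have hxt : φ x ∈ φ.target := φ.map_source hxs
  -- a smooth function on the model space which agrees with `f` near `x` in the chart
  obtain ⟨F, hF, hFf⟩ : ∃ F : EuclideanSpace ℝ (Fin n) → ℝ, ContDiff ℝ ∞ F ∧
      F =ᶠ[𝓝 (φ x)] f ∘ φ.symm := by
    obtain ⟨F, hF⟩ := exists_smoothFun_eventuallyEq (n := n) hto hxt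
      (contDiffOn_comp_extChartAt_symm f x).contMDiffOn
    exact ⟨F, F.contMDiff.contDiff, hF⟩
  -- in the chart, `f - f x` is near `x` the sum of the products `y k * g k`, both of whose factors
  -- vanish at `x`
  obtain ⟨G, hG, hG0, hGf⟩ := exists_hadamard hF (φ x)
  have hφs := contMDiffOn_extChartAt (I := 𝓡 n) (n := ∞) (x := x)
  rw [← extChartAt_source (I := 𝓡 n)] at hφs
  choose y hy using fun k : Fin n => exists_smoothFun_eventuallyEq (n := n) hso hxs
    (g := fun z => φ z k - φ x k) ((contMDiffOn_extChartAt_coord x k).sub contMDiffOn_const)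
  choose g hg using fun k : Fin n => exists_smoothFun_eventuallyEq (n := n) hso hxs
    (g := fun z => G (φ z) (EuclideanSpace.single k (1 : ℝ)))
    ((hG.clm_apply contDiff_const).contMDiff.comp_contMDiffOn hφs)
  have key : (f - (algebraMap ℝ (SmoothFun n M) (f x) + ∑ k, y k * g k) : SmoothFun n M)
      =ᶠ[𝓝 x] (0 : M → ℝ) := by
    have h1 : ∀ᶠ z in 𝓝 x, F (φ z) = f (φ.symm (φ z)) :=
      (continuousAt_extChartAt (I := 𝓡 n) x).eventually hFf
    filter_upwards [Filter.eventually_all.2 hy, Filter.eventually_all.2 hg, h1,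
      hso.mem_nhds hxs] with z hz1 hz2 hz3 hzs
    rw [φ.left_inv hzs] at hz3
    have h2 : F (φ x) = f x := by simpa [φ.left_inv hxs] using hFf.self_of_nhds
    have h3 : φ z - φ x = ∑ k, (φ z k - φ x k) • EuclideanSpace.single k (1 : ℝ) := by
      ext i
      simp [Finset.sum_apply, Pi.single_apply]
    have h4 : f z = f x + ∑ k, (φ z k - φ x k) * G (φ z) (EuclideanSpace.single k (1 : ℝ)) := by
      rw [← hz3, hGf, h2, h3, map_sum]
      simp
    have h5 : ((∑ k, y k * g k : SmoothFun n M)) z = ∑ k, y k z * g k z := by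
      rw [smoothFun_sum_apply]
      simp
    have h6 : (algebraMap ℝ (SmoothFun n M) (f x)) z = f x := rfl
    simp only [ContMDiffMap.coe_sub, ContMDiffMap.coe_add, Pi.sub_apply, Pi.add_apply, h5, h6,
      hz1, hz2, h4, Pi.zero_apply, sub_self]
  have h7 := pointDerivation_eq_zero_of_eventuallyEq hD key
  rw [map_sub, map_add, map_sum, Algebra.algebraMap_eq_smul_one, map_smul,
    pointDerivation_one hD] at h7
  have h8 (k : Fin n) : D (y k * g k) = 0 := by
    have h9 : y k x = 0 := by simp [(hy k).self_of_nhds]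
    have h10 : g k x = 0 := by
      rw [(hg k).self_of_nhds]
      simp only
      rw [hG0, hFf.fderiv_eq, fderiv_comp_extChartAt_symm f hxs, hf]
      rfl
    rw [hD, h9, h10]
    simp
  simp only [h8] at h7
  simpa using h7

end PointDerivation

section Multiderivation

variable {n : ℕ} {M : Type*} [TopologicalSpace M] [ChartedSpace (EuclideanSpace ℝ (Fin n)) M]
  [IsManifold (𝓡 n) ∞ M] [T2Space M]

theorem multiderivation_update_eq_zero {m : ℕ}
    {P : (SmoothFun n M) [⋀^Fin m]→ₗ[ℝ] (SmoothFun n M)} (hP : IsMultiderivation P)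
    (f : Fin m → SmoothFun n M) (i : Fin m) {x : M} {g : SmoothFun n M} (h : dAt x g = 0) :
    P (Function.update f i g) x = 0 := by
  let D : SmoothFun n M →ₗ[ℝ] ℝ :=
    { toFun := fun g => P (Function.update f i g) x
      map_add' := fun a b => by rw [P.map_update_add]; rfl
      map_smul' := fun c a => by rw [P.map_update_smul]; rfl }
  exact pointDerivation_eq_zero (x := x) (D := D) (fun a b => congr($(hP f i a b) x)) h

/-- The value of a multivector field at a point only depends on the differentials of its
arguments. -/
theorem multiderivation_congr {m : ℕ}
    {P : (SmoothFun n M) [⋀^Fin m]→ₗ[ℝ] (SmoothFun n M)} (hP : IsMultiderivation P)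
    {f g : Fin m → SmoothFun n M} {x : M} (h : ∀ i, dAt x (f i) = dAt x (g i)) :
    P f x = P g x := by
  classical
  -- the arguments are replaced one at a time
  have key (s : Finset (Fin m)) : P f x = P (s.piecewise g f) x := by
    induction s using Finset.induction_on with
    | empty => simp
    | insert i s hi ih =>
      rw [ih, Finset.piecewise_insert]
      have h1 : dAt x (f i - g i) = 0 := by rw [map_sub, h, sub_self]
      have h2 := multiderivation_update_eq_zero hP (s.piecewise g f) i h1
      rw [P.map_update_sub] at h2
      have h3 : Function.update (s.piecewise g f) i (f i) = s.piecewise g f := by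
        rw [← Finset.piecewise_eq_of_notMem s g f hi, Function.update_eq_self]
      rw [h3] at h2
      exact sub_eq_zero.1 h2
  simpa using key Finset.univ

/-- A point derivation is given by a tangent vector. -/
theorem exists_tangentVector {x : M} {D : SmoothFun n M →ₗ[ℝ] ℝ}
    (hD : ∀ f g, D (f * g) = f x * D g + g x * D f) :
    ∃ v : TangentSpace (𝓡 n) x, ∀ f, D f = dAt x f v := by
  obtain ⟨y, E, h⟩ := exists_localCoordinates (n := n) x
  obtain ⟨b, h1, h2⟩ := h.self_of_nhds
  refine ⟨∑ l, D (y l) • b l, fun f => ?_⟩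
  have h3 : dAt x (f - ∑ l, dAt x f (b l) • y l) = 0 := by
    rw [map_sub, map_sum]
    refine ContinuousLinearMap.coe_injective (b.ext fun k => ?_)
    simp [h2]
  have h4 := pointDerivation_eq_zero hD h3
  rw [map_sub, map_sum, sub_eq_zero] at h4
  simp [h4, mul_comm]

theorem exists_dAt_eq {x : M} (ξ : TangentSpace (𝓡 n) x →ₗ[ℝ] ℝ) :
    ∃ f : SmoothFun n M, ∀ v, dAt x f v = ξ v := by
  obtain ⟨y, E, h⟩ := exists_localCoordinates (n := n) x
  obtain ⟨b, h1, h2⟩ := h.self_of_nhds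
  refine ⟨∑ l, ξ (b l) • y l, fun v => ?_⟩
  have : ((dAt x (∑ l, ξ (b l) • y l) : TangentSpace (𝓡 n) x →L[ℝ] ℝ) :
      TangentSpace (𝓡 n) x →ₗ[ℝ] ℝ) = ξ := by
    refine b.ext fun k => ?_
    simp [map_sum, h2]
  exact congr($this v)

/-- A derivation of the algebra of functions has a value in every tangent space. -/
theorem exists_derivation_value (D : Derivation ℝ (SmoothFun n M) (SmoothFun n M)) (x : M) :
    ∃ v : TangentSpace (𝓡 n) x, ∀ f, D f x = dAt x f v := by
  let D' : SmoothFun n M →ₗ[ℝ] ℝ :=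
    { toFun := fun g => D g x
      map_add' := fun a b => by rw [map_add]; rfl
      map_smul' := fun c a => by rw [D.map_smul]; rfl }
  exact exists_tangentVector (D := D') fun f g => by
    change D (f * g) x = f x * D g x + g x * D f x
    rw [D.leibniz]; rfl

end Multiderivation

end

/-! ### The body as an embedded submanifold -/

section

namespace GradedSubmanifold

variable {n : ℕ} {M : Type*} [TopologicalSpace M] [ChartedSpace (EuclideanSpace ℝ (Fin n)) M]
  [IsManifold (𝓡 n) ∞ M] (𝒞 : GradedSubmanifold n M)

/-- The body is locally a smooth retract of `M`. -/
theorem exists_retraction (c : 𝒞.body) : ∃ W : Set M, IsOpen W ∧ (c : M) ∈ W ∧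
    ∃ p : M → 𝒞.body, ContMDiffOn (𝓡 n) (𝓡 𝒞.dim) ∞ p W ∧ ∀ y : 𝒞.body, (y : M) ∈ W → p y = y := by
  obtain ⟨F, _, _, hF⟩ := 𝒞.isSmoothEmbedding.isImmersion
  have h := hF c
  set φ := h.domChart with hφ
  set ψ := h.codChart with hψ
  obtain ⟨W', hW'o, hW'⟩ := isOpen_induced_iff.1 φ.open_source
  have hψs : ContMDiffOn (𝓡 n) (𝓡 n) ∞ ψ ψ.source :=
    contMDiffOn_of_mem_maximalAtlas h.codChart_mem_maximalAtlas
  have hφs : ContMDiffOn (𝓡 𝒞.dim) (𝓡 𝒞.dim) ∞ φ.symm φ.target :=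
    contMDiffOn_symm_of_mem_maximalAtlas h.domChart_mem_maximalAtlas
  have hw (y : 𝒞.body) (hy : y ∈ φ.source) : ψ y = h.equiv (φ y, 0) := by
    have hmem : φ y ∈ (h.domChart.extend (𝓡 𝒞.dim)).target := by
      simpa [hφ] using φ.map_source hy
    have := h.writtenInCharts hmem
    simpa [φ.left_inv hy, ← hφ, ← hψ] using this
  set r : EuclideanSpace ℝ (Fin n) → EuclideanSpace ℝ (Fin 𝒞.dim) :=
    fun u => (h.equiv.symm u).1 with hr
  have hrs : ContDiff ℝ ∞ r := by fun_prop
  have hrs' : ContMDiff (𝓡 n) (𝓡 𝒞.dim) ∞ r := hrs.contMDiff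
  have hrc : Continuous r := hrs.continuous
  -- in the charts of an immersion the inclusion is `u ↦ (u, 0)`, and the retraction is the first
  -- projection; `W'` ensures that the body only meets the domain in the chart of the immersion
  refine ⟨(ψ.source ∩ ψ ⁻¹' (r ⁻¹' φ.target)) ∩ W',
    (ψ.isOpen_inter_preimage (φ.open_target.preimage hrc)).inter hW'o,
    ⟨⟨h.mem_codChart_source, ?_⟩, ?_⟩, fun z => φ.symm (r (ψ z)), ?_, ?_⟩
  · change r (ψ c) ∈ φ.target
    rw [hw c h.mem_domChart_source]
    simpa [hr] using φ.map_source h.mem_domChart_source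
  · have : c ∈ Subtype.val ⁻¹' W' := hW' ▸ h.mem_domChart_source
    exact this
  · exact hφs.comp (hrs'.comp_contMDiffOn (hψs.mono fun z hz => hz.1.1)) fun z hz => hz.1.2
  · intro y hy
    have hyφ : y ∈ φ.source := by
      rw [← hW']; exact hy.2
    change φ.symm (r (ψ y)) = y
    rw [hw y hyφ]
    simp [hr, φ.left_inv hyφ]

theorem tangent_coe (y : 𝒞.body) :
    𝒞.tangent (y : M) = LinearMap.range (𝒞.inclDeriv y).toLinearMap := by
  simp [tangent]

theorem mdifferentiableAt_incl (y : 𝒞.body) :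
    MDifferentiableAt (𝓡 𝒞.dim) (𝓡 n) (Subtype.val : 𝒞.body → M) y :=
  (𝒞.isSmoothEmbedding.contMDiff y).mdifferentiableAt (by simp)

theorem inclDeriv_mem_tangent (y : 𝒞.body) (w : TangentSpace (𝓡 𝒞.dim) y) :
    𝒞.inclDeriv y w ∈ 𝒞.tangent (y : M) := by
  rw [tangent_coe]; exact ⟨w, rfl⟩

theorem dAt_inclDeriv (f : SmoothFun n M) (y : 𝒞.body) (w : TangentSpace (𝓡 𝒞.dim) y) :
    dAt (y : M) f (𝒞.inclDeriv y w) =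
      (mfderiv (𝓡 𝒞.dim) 𝓘(ℝ, ℝ) (fun z : 𝒞.body => f z) y w : ℝ) := by
  have := mfderiv_comp_apply (I := 𝓡 𝒞.dim) (I' := 𝓡 n) (I'' := 𝓘(ℝ, ℝ)) y
    (mdifferentiableAt_smoothFun f (y : M)) (𝒞.mdifferentiableAt_incl y) w
  exact this.symm

/-- Along `TC`, the differential only depends on the restriction to `C`. -/
theorem dAt_tangent_congr {f g : SmoothFun n M} {y : M} {v : TangentSpace (𝓡 n) y}
    (hv : v ∈ 𝒞.tangent y) (hy : y ∈ 𝒞.body) (h : ∀ᶠ z in 𝓝[𝒞.body] y, f z = g z) :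
    dAt y f v = dAt y g v := by
  have h0 := 𝒞.tangent_coe ⟨y, hy⟩
  simp only at h0
  rw [h0] at hv
  obtain ⟨w, rfl⟩ := hv
  have h1 := 𝒞.dAt_inclDeriv f ⟨y, hy⟩ w
  have h2 := 𝒞.dAt_inclDeriv g ⟨y, hy⟩ w
  have h3 : (fun z : 𝒞.body => f z) =ᶠ[𝓝 (⟨y, hy⟩ : 𝒞.body)] fun z => g z := by
    rw [nhdsWithin_eq_map_subtype_coe hy] at h
    exact h
  rw [h3.mfderiv_eq] at h1
  exact h1.trans h2.symm

/-- The inclusion of the body is injective on tangent spaces. -/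
theorem inclDeriv_injective (y : 𝒞.body) : Function.Injective (𝒞.inclDeriv y) := by
  obtain ⟨W, hW, hyW, p, hp, hpW⟩ := 𝒞.exists_retraction y
  have h1 : MDifferentiableAt (𝓡 n) (𝓡 𝒞.dim) p y :=
    ((hp y hyW).contMDiffAt (hW.mem_nhds hyW)).mdifferentiableAt (by simp)
  have h2 : (p ∘ (Subtype.val : 𝒞.body → M)) =ᶠ[𝓝 y] id := by
    filter_upwards [(hW.preimage continuous_subtype_val).mem_nhds hyW] with z hz
    exact hpW z hz
  have h3 := h2.mfderiv_eq (I := 𝓡 𝒞.dim) (I' := 𝓡 𝒞.dim)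
  intro v w hvw
  have h4 (u : TangentSpace (𝓡 𝒞.dim) y) :
      mfderiv (𝓡 n) (𝓡 𝒞.dim) p y (𝒞.inclDeriv y u) = u := by
    have := mfderiv_comp_apply y h1 (𝒞.mdifferentiableAt_incl y) u
    rw [h3, mfderiv_id] at this
    exact this.symm
  rw [← h4 v, hvw, h4]

/-- Near a point of the body there are finitely many functions vanishing on the body, whose
differentials cut out the tangent spaces of the body. -/
theorem exists_conormalFrame [T2Space M] {c : M} (hc : c ∈ 𝒞.body) :
    ∃ κ : Fin n → SmoothFun n M, (∀ l, ∀ y ∈ 𝒞.body, κ l y = 0) ∧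
      ∀ᶠ y in 𝓝[𝒞.body] c, ∀ v : TangentSpace (𝓡 n) y,
        (∀ l, dAt y (κ l) v = 0) → v ∈ 𝒞.tangent y := by
  obtain ⟨W, hW, hcW, p, hp, hpW⟩ := 𝒞.exists_retraction ⟨c, hc⟩
  -- the functions `x l - x l ∘ p`, for a retraction `p` to the body, cut off outside its domain
  obtain ⟨x, D, hx⟩ := exists_localCoordinates (n := n) c
  obtain ⟨χ, hχ, hχW⟩ := exists_bump (n := n) (hW.mem_nhds hcW)
  have hg (l : Fin n) : ContMDiffOn (𝓡 n) 𝓘(ℝ, ℝ) ∞ (fun z => x l z - x l (p z)) W :=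
    (x l).contMDiff.contMDiffOn.sub (((x l).contMDiff.comp
      𝒞.isSmoothEmbedding.contMDiff).comp_contMDiffOn hp)
  choose κ hκ using fun l => exists_smoothFun_eq_mul hW hχW (hg l)
  refine ⟨κ, fun l y hy => ?_, ?_⟩
  · rw [hκ]
    by_cases hyW : y ∈ W
    · rw [hpW ⟨y, hy⟩ hyW]; simp
    · rw [image_eq_zero_of_notMem_tsupport fun h => hyW (hχW h), zero_mul]
  · have h1 : ∀ᶠ y in 𝓝 c, χ =ᶠ[𝓝 y] (1 : M → ℝ) := hχ.eventually_nhds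
    filter_upwards [eventually_nhdsWithin_of_eventually_nhds hx,
      eventually_nhdsWithin_of_eventually_nhds h1, eventually_nhdsWithin_of_eventually_nhds
      (hW.mem_nhds hcW), self_mem_nhdsWithin] with y hy1 hy2 hyW hyC v hv
    obtain ⟨b, -, hb⟩ := hy1
    have hpy : MDifferentiableAt (𝓡 n) (𝓡 𝒞.dim) p y :=
      ((hp y hyW).contMDiffAt (hW.mem_nhds hyW)).mdifferentiableAt (by simp)
    have hpe : p y = ⟨y, hyC⟩ := hpW ⟨y, hyC⟩ hyW
    obtain ⟨w, hw⟩ : ∃ w : TangentSpace (𝓡 𝒞.dim) (⟨y, hyC⟩ : 𝒞.body), ∀ g : 𝒞.body → ℝ,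
        MDifferentiableAt (𝓡 𝒞.dim) 𝓘(ℝ, ℝ) g ⟨y, hyC⟩ →
        (mfderiv (𝓡 n) 𝓘(ℝ, ℝ) (g ∘ p) y v : ℝ) = mfderiv (𝓡 𝒞.dim) 𝓘(ℝ, ℝ) g ⟨y, hyC⟩ w := by
      rw [← hpe]
      exact ⟨mfderiv (𝓡 n) (𝓡 𝒞.dim) p y v, fun g hg => mfderiv_comp_apply y hg hpy v⟩
    have key (l : Fin n) : dAt y (x l) v = dAt y (x l) (𝒞.inclDeriv ⟨y, hyC⟩ w) := by
      have h2 : MDifferentiableAt (𝓡 𝒞.dim) 𝓘(ℝ, ℝ) (fun z : 𝒞.body => x l z) ⟨y, hyC⟩ :=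
        (mdifferentiableAt_smoothFun (x l) y).comp (⟨y, hyC⟩ : 𝒞.body)
          (𝒞.mdifferentiableAt_incl ⟨y, hyC⟩)
      have h3 : MDifferentiableAt (𝓡 n) 𝓘(ℝ, ℝ) ((fun z : 𝒞.body => x l z) ∘ p) y :=
        MDifferentiableAt.comp y (by rw [hpe]; exact h2) hpy
      have h4 : κ l =ᶠ[𝓝 y] (x l : M → ℝ) - (fun z : 𝒞.body => x l z) ∘ p := by
        filter_upwards [hy2] with z hz
        rw [hκ, hz]
        simp
      have h5 := hv l
      rw [dAt_apply, h4.mfderiv_eq, mfderiv_sub (mdifferentiableAt_smoothFun _ _) h3] at h5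
      exact (sub_eq_zero.1 h5).trans
        ((hw _ h2).trans (𝒞.dAt_inclDeriv (x l) ⟨y, hyC⟩ w).symm)
    have hvw : v = 𝒞.inclDeriv ⟨y, hyC⟩ w := by
      have h6 (u : TangentSpace (𝓡 n) y) (k : Fin n) : dAt y (x k) u = b.repr u k := by
        conv_lhs => rw [← b.sum_repr u, map_sum]
        simp [hb, -Module.Basis.sum_repr]
      refine b.ext_elem fun k => ?_
      rw [← h6, ← h6, key]
    rw [hvw]
    exact 𝒞.inclDeriv_mem_tangent ⟨y, hyC⟩ _

end GradedSubmanifold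

end

/-! ### Conormal functions and sections of the subbundle -/

section

namespace GradedSubmanifold

variable {n : ℕ} {M : Type*} [TopologicalSpace M] [ChartedSpace (EuclideanSpace ℝ (Fin n)) M]
  [IsManifold (𝓡 n) ∞ M] (𝒞 : GradedSubmanifold n M)

/-- Every covector which vanishes on the tangent space of the body is the differential of a function
vanishing on the body. -/
theorem exists_conormal [T2Space M] {c : M} (hc : c ∈ 𝒞.body) (ξ : TangentSpace (𝓡 n) c →ₗ[ℝ] ℝ)
    (hξ : ∀ v ∈ 𝒞.tangent c, ξ v = 0) :
    ∃ κ : SmoothFun n M, (∀ y ∈ 𝒞.body, κ y = 0) ∧ ∀ v, dAt c κ v = ξ v := by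
  obtain ⟨κ, hκ, h⟩ := 𝒞.exists_conormalFrame hc
  have h := h.self_of_nhdsWithin hc
  have h1 : ξ ∈ Submodule.span ℝ (Set.range fun l => (dAt c (κ l)).toLinearMap) := by
    refine mem_span_of_iInf_ker_le_ker fun v hv => hξ v (h v fun l => ?_)
    exact LinearMap.mem_ker.1 (Submodule.mem_iInf _ |>.1 hv l)
  obtain ⟨a, ha⟩ := (Submodule.mem_span_range_iff_exists_fun ℝ).1 h1
  refine ⟨∑ l, a l • κ l, fun y hy => ?_, fun v => ?_⟩
  · rw [smoothFun_sum_apply]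
    simp [hκ _ y hy]
  · rw [← ha]
    simp [map_sum]

/-- The derivative of a function along a smooth family of tangent vectors is smooth. -/
theorem contMDiffOn_dAt_section {d : ℕ} {N : Type*} [TopologicalSpace N]
    [ChartedSpace (EuclideanSpace ℝ (Fin d)) N] {ι : N → M} {U : Set N}
    {s : ∀ y : N, TangentSpace (𝓡 n) (ι y)}
    (hs : ContMDiffOn (𝓡 d) (𝓡 n).tangent ∞ (fun y => (⟨ι y, s y⟩ : TangentBundle (𝓡 n) M)) U)
    (f : SmoothFun n M) : ContMDiffOn (𝓡 d) 𝓘(ℝ, ℝ) ∞ (fun y => dAt (ι y) f (s y)) U := by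
  have h1 : ContMDiff (𝓡 n).tangent 𝓘(ℝ, ℝ).tangent ∞ (tangentMap (𝓡 n) 𝓘(ℝ, ℝ) f) :=
    f.contMDiff.contMDiff_tangentMap (by simp)
  exact (contMDiff_snd_tangentBundle_modelSpace ℝ 𝓘(ℝ, ℝ)).comp_contMDiffOn
    (h1.comp_contMDiffOn hs)

theorem ofDeriv_mem_tangentFields_iff (X : Derivation ℝ (SmoothFun n M) (SmoothFun n M)) :
    ofDeriv X ∈ 𝒞.tangentFields ↔
      ∀ y ∈ 𝒞.body, ∃ v ∈ 𝒞.fiber y, ∀ f, X f y = dAt y f v := by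
  constructor
  · rintro ⟨-, -, h⟩ y hy
    obtain ⟨v, hv, h⟩ := h y hy
    exact ⟨v, hv, fun f => by rw [dAt_apply]; simpa using h f⟩
  · intro h
    refine ⟨ofDeriv_mem_functions X, isHomogeneous_single _ _, fun y hy => ?_⟩
    obtain ⟨v, hv, h⟩ := h y hy
    exact ⟨v, hv, fun f => by simpa [dAt_apply] using h f⟩

/-- Near a point of the body, the subbundle `E` has a frame consisting of globally defined vector
fields which are sections of `E` along the whole body. -/
theorem exists_fiberFrame [T2Space M] {c : M} (hc : c ∈ 𝒞.body) :
    ∃ (r : ℕ) (X : Fin r → Derivation ℝ (SmoothFun n M) (SmoothFun n M)),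
      (∀ i, ofDeriv (X i) ∈ 𝒞.tangentFields) ∧
      ∀ᶠ y in 𝓝[𝒞.body] c, ∃ s : Fin r → TangentSpace (𝓡 n) y, LinearIndependent ℝ s ∧
        Submodule.span ℝ (Set.range s) = 𝒞.fiber y ∧ ∀ i f, X i f y = dAt y f (s i) := by
  obtain ⟨U, hU, r, s, hs, hsU⟩ := 𝒞.exists_frame ⟨c, hc⟩
  obtain ⟨W, hW, hcW, p, hp, hpW⟩ := 𝒞.exists_retraction ⟨c, hc⟩
  obtain ⟨x, D, hx⟩ := exists_localCoordinates (n := n) c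
  obtain ⟨V, hV, hVo, hcV⟩ := eventually_nhds_iff.1 hx
  set O : Set M := (W ∩ p ⁻¹' (interior U)) ∩ V with hO
  have hOo : IsOpen O := (hp.continuousOn.isOpen_inter_preimage hW isOpen_interior).inter hVo
  have hcO : c ∈ O := by
    refine ⟨⟨hcW, ?_⟩, hcV⟩
    change p ((⟨c, hc⟩ : 𝒞.body) : M) ∈ interior U
    rw [hpW _ hcW]
    exact mem_interior_iff_mem_nhds.2 hU
  obtain ⟨χ, hχ, hχO⟩ := exists_bump (n := n) (hOo.mem_nhds hcO)
  -- the coordinates of the frame, extended from the body by the retraction `p`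
  have ha (i : Fin r) (l : Fin n) : ContMDiffOn (𝓡 n) 𝓘(ℝ, ℝ) ∞
      (fun z => dAt (p z : M) (x l) (s i (p z))) O :=
    (contMDiffOn_dAt_section (hs i) (x l)).comp (hp.mono fun z hz => hz.1.1)
      fun z hz => interior_subset (s := U) hz.1.2
  choose a ha using fun i l => exists_smoothFun_eq_mul hOo hχO (ha i l)
  have key (i : Fin r) (y : M) (hy : y ∈ 𝒞.body) (hyO : y ∈ O) (f : SmoothFun n M) :
      (∑ l, a i l • D l) f y = dAt y f (χ y • s i ⟨y, hy⟩) := by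
    obtain ⟨b, hb1, hb2⟩ := hV y hyO.2
    have hpy : p y = ⟨y, hy⟩ := hpW ⟨y, hy⟩ hyO.1.1
    have h6 (u : TangentSpace (𝓡 n) y) (k : Fin n) : dAt y (x k) u = b.repr u k := by
      conv_lhs => rw [← b.sum_repr u, map_sum]
      simp [hb2, -Module.Basis.sum_repr]
    have h7 : (∑ l, a i l • D l) f y = ∑ l, a i l y * D l f y := by
      rw [← Derivation.coeFnAddMonoidHom_apply, map_sum, Finset.sum_apply, smoothFun_sum_apply]
      rfl
    rw [h7, ← b.sum_repr (s i ⟨y, hy⟩)]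
    have h9 (l : Fin n) : dAt (p y : M) (x l) (s i (p y)) = dAt y (x l) (s i ⟨y, hy⟩) := by
      rw [hpy]
    simp only [ha, h9, h6, hb1, map_smul, map_sum, smul_eq_mul, Finset.mul_sum, mul_assoc]
  refine ⟨r, fun i => ∑ l, a i l • D l, fun i => ?_, ?_⟩
  · rw [ofDeriv_mem_tangentFields_iff]
    intro y hy
    by_cases hyO : y ∈ O
    · refine ⟨χ y • s i ⟨y, hy⟩, Submodule.smul_mem _ _ ?_, key i y hy hyO⟩
      have hyU : (⟨y, hy⟩ : 𝒞.body) ∈ U := by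
        have := interior_subset hyO.1.2
        rwa [hpW ⟨y, hy⟩ hyO.1.1] at this
      rw [← (hsU _ hyU).2]
      exact Submodule.subset_span ⟨i, rfl⟩
    · refine ⟨0, Submodule.zero_mem _, fun f => ?_⟩
      have h8 : χ y = 0 := image_eq_zero_of_notMem_tsupport fun h => hyO (hχO h)
      rw [← Derivation.coeFnAddMonoidHom_apply, map_sum, Finset.sum_apply, smoothFun_sum_apply,
        map_zero]
      refine Finset.sum_eq_zero fun l _ => ?_
      change a i l y * D l f y = 0
      rw [ha, h8, zero_mul, zero_mul]
  · filter_upwards [eventually_nhdsWithin_of_eventually_nhds hχ,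
      eventually_nhdsWithin_of_eventually_nhds (hOo.mem_nhds hcO), self_mem_nhdsWithin]
      with y hyχ hyO hy
    have hyU : (⟨y, hy⟩ : 𝒞.body) ∈ U := by
      have := interior_subset hyO.1.2
      rwa [hpW ⟨y, hy⟩ hyO.1.1] at this
    refine ⟨fun i => s i ⟨y, hy⟩, (hsU _ hyU).1, (hsU _ hyU).2, fun i f => ?_⟩
    rw [key i y hy hyO, hyχ]
    simp

/-- Every vector of the subbundle `E` is the value of a section. -/
theorem exists_tangentField_eq [T2Space M] {c : M} (hc : c ∈ 𝒞.body) {e : TangentSpace (𝓡 n) c}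
    (he : e ∈ 𝒞.fiber c) : ∃ X : Derivation ℝ (SmoothFun n M) (SmoothFun n M),
      ofDeriv X ∈ 𝒞.tangentFields ∧ ∀ f, X f c = dAt c f e := by
  obtain ⟨r, X, hX, h⟩ := 𝒞.exists_fiberFrame hc
  obtain ⟨s, -, hs, hXs⟩ := h.self_of_nhdsWithin hc
  rw [← hs] at he
  obtain ⟨a, rfl⟩ := (Submodule.mem_span_range_iff_exists_fun ℝ).1 he
  have h7 (f : SmoothFun n M) (y : M) : (∑ i, a i • X i) f y = ∑ i, a i * X i f y := by
    rw [← Derivation.coeFnAddMonoidHom_apply, map_sum, Finset.sum_apply, smoothFun_sum_apply]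
    rfl
  refine ⟨∑ i, a i • X i, ?_, fun f => ?_⟩
  · rw [ofDeriv_mem_tangentFields_iff]
    intro y hy
    choose v hv hvX using fun i => (𝒞.ofDeriv_mem_tangentFields_iff (X i)).1 (hX i) y hy
    refine ⟨∑ i, a i • v i, Submodule.sum_mem _ fun i _ => Submodule.smul_mem _ _ (hv i),
      fun f => ?_⟩
    simp [h7, hvX, map_sum]
  · simp [h7, hXs, map_sum]

end GradedSubmanifold

end

/-! ### Linear systems of constant rank -/

section

/-- A matrix of rank `k` can be compressed to the identity matrix of size `k`. -/
theorem exists_mul_mul_eq_one {r m : ℕ} (A : Matrix (Fin r) (Fin m) ℝ) :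
    ∃ (p : Matrix (Fin A.rank) (Fin r) ℝ) (s : Matrix (Fin m) (Fin A.rank) ℝ), p * A * s = 1 := by
  set V := LinearMap.range A.mulVecLin with hV
  let e : V ≃ₗ[ℝ] (Fin A.rank → ℝ) := LinearEquiv.ofFinrankEq _ _ (by
    rw [Module.finrank_fin_fun]; rfl)
  obtain ⟨g, hg⟩ := V.subtype.exists_leftInverse_of_injective (by simp)
  obtain ⟨h, hh⟩ := A.mulVecLin.rangeRestrict.exists_rightInverse_of_surjective
    (LinearMap.range_rangeRestrict _)
  refine ⟨LinearMap.toMatrix' (e.toLinearMap ∘ₗ g),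
    LinearMap.toMatrix' (h ∘ₗ e.symm.toLinearMap), ?_⟩
  have h1 : (e.toLinearMap ∘ₗ g) ∘ₗ A.mulVecLin ∘ₗ (h ∘ₗ e.symm.toLinearMap) = LinearMap.id := by
    refine LinearMap.ext fun x => ?_
    have h2 : A.mulVecLin (h (e.symm x)) = V.subtype (e.symm x) :=
      congrArg Subtype.val (LinearMap.congr_fun hh (e.symm x))
    have h3 := LinearMap.congr_fun hg (e.symm x)
    simp only [LinearMap.comp_apply, LinearEquiv.coe_coe, h2] at h3 ⊢
    rw [h3]
    simp
  have h4 := congrArg LinearMap.toMatrix' h1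
  rw [LinearMap.toMatrix'_comp, LinearMap.toMatrix'_comp,
    show LinearMap.toMatrix' A.mulVecLin = A from LinearMap.toMatrix'_toLin' A,
    LinearMap.toMatrix'_id, ← Matrix.mul_assoc] at h4
  exact h4

/-- A vector annihilated by the left kernel of a matrix is in its range. -/
theorem mem_range_mulVecLin {r m : ℕ} (A : Matrix (Fin r) (Fin m) ℝ) (b : Fin r → ℝ)
    (h : ∀ a : Fin r → ℝ, Matrix.vecMul a A = 0 → a ⬝ᵥ b = 0) :
    b ∈ LinearMap.range A.mulVecLin := by
  by_contra hb
  obtain ⟨φ, hφ, hφ0⟩ := Submodule.exists_dual_map_eq_bot_of_notMem hb inferInstance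
  set a : Fin r → ℝ := fun k => φ (Pi.single k 1) with ha
  have h1 (v : Fin r → ℝ) : φ v = a ⬝ᵥ v := by
    have := (LinearMap.pi_apply_eq_sum_univ φ v)
    rw [this]
    simp only [dotProduct, ha, smul_eq_mul]
    refine Finset.sum_congr rfl fun i _ => ?_
    rw [mul_comm]
    congr 2
    funext j
    simp [Pi.single_apply, eq_comm]
  apply hφ
  rw [h1]
  refine h a ?_
  funext l
  have h2 : φ (A.mulVecLin (Pi.single l 1)) = 0 := by
    have : φ (A.mulVecLin (Pi.single l 1)) ∈ (LinearMap.range A.mulVecLin).map φ :=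
      ⟨_, ⟨_, rfl⟩, rfl⟩
    rwa [hφ0] at this
  rw [h1] at h2
  rw [Matrix.mulVecLin_apply, Matrix.mulVec_single_one] at h2
  exact h2

variable {n : ℕ} {M : Type*} [TopologicalSpace M] [ChartedSpace (EuclideanSpace ℝ (Fin n)) M]
  [IsManifold (𝓡 n) ∞ M] [T2Space M]

/-- A linear system with smooth coefficients, whose matrix has constant rank along `C` and which is
solvable at every point of `C` near `c`, has a smooth solution along `C` near `c`, with
arbitrarily prescribed value at `c`. -/
theorem exists_smooth_solution {r m : ℕ} (N : Matrix (Fin r) (Fin m) (SmoothFun n M))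
    (b : Fin r → SmoothFun n M) {C : Set M} {c : M}
    (hrank : ∀ᶠ y in 𝓝[C] c,
      Module.finrank ℝ (LinearMap.ker (N.map fun f => f y).vecMulLinear) =
        Module.finrank ℝ (LinearMap.ker (N.map fun f => f c).vecMulLinear))
    (hsol : ∀ᶠ y in 𝓝[C] c, ∀ a : Fin r → ℝ,
      Matrix.vecMul a (N.map fun f => f y) = 0 → ∑ k, a k * b k y = 0)
    (a₀ : Fin m → ℝ) (h₀ : ∀ k, ∑ l, N k l c * a₀ l = b k c) :
    ∃ a : Fin m → SmoothFun n M, (∀ l, a l c = a₀ l) ∧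
      ∀ᶠ y in 𝓝[C] c, ∀ k, ∑ l, N k l y * a l y = b k y := by
  classical
  let ev (y : M) : SmoothFun n M →+* ℝ := ContMDiffMap.evalRingHom (I := 𝓡 n) (n := ∞) (R := ℝ) y
  let al : ℝ →+* SmoothFun n M := algebraMap ℝ (SmoothFun n M)
  have eval (y : M) (t : ℝ) : ev y (al t) = t := rfl
  set Nc := N.map (ev c) with hNc
  obtain ⟨p, s, hps⟩ := exists_mul_mul_eq_one Nc
  -- with `p` and `s` such that `p N(c) s = 1`, the matrix `B = p N s` is invertible near `c`, and
  -- the solution is `a₀ + s B⁻¹ p (b - N a₀)`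
  set B : Matrix (Fin Nc.rank) (Fin Nc.rank) (SmoothFun n M) := p.map al * N * s.map al with hB
  have hpy {i j : ℕ} (q : Matrix (Fin i) (Fin j) ℝ) (y : M) : (q.map al).map (ev y) = q := by
    ext; rfl
  have hBy (y : M) : B.map (ev y) = p * N.map (ev y) * s := by
    rw [hB, Matrix.map_mul, Matrix.map_mul, hpy, hpy]
  have hdet (y : M) : B.det y = (B.map (ev y)).det := (ev y).map_det B
  have hdc : B.det c = 1 := by rw [hdet, hBy, ← hNc, hps, Matrix.det_one]
  -- the inverse of the determinant near `c`
  obtain ⟨d, hd⟩ : ∃ d : SmoothFun n M, ∀ᶠ y in 𝓝 c, d y * B.det y = 1 := by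
    have ho : IsOpen {y | B.det y ≠ 0} := isOpen_ne_fun B.det.contMDiff.continuous continuous_const
    obtain ⟨d, hd⟩ := exists_smoothFun_eventuallyEq (n := n) (x := c) ho (by simp [hdc])
      (g := fun y => (B.det y)⁻¹) (B.det.contMDiff.contMDiffOn.inv₀ fun y hy => hy)
    refine ⟨d, ?_⟩
    filter_upwards [hd, ho.mem_nhds (show c ∈ {y | B.det y ≠ 0} by simp [hdc])] with y hy hy0
    rw [hy]
    exact inv_mul_cancel₀ hy0
  set w : Fin r → SmoothFun n M := b - N.mulVec (al ∘ a₀) with hw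
  set a : Fin m → SmoothFun n M :=
    al ∘ a₀ + (s.map al).mulVec ((d • B.adjugate).mulVec ((p.map al).mulVec w)) with ha
  have hwy (y : M) : ev y ∘ w = (fun k => b k y) - (N.map (ev y)).mulVec a₀ := by
    funext k
    have := RingHom.map_mulVec (ev y) N (al ∘ a₀) k
    simp only [hw, Function.comp_apply, Pi.sub_apply, map_sub, this]
    rfl
  have hay (y : M) : (fun l => a l y) = a₀ + s.mulVec ((d y • (B.map (ev y)).adjugate).mulVec
      (p.mulVec (ev y ∘ w))) := by
    have h1 (i : Fin Nc.rank) : ev y ((p.map al).mulVec w i) = p.mulVec (ev y ∘ w) i := by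
      rw [RingHom.map_mulVec, hpy]
    have h2 (i : Fin Nc.rank) : ev y ((d • B.adjugate).mulVec ((p.map al).mulVec w) i) =
        (d y • (B.map (ev y)).adjugate).mulVec (p.mulVec (ev y ∘ w)) i := by
      rw [RingHom.map_mulVec]
      have : (d • B.adjugate).map (ev y) = d y • (B.map (ev y)).adjugate := by
        have h3 := RingHom.map_adjugate (ev y) B
        simp only [RingHom.mapMatrix_apply] at h3
        rw [← h3]
        ext i j
        exact map_mul (ev y) d _
      rw [this]
      congr 1
      exact funext h1
    funext l
    change ev y (a l) = _
    simp only [ha, Pi.add_apply, map_add, Function.comp_apply, eval]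
    rw [RingHom.map_mulVec, hpy]
    congr 2
    exact funext h2
  refine ⟨a, fun l => ?_, ?_⟩
  · have h1 : ev c ∘ w = 0 := by
      rw [hwy]
      funext k
      have := h₀ k
      simp only [Pi.sub_apply, Pi.zero_apply, ← this]
      exact sub_self _
    have := congrFun (hay c) l
    simpa [h1] using this
  · filter_upwards [hrank, hsol, eventually_nhdsWithin_of_eventually_nhds hd] with y hy1 hy2 hy3
    set Ny := N.map (ev y) with hNy
    have hr : Ny.rank = Nc.rank := by
      have h1 (A : Matrix (Fin r) (Fin m) ℝ) :
          A.rank + Module.finrank ℝ (LinearMap.ker A.vecMulLinear) = r := by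
        have := LinearMap.finrank_range_add_finrank_ker A.vecMulLinear
        rw [← Matrix.mulVecLin_transpose] at this ⊢
        rw [← Matrix.rank_transpose, Matrix.rank, this]
        simp
      have h2 := h1 Ny
      have h3 := h1 Nc
      have h4 : Module.finrank ℝ (LinearMap.ker Ny.vecMulLinear) =
        Module.finrank ℝ (LinearMap.ker Nc.vecMulLinear) := hy1
      omega
    have hbr : (fun k => b k y) ∈ LinearMap.range Ny.mulVecLin := by
      refine mem_range_mulVecLin _ _ fun a' ha' => ?_
      exact hy2 a' ha'
    have hinv : (p * Ny * s) * (d y • (B.map (ev y)).adjugate) = 1 := by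
      rw [← hBy, Matrix.mul_smul, Matrix.mul_adjugate, smul_smul, ← hdet, hy3, one_smul]
    -- `p` is injective on the range of the matrix at `y`, being surjective onto a space of the same
    -- dimension; therefore it suffices to solve the system multiplied by `p`
    have hinj : ∀ v ∈ LinearMap.range Ny.mulVecLin, p.mulVec v = 0 → v = 0 := by
      let f : LinearMap.range Ny.mulVecLin →ₗ[ℝ] (Fin Nc.rank → ℝ) :=
        p.mulVecLin.domRestrict _
      have hf : Function.Surjective f := by
        intro z
        refine ⟨⟨Ny.mulVecLin (s.mulVec ((d y • (B.map (ev y)).adjugate).mulVec z)), ⟨_, rfl⟩⟩, ?_⟩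
        have h : p.mulVec (Ny.mulVec (s.mulVec ((d y • (B.map (ev y)).adjugate).mulVec z))) = z :=
          ?_
        · exact h
        rw [Matrix.mulVec_mulVec, Matrix.mulVec_mulVec, Matrix.mulVec_mulVec, hinv,
          Matrix.one_mulVec]
      have hf' : Function.Injective f :=
        (LinearMap.injective_iff_surjective_of_finrank_eq_finrank (by
          rw [Module.finrank_fin_fun]; exact hr)).2 hf
      intro v hv hpv
      exact congrArg Subtype.val (hf' (a₁ := ⟨v, hv⟩) (a₂ := 0) (by rw [map_zero]; exact hpv))
    have hz : Ny.mulVec (fun l => a l y) - (fun k => b k y) = 0 := by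
      refine hinj _ (Submodule.sub_mem _ ⟨_, rfl⟩ hbr) ?_
      rw [hay, Matrix.mulVec_sub, Matrix.mulVec_add, Matrix.mulVec_add, Matrix.mulVec_mulVec,
        Matrix.mulVec_mulVec, Matrix.mulVec_mulVec, Matrix.mulVec_mulVec, hinv, Matrix.one_mulVec,
        hwy, Matrix.mulVec_sub, Matrix.mulVec_mulVec]
      abel
    intro k
    have := congrFun (sub_eq_zero.1 hz) k
    exact this

/-- A linear system with smooth coefficients whose rows are linearly independent at the points of
`C` near `c` has a smooth solution along `C` near `c`. -/
theorem exists_smooth_solution_of_ker_eq_bot {r m : ℕ} (N : Matrix (Fin r) (Fin m) (SmoothFun n M))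
    (b : Fin r → SmoothFun n M) {C : Set M} {c : M} (hc : c ∈ C)
    (hN : ∀ᶠ y in 𝓝[C] c, ∀ a : Fin r → ℝ, (∀ l, ∑ k, a k * N k l y = 0) → a = 0) :
    ∃ a : Fin m → SmoothFun n M, ∀ᶠ y in 𝓝[C] c, ∀ k, ∑ l, N k l y * a l y = b k y := by
  have h1 : ∀ᶠ y in 𝓝[C] c, LinearMap.ker (N.map fun f => f y).vecMulLinear = ⊥ := by
    filter_upwards [hN] with y hy
    rw [LinearMap.ker_eq_bot']
    exact fun a ha => hy a fun l => congrFun ha l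
  have h2 := h1.self_of_nhdsWithin hc
  obtain ⟨a₀, h₀⟩ := mem_range_mulVecLin (N.map fun f => f c) (fun k => b k c) fun a ha => by
    rw [hN.self_of_nhdsWithin hc a fun l => congrFun ha l, zero_dotProduct]
  obtain ⟨a, -, ha⟩ := exists_smooth_solution N b (by
      filter_upwards [h1] with y hy
      rw [hy, h2])
    (by
      filter_upwards [hN] with y hy a ha
      rw [hy a fun l => congrFun ha l]
      simp) a₀ fun k => congrFun h₀ k
  exact ⟨a, ha⟩

end

/-! ### Expansion of multivector fields -/

section

section Algebra
variable {n : ℕ} {M : Type*} [TopologicalSpace M] [ChartedSpace (EuclideanSpace ℝ (Fin n)) M]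

theorem alternatingMap_sum_apply {A κ ι : Type*} [CommRing A] [Algebra ℝ A] (s : Finset ι)
    (P : ι → A [⋀^κ]→ₗ[ℝ] A) (f : κ → A) : (∑ i ∈ s, P i) f = ∑ i ∈ s, P i f := by
  classical
  induction s using Finset.induction_on with
  | empty => simp
  | insert i s hi ih => simp [hi, ih]

theorem smoothFun_units_smul_apply (ε : ℤˣ) (f : SmoothFun n M) (x : M) :
    (ε • f) x = ε • f x := by
  rcases Int.units_eq_one_or ε with h | h
  · rw [h, one_smul, one_smul]
  · rw [h, Units.neg_smul, Units.neg_smul, one_smul, one_smul]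
    rfl

theorem wedgeHom_smul {p q : ℕ} (g : SmoothFun n M)
    (P : (SmoothFun n M) [⋀^Fin p]→ₗ[ℝ] (SmoothFun n M))
    (Q : (SmoothFun n M) [⋀^Fin q]→ₗ[ℝ] (SmoothFun n M)) :
    wedgeHom (g • P) Q = g • wedgeHom P Q := by
  ext f : 1
  simp only [wedgeHom_apply, AlternatingMap.smul_apply, smul_mul_assoc]
  rw [smul_comm g, Finset.smul_sum (r := g)]
  simp only [smul_comm g]

theorem wedge_smul (g : SmoothFun n M) (P Q : Cochain n M) :
    wedge (g • P) Q = g • wedge P Q := by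
  funext m
  simp only [wedge, Pi.smul_apply, wedgeHom_smul]
  rw [Finset.smul_sum]
  rfl

theorem smul_mem_functions (g : SmoothFun n M) {P : Cochain n M} (hP : P ∈ functions n M) :
    g • P ∈ functions n M := by
  intro k v i a b
  simp only [Pi.smul_apply, AlternatingMap.smul_apply, hP k v i a b, smul_eq_mul]
  ring

theorem smul_mem_idealSpan (g : SmoothFun n M) {G : Set (Cochain n M)} {P : Cochain n M}
    (hP : P ∈ idealSpan G) : g • P ∈ idealSpan G := by
  refine Submodule.span_induction ?_ ?_ ?_ ?_ hP
  · rintro _ ⟨a, ha, x, hx, rfl⟩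
    exact Submodule.subset_span ⟨g • a, smul_mem_functions g ha, x, hx, (wedge_smul g a x).symm⟩
  · rw [smul_zero]
    exact Submodule.zero_mem _
  · intro P Q _ _ h1 h2
    rw [smul_add]
    exact Submodule.add_mem _ h1 h2
  · intro c P _ h
    rw [smul_comm]
    exact Submodule.smul_mem _ c h

/-- An exterior product of derivations one of whose factors is among the generators is in the
ideal. -/
theorem single_multiField_mem_idealSpan {G : Set (Cochain n M)} {m : ℕ}
    (e : Fin m → Derivation ℝ (SmoothFun n M) (SmoothFun n M)) (a : Fin m)
    (he : ofDeriv (e a) ∈ G) : (Pi.single m (multiField e) : Cochain n M) ∈ idealSpan G := by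
  obtain _ | m := m
  · exact a.elim0
  set τ := Equiv.swap a (Fin.last m)
  have h1 : e ∘ τ = Fin.snoc (α := fun _ => _) (Fin.init (e ∘ τ)) (e a) := by
    conv_lhs => rw [← Fin.snoc_init_self (e ∘ τ)]
    simp [τ]
  have h2 : (Pi.single (m + 1) (multiField (e ∘ τ)) : Cochain n M) ∈ idealSpan G := by
    rw [h1, ← wedgeHom_multiField, ← wedge_single_ofDeriv]
    exact Submodule.subset_span ⟨_, single_mem_functions (isMultiderivation_multiField _), _, he,
      rfl⟩
  rw [multiField_comp_perm] at h2
  rcases Int.units_eq_one_or (Equiv.Perm.sign τ) with h | h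
  · simpa [h] using h2
  · simp only [h, Units.val_neg, Units.val_one, neg_smul, one_smul] at h2
    rw [← Submodule.neg_mem_iff, ← Pi.single_neg]
    exact h2

end Algebra

variable {n : ℕ} {M : Type*} [TopologicalSpace M] [ChartedSpace (EuclideanSpace ℝ (Fin n)) M]
  [IsManifold (𝓡 n) ∞ M]

/-- The expansion of a multivector field along a (possibly redundant) family of derivations
`e i`, given a decomposition `dg = ∑ i, (e i g) d(h i)` of the differentials of functions at the
point `x`. -/
theorem multiderivation_eq_sum_multiField [T2Space M] {ι : Type*} [Fintype ι] {m : ℕ}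
    {P : (SmoothFun n M) [⋀^Fin m]→ₗ[ℝ] (SmoothFun n M)} (hP : IsMultiderivation P)
    (e : ι → Derivation ℝ (SmoothFun n M) (SmoothFun n M)) (h : ι → SmoothFun n M) (x : M)
    (hdec : ∀ g, dAt x g = ∑ i, e i g x • dAt x (h i)) (f : Fin m → SmoothFun n M) :
    P f x = (m.factorial : ℝ)⁻¹ * ∑ J : Fin m → ι, P (h ∘ J) x * multiField (e ∘ J) f x := by
  classical
  have h1 (f : Fin m → SmoothFun n M) :
      P f x = ∑ J : Fin m → ι, P (h ∘ J) x * ∏ b, e (J b) (f b) x := by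
    have h2 : P f x = P (fun b => ∑ i, e i (f b) x • h i) x := by
      refine multiderivation_congr hP fun b => ?_
      rw [hdec, map_sum]
      simp only [map_smul]
    have h3 := P.toMultilinearMap.map_sum (fun (b : Fin m) (i : ι) => e i (f b) x • h i)
    have h4 (J : Fin m → ι) := P.toMultilinearMap.map_smul_univ (fun b => e (J b) (f b) x)
      (fun b => h (J b))
    rw [h2]
    refine (congrArg (fun F : SmoothFun n M => F x) h3).trans ?_
    simp only [h4, smoothFun_sum_apply]
    refine Finset.sum_congr rfl fun J _ => ?_
    exact mul_comm _ _
  -- the sum is antisymmetrized over the permutations of the arguments to obtain determinants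
  have h5 (σ : Equiv.Perm (Fin m)) : P f x = ∑ J : Fin m → ι,
      P (h ∘ J) x * (Equiv.Perm.sign σ • ∏ b, e (J b) (f (σ b)) x) := by
    have h6 := P.map_perm f σ
    have h7 : P f = Equiv.Perm.sign σ • P (f ∘ σ) := by
      rw [h6, smul_smul, Int.units_mul_self, one_smul]
    have h8 : P f x = Equiv.Perm.sign σ • P (f ∘ σ) x := by
      rw [← smoothFun_units_smul_apply, ← h7]
    rw [h8, h1, Finset.smul_sum]
    refine Finset.sum_congr rfl fun J _ => ?_
    rw [mul_smul_comm]
    rfl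
  have h9 : (m.factorial : ℝ) * P f x = ∑ J : Fin m → ι, P (h ∘ J) x * multiField (e ∘ J) f x := by
    have h10 : ∑ σ : Equiv.Perm (Fin m), P f x = (m.factorial : ℝ) * P f x := by
      rw [Finset.sum_const, Finset.card_univ, Fintype.card_perm, Fintype.card_fin, nsmul_eq_mul]
    rw [← h10, Finset.sum_congr rfl fun σ _ => h5 σ, Finset.sum_comm]
    refine Finset.sum_congr rfl fun J _ => ?_
    rw [← Finset.mul_sum, multiField_apply, smoothFun_sum_apply]
    congr 1
    refine Finset.sum_congr rfl fun σ _ => ?_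
    rw [← smoothFun_prod_apply, smoothFun_units_smul_apply]
    rfl
  have : (m.factorial : ℝ) ≠ 0 := by positivity
  rw [← h9, inv_mul_cancel_left₀ this]

end

/-! ### The criterion for membership in the vanishing ideal -/

section

section Decomposition
variable {r n : ℕ} (u A : Fin r → Fin n → ℝ)

/-- The decomposition of `∑ d j • w j` into a component along the vectors `∑ l, A i l • w l` and a
remainder. -/
theorem sum_smul_decomposition {V : Type*} [AddCommGroup V] [Module ℝ V] (d : Fin n → ℝ)
    (w : Fin n → V) : ∑ i, (∑ j, d j * u i j) • ∑ l, A i l • w l +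
      ∑ j, d j • ∑ l, ((if j = l then 1 else 0) - ∑ i, u i j * A i l) • w l =
    ∑ j, d j • w j := by
  have h6 : ∑ i, (∑ j, d j * u i j) • ∑ l, A i l • w l =
      ∑ j, d j • ∑ l, (∑ i, u i j * A i l) • w l := by
    simp only [Finset.sum_smul, Finset.smul_sum, smul_smul, Finset.sum_mul]
    rw [Finset.sum_comm]
    conv_rhs => rw [Finset.sum_comm]
    refine Finset.sum_congr rfl fun l _ => ?_
    rw [Finset.sum_comm]
    simp only [mul_assoc]
  rw [h6]
  simp only [sub_smul, Finset.sum_sub_distrib, smul_sub, ite_smul, one_smul, zero_smul,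
      Finset.sum_ite_eq, Finset.mem_univ, if_true]
  abel

/-- If the vectors `u k` are dual to the covectors `A i`, they are annihilated by the remainder in
`sum_smul_decomposition`. -/
theorem sum_mul_decomposition (h : ∀ i k, ∑ l, u k l * A i l = if k = i then 1 else 0) (j : Fin n)
    (k : Fin r) : ∑ l, ((if j = l then 1 else 0) - ∑ i, u i j * A i l) * u k l = 0 := by
  have h1 : ∑ l, (∑ i, u i j * A i l) * u k l = ∑ i, u i j * ∑ l, u k l * A i l := by
    simp only [Finset.sum_mul, Finset.mul_sum]
    rw [Finset.sum_comm]
    exact Finset.sum_congr rfl fun i _ => Finset.sum_congr rfl fun l _ => by ring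
  simp only [sub_mul, Finset.sum_sub_distrib, h1, h]
  simp

end Decomposition

namespace GradedSubmanifold

variable {n : ℕ} {M : Type*} [TopologicalSpace M] [ChartedSpace (EuclideanSpace ℝ (Fin n)) M]
  [IsManifold (𝓡 n) ∞ M] (𝒞 : GradedSubmanifold n M)

/-- The multivector fields in the vanishing ideal vanish, at the points of `C`, on functions whose
differentials annihilate `E`. -/
theorem apply_eq_zero_of_mem_ideal {P : Cochain n M} (hP : P ∈ 𝒞.ideal) {m : ℕ}
    (f : Fin m → SmoothFun n M) {c : M} (hc : c ∈ 𝒞.body)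
    (hf : ∀ i, ∀ e ∈ 𝒞.fiber c, dAt c (f i) e = 0) : P m f c = 0 := by
  obtain ⟨V, hV, Q, hQ, h⟩ := hP.2 c
  rw [h m f c (mem_of_mem_nhds hV)]
  clear h hV
  induction hQ using Submodule.span_induction with
  | zero => rfl
  | add P Q _ _ h1 h2 =>
    change P m f c + Q m f c = 0
    rw [h1, h2, add_zero]
  | smul a P _ h1 =>
    change a * P m f c = 0
    rw [h1, mul_zero]
  | mem Q hQ =>
  obtain ⟨a, ha, g, hg, rfl⟩ := hQ
  rcases hg with ⟨g, hg, rfl⟩ | ⟨hg, hg1, hgE⟩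
  · rw [wedge_ofFun]
    change a m f c * g c = 0
    rw [hg c hc, mul_zero]
  · obtain ⟨v, hv, hgv⟩ := hgE c hc
    have h0 (k : ℕ) (u : Fin k → SmoothFun n M)
        (hu : ∀ i, ∀ e ∈ 𝒞.fiber c, dAt c (u i) e = 0) : g k u c = 0 := by
      by_cases hk1 : k = 1
      · subst hk1
        have : u = ![u 0] := by
          funext i
          rw [Subsingleton.elim i 0]
          rfl
        rw [this, hgv]
        exact hu 0 v hv
      · rw [hg1 k hk1]; rfl
    rw [wedge, alternatingMap_sum_apply, smoothFun_sum_apply]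
    refine Finset.sum_eq_zero fun x _ => ?_
    rw [AlternatingMap.domDomCongr_apply, wedgeHom_apply]
    refine (smul_eq_mul (α := ℝ) _ _).trans ?_
    rw [smoothFun_sum_apply, Finset.sum_eq_zero, mul_zero]
    intro σ _
    have h3 := h0 x.1.2 (fun i => (f ∘ finCongr (Finset.HasAntidiagonal.mem_antidiagonal.1 x.2))
      (σ (Fin.natAdd x.1.1 i))) fun i => hf _
    have h4 (P Q : SmoothFun n M) (h : Q c = 0) : (Equiv.Perm.sign σ • (P * Q)) c = 0 := by
      have : (P * Q) c = P c * Q c := rfl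
      rw [smoothFun_units_smul_apply, this, h, mul_zero, smul_zero]
    exact h4 _ _ h3

/-- Near a point of `C`, the differentials decompose along derivations, some of which span `E`, the
others having coefficients that annihilate `E`. -/
theorem exists_adapted_decomposition [T2Space M] {c : M} (hc : c ∈ 𝒞.body) :
    ∃ (r : ℕ) (e : Fin r ⊕ Fin n → Derivation ℝ (SmoothFun n M) (SmoothFun n M))
      (a : Fin r ⊕ Fin n → Fin n → SmoothFun n M) (y : Fin n → SmoothFun n M),
      (∀ i, ofDeriv (e (.inl i)) ∈ 𝒞.tangentFields) ∧
      (∀ᶠ x in 𝓝 c, ∀ g, dAt x g = ∑ i, e i g x • dAt x (∑ l, a i l x • y l)) ∧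
      ∀ᶠ x in 𝓝[𝒞.body] c, ∀ j, ∀ v ∈ 𝒞.fiber x, dAt x (∑ l, a (.inr j) l x • y l) v = 0 := by
  obtain ⟨r, X, hX, hXs⟩ := 𝒞.exists_fiberFrame hc
  obtain ⟨y, D, hyD⟩ := exists_localCoordinates (n := n) c
  -- the coefficients of covectors `∑ l, A i l • dy l` dual to the frame `X` of `E`
  have hA : ∀ i : Fin r, ∃ a : Fin n → SmoothFun n M, ∀ᶠ x in 𝓝[𝒞.body] c, ∀ k,
      ∑ l, X k (y l) x * a l x = algebraMap ℝ (SmoothFun n M) (if k = i then 1 else 0) x := by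
    intro i
    refine exists_smooth_solution_of_ker_eq_bot (fun k l => X k (y l)) _ hc ?_
    filter_upwards [hXs, eventually_nhdsWithin_of_eventually_nhds hyD] with x hx1 hx2 a ha
    obtain ⟨s, hs, -, hsX⟩ := hx1
    obtain ⟨b, hb1, hb2⟩ := hx2
    have h1 : ∑ k, a k • s k = 0 := by
      have h2 (v : TangentSpace (𝓡 n) x) (l : Fin n) : b.repr v l = dAt x (y l) v := by
        conv_rhs => rw [← b.sum_repr v, map_sum]
        simp [hb2, -Module.Basis.sum_repr]
      refine b.repr.injective (Finsupp.ext fun l => ?_)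
      rw [h2, map_sum, map_zero]
      simpa [hsX] using ha l
    exact funext fun k => Fintype.linearIndependent_iff.1 hs a h1 k
  choose A hA using hA
  have hev (t : ℝ) (x : M) : algebraMap ℝ (SmoothFun n M) t x = t := rfl
  simp only [hev] at hA
  have hd (x : M) (u : Fin n → ℝ) : dAt x (∑ l, u l • y l) = ∑ l, u l • dAt x (y l) := by
    simp [map_sum]
  refine ⟨r, Sum.elim X D, Sum.elim A fun j l =>
    algebraMap ℝ (SmoothFun n M) (if j = l then 1 else 0) - ∑ i, X i (y j) * A i l, y, hX, ?_, ?_⟩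
  · filter_upwards [hyD] with x ⟨b, hb1, hb2⟩ g
    simp only [hd, Fintype.sum_sum_type, Sum.elim_inl, Sum.elim_inr]
    have h3 (g : SmoothFun n M) : dAt x g = ∑ l, D l g x • dAt x (y l) := by
      refine ContinuousLinearMap.coe_injective (b.ext fun k => ?_)
      simp [hb1, hb2]
    have h4 (i : Fin r) : X i g x = ∑ l, D l g x * X i (y l) x := by
      obtain ⟨v, hv⟩ := exists_derivation_value (X i) x
      rw [hv, h3]
      simp [hv]
    have h5 (j l : Fin n) : (algebraMap ℝ (SmoothFun n M) (if j = l then 1 else 0) -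
        ∑ i, X i (y j) * A i l) x = (if j = l then 1 else 0) - ∑ i, X i (y j) x * A i l x := by
      have : (∑ i, X i (y j) * A i l) x = ∑ i, X i (y j) x * A i l x := smoothFun_sum_apply _ _ _
      rw [← this]
      rfl
    simp only [h5, h4]
    rw [h3 g]
    exact (sum_smul_decomposition (fun i l => X i (y l) x) (fun i l => A i l x)
      (fun l => D l g x) fun l => dAt x (y l)).symm
  · filter_upwards [hXs, Filter.eventually_all.2 hA] with x ⟨s, _, hs, hsX⟩ hx j v hv
    rw [← hs] at hv
    obtain ⟨t, rfl⟩ := (Submodule.mem_span_range_iff_exists_fun ℝ).1 hv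
    rw [map_sum]
    refine Finset.sum_eq_zero fun k _ => ?_
    have h5 (j l : Fin n) : (algebraMap ℝ (SmoothFun n M) (if j = l then 1 else 0) -
        ∑ i, X i (y j) * A i l) x = (if j = l then 1 else 0) - ∑ i, X i (y j) x * A i l x := by
      have : (∑ i, X i (y j) * A i l) x = ∑ i, X i (y j) x * A i l x := smoothFun_sum_apply _ _ _
      rw [← this]
      rfl
    have h6 := sum_mul_decomposition (fun i l => X i (y l) x) (fun i l => A i l x) hx j k
    have h7 (u : Fin n → ℝ) (v : TangentSpace (𝓡 n) x) :
        dAt x (∑ l, u l • y l) v = ∑ l, u l * dAt x (y l) v := by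
      simp [map_sum]
    rw [map_smul, h7]
    simp only [Sum.elim_inr, h5, ← hsX, h6, smul_zero]

/-- A multivector field which vanishes, at the points of `C`, on functions whose differentials
annihilate `E`, is in the vanishing ideal. -/
theorem mem_ideal_of_apply_eq_zero [T2Space M] {P : Cochain n M} (hP : P ∈ functions n M)
    (h : ∀ (m : ℕ) (f : Fin m → SmoothFun n M), ∀ c ∈ 𝒞.body,
      (∀ i, ∀ e ∈ 𝒞.fiber c, dAt c (f i) e = 0) → P m f c = 0) : P ∈ 𝒞.ideal := by
  classical
  refine ⟨hP, fun c => ?_⟩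
  by_cases hc : c ∈ 𝒞.body
  · obtain ⟨r, e, a, y, he, hdec, hann⟩ := 𝒞.exists_adapted_decomposition hc
    obtain ⟨W, hW, hWo, hcW⟩ := eventually_nhds_iff.1 (hdec.and (eventually_nhdsWithin_iff.1 hann))
    obtain ⟨χ, hχ1, hχW⟩ := exists_bump (n := n) (hWo.mem_nhds hcW)
    -- `dg = ∑ i, (e i g) d(hz z i)` at the points `z` near `c`, and the function
    -- `K m J : z ↦ P m (hz z ∘ J) z` is smooth although `hz z` varies with `z`
    let hz (z : M) (i : Fin r ⊕ Fin n) : SmoothFun n M := ∑ l, a i l z • y l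
    let K (m : ℕ) (J : Fin m → Fin r ⊕ Fin n) : SmoothFun n M :=
      ∑ L : Fin m → Fin n, (∏ b, a (J b) (L b)) * P m (y ∘ L)
    have hK (m : ℕ) (J : Fin m → Fin r ⊕ Fin n) (z : M) : K m J z = P m (hz z ∘ J) z := by
      have h3 := (P m).toMultilinearMap.map_sum
        (fun (b : Fin m) (l : Fin n) => a (J b) l z • y l)
      have h4 (L : Fin m → Fin n) := (P m).toMultilinearMap.map_smul_univ
        (fun b => a (J b) (L b) z) (fun b => y (L b))
      simp only [h4] at h3
      have h5 : P m (hz z ∘ J) z = _ := congrArg (fun F : SmoothFun n M => F z) h3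
      rw [h5, smoothFun_sum_apply, smoothFun_sum_apply]
      refine Finset.sum_congr rfl fun L _ => ?_
      change (∏ b, a (J b) (L b)) z * P m (y ∘ L) z = _ * P m (y ∘ L) z
      rw [smoothFun_prod_apply]
    -- the cutoff of the expansion of `P m`; it vanishes if `m` exceeds the number of the `e i`
    let T (m : ℕ) : (SmoothFun n M) [⋀^Fin m]→ₗ[ℝ] (SmoothFun n M) :=
      (m.factorial : ℝ)⁻¹ • ∑ J : Fin m → Fin r ⊕ Fin n, (χ * K m J) • multiField (e ∘ J)
    have hT (m : ℕ) (f : Fin m → SmoothFun n M) (z : M) (hzW : z ∈ W) (hz1 : χ z = 1) :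
        P m f z = T m f z := by
      rw [multiderivation_eq_sum_multiField (hP m) e (hz z) z (hW z hzW).1]
      change _ = (m.factorial : ℝ)⁻¹ * (∑ J : Fin m → Fin r ⊕ Fin n,
        (χ * K m J) • multiField (e ∘ J) : (SmoothFun n M) [⋀^Fin m]→ₗ[ℝ] (SmoothFun n M)) f z
      rw [alternatingMap_sum_apply, smoothFun_sum_apply]
      congr 1
      refine Finset.sum_congr rfl fun J _ => ?_
      change _ = (χ z * K m J z) * multiField (e ∘ J) f z
      rw [hK, hz1, one_mul]
    have hT0 (m : ℕ) (hm : r + n < m) : T m = 0 := by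
      have : ∀ J : Fin m → Fin r ⊕ Fin n, multiField (e ∘ J) = 0 := fun J =>
        multiField_eq_zero _ fun hJ => by
          have := Fintype.card_le_of_injective J hJ.of_comp
          simp at this
          omega
      simp [T, this]
    have hmem (m : ℕ) : (Pi.single m (T m) : Cochain n M) ∈
        idealSpan (𝒞.vanishingFunctions ∪ 𝒞.tangentFields) := by
      have h1 : (Pi.single m (T m) : Cochain n M) = (m.factorial : ℝ)⁻¹ •
          ∑ J : Fin m → Fin r ⊕ Fin n, (χ * K m J) •
            (Pi.single m (multiField (e ∘ J)) : Cochain n M) := by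
        funext k
        by_cases hk : k = m
        · subst hk
          simp [T]
        · simp [hk]
      rw [h1]
      refine Submodule.smul_mem _ _ (Submodule.sum_mem _ fun J _ => ?_)
      -- a summand has a factor in `E`, or else its coefficient vanishes on `C`
      by_cases hJ : ∃ b i, J b = .inl i
      · obtain ⟨b, i, hb⟩ := hJ
        refine smul_mem_idealSpan _ (single_multiField_mem_idealSpan _ b (Or.inr ?_))
        rw [Function.comp_apply, hb]
        exact he i
      · have hJ' (b : Fin m) : ∃ j, J b = .inr j := by
          rcases hb : J b with i | j
          · exact absurd ⟨b, i, hb⟩ hJ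
          · exact ⟨j, rfl⟩
        have h2 : (χ * K m J) • (Pi.single m (multiField (e ∘ J)) : Cochain n M) =
            wedge (Pi.single m (multiField (e ∘ J))) (ofFun (χ * K m J)) := by
          funext k
          ext f : 1
          rw [wedge_ofFun]
          exact mul_comm _ _
        rw [h2]
        refine Submodule.subset_span ⟨_, single_mem_functions (isMultiderivation_multiField _), _,
          Or.inl ⟨χ * K m J, fun z hzC => ?_, rfl⟩, rfl⟩
        change χ z * K m J z = 0
        by_cases hzW : z ∈ W
        · rw [hK, h m _ z hzC, mul_zero]
          intro b v hv
          obtain ⟨j, hj⟩ := hJ' b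
          rw [Function.comp_apply, hj]
          exact (hW z hzW).2 hzC j v hv
        · rw [image_eq_zero_of_notMem_tsupport fun hh => hzW (hχW hh), zero_mul]
    refine ⟨{z | χ z = 1} ∩ W, Filter.inter_mem hχ1 (hWo.mem_nhds hcW),
      ∑ m ∈ Finset.range (r + n + 1), Pi.single m (T m), Submodule.sum_mem _ fun m _ => hmem m, ?_⟩
    rintro k f z ⟨hz1, hzW⟩
    rw [hT k f z hzW hz1, Finset.sum_apply, Finset.sum_pi_single]
    split_ifs with hk
    · rfl
    · rw [hT0 k (by simpa using hk)]
  · obtain ⟨χ, hχ1, hχ⟩ := exists_bump (n := n) (𝒞.isClosed_body.isOpen_compl.mem_nhds hc)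
    refine ⟨_, hχ1, wedge P (ofFun χ), Submodule.subset_span ⟨P, hP, _, Or.inl ⟨χ, fun z hz => ?_,
      rfl⟩, rfl⟩, fun k f z hz => ?_⟩
    · exact image_eq_zero_of_notMem_tsupport fun h => hχ h hz
    · rw [wedge_ofFun]
      change _ = P k f z * χ z
      have hz : χ z = 1 := hz
      rw [hz, mul_one]

end GradedSubmanifold

end

/-! ### Submersions -/

section

section Submersion
variable {d q : ℕ} {N : Type*} [TopologicalSpace N] [ChartedSpace (EuclideanSpace ℝ (Fin d)) N]
  {Q : Type*} [TopologicalSpace Q] [ChartedSpace (EuclideanSpace ℝ (Fin q)) Q] {f : N → Q}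

/-- The chart description of a submersion: `f = ψ⁻¹ ∘ fst ∘ Φ` near `x`, with `Φ` a diffeomorphism
onto an open subset of a product. -/
theorem exists_submersion_charts (hf : Manifold.IsSubmersion (𝓡 d) (𝓡 q) ∞ f) (x : N) :
    ∃ (F : Type) (_ : NormedAddCommGroup F) (_ : NormedSpace ℝ F)
      (φ : OpenPartialHomeomorph N (EuclideanSpace ℝ (Fin d)))
      (ψ : OpenPartialHomeomorph Q (EuclideanSpace ℝ (Fin q)))
      (e : EuclideanSpace ℝ (Fin d) ≃L[ℝ] (EuclideanSpace ℝ (Fin q) × F)),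
      x ∈ φ.source ∧ f x ∈ ψ.source ∧ ContMDiffOn (𝓡 d) (𝓡 d) ∞ φ.symm φ.target ∧
      ContMDiffOn (𝓡 q) (𝓡 q) ∞ ψ ψ.source ∧
      ∀ y ∈ φ.source, f y ∈ ψ.source ∧ ψ (f y) = (e (φ y)).1 := by
  obtain ⟨F, _, _, hF⟩ := hf
  have h := hF x
  refine ⟨F, _, _, h.domChart, h.codChart, h.equiv, h.mem_domChart_source, h.mem_codChart_source,
    contMDiffOn_symm_of_mem_maximalAtlas h.domChart_mem_maximalAtlas,
    contMDiffOn_of_mem_maximalAtlas h.codChart_mem_maximalAtlas, fun y hy => ?_⟩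
  refine ⟨h.source_subset_preimage_source hy, ?_⟩
  have hmem : h.domChart y ∈ (h.domChart.extend (𝓡 d)).target := by
    simpa using h.domChart.map_source hy
  have := h.writtenInCharts hmem
  simpa [h.domChart.left_inv hy] using this

/-- A submersion has smooth local sections. -/
theorem exists_localSection (hf : Manifold.IsSubmersion (𝓡 d) (𝓡 q) ∞ f) (x : N) :
    ∃ s : Q → N, s (f x) = x ∧ ContMDiffAt (𝓡 q) (𝓡 d) ∞ s (f x) ∧
      ∀ᶠ z in 𝓝 (f x), f (s z) = z := by
  obtain ⟨F, _, _, φ, ψ, e, hx, hfx, hφ, hψ, h⟩ := exists_submersion_charts hf x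
  set a := (e (φ x)).2
  set g : EuclideanSpace ℝ (Fin q) → EuclideanSpace ℝ (Fin d) := fun u => e.symm (u, a) with hg
  have hgs : ContDiff ℝ ∞ g := by fun_prop
  have hgm : ContMDiff (𝓡 q) (𝓡 d) ∞ g := hgs.contMDiff
  have h0 : g (ψ (f x)) = φ x := by
    rw [(h x hx).2]
    simp [hg, a]
  have h1 : ContMDiffAt (𝓡 q) (𝓡 d) ∞ (fun z => g (ψ z)) (f x) :=
    hgm.contMDiffAt.comp (f x) ((hψ _ hfx).contMDiffAt (ψ.open_source.mem_nhds hfx))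
  have h2 : ∀ᶠ z in 𝓝 (f x), g (ψ z) ∈ φ.target := by
    refine h1.continuousAt.eventually_mem (φ.open_target.mem_nhds ?_)
    rw [h0]
    exact φ.map_source hx
  refine ⟨fun z => φ.symm (g (ψ z)), ?_, ?_, ?_⟩
  · change φ.symm (g (ψ (f x))) = x
    rw [h0, φ.left_inv hx]
  · refine ContMDiffAt.comp (f x) (g := φ.symm) (I' := 𝓡 d) ?_ h1
    rw [h0]
    exact (hφ _ (φ.map_source hx)).contMDiffAt (φ.open_target.mem_nhds (φ.map_source hx))
  · filter_upwards [h2, ψ.open_source.mem_nhds hfx] with z hz hzs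
    obtain ⟨h3, h4⟩ := h _ (φ.map_target hz)
    refine ψ.injOn h3 hzs ?_
    rw [h4, φ.right_inv hz]
    simp [hg]

theorem surjective_mfderiv_of_isSubmersion (hf : Manifold.IsSubmersion (𝓡 d) (𝓡 q) ∞ f) (x : N) :
    Function.Surjective (mfderiv (𝓡 d) (𝓡 q) f x) := by
  obtain ⟨s, hs, hs1, hs2⟩ := exists_localSection hf x
  intro w
  have h1 : MDifferentiableAt (𝓡 d) (𝓡 q) f (s (f x)) :=
    (hf.contMDiff (s (f x))).mdifferentiableAt (by simp)
  have h2 := mfderiv_comp_apply (f x) h1 (hs1.mdifferentiableAt (by simp)) w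
  have h3 : f ∘ s =ᶠ[𝓝 (f x)] id := hs2
  rw [h3.mfderiv_eq, mfderiv_id] at h2
  rw [hs] at h2
  exact ⟨_, h2.symm⟩

/-- A function whose differential vanishes on the kernel of the differential of a submersion is
locally constant along its fibers. -/
theorem eventually_eq_of_mfderiv_eq_zero (hf : Manifold.IsSubmersion (𝓡 d) (𝓡 q) ∞ f)
    {u : N → ℝ} (hu : ContMDiff (𝓡 d) 𝓘(ℝ, ℝ) ∞ u)
    (h0 : ∀ y (w : TangentSpace (𝓡 d) y), mfderiv (𝓡 d) (𝓡 q) f y w = 0 →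
      mfderiv (𝓡 d) 𝓘(ℝ, ℝ) u y w = 0) (x : N) : ∀ᶠ y in 𝓝 x, f y = f x → u y = u x := by
  obtain ⟨F, _, _, φ, ψ, e, hx, hfx, hφ, hψ, h⟩ := exists_submersion_charts hf x
  set a := e (φ x) with ha
  have hO : IsOpen {v : F | e.symm (a.1, v) ∈ φ.target} := φ.open_target.preimage (by fun_prop)
  obtain ⟨ε, hε, hball⟩ := Metric.isOpen_iff.1 hO a.2 (by simp [ha, φ.map_source hx])
  set γ : F → N := fun v => φ.symm (e.symm (a.1, v)) with hγ
  have hγs (v : F) (hv : v ∈ Metric.ball a.2 ε) : ContMDiffAt 𝓘(ℝ, F) (𝓡 d) ∞ γ v := by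
    have h1 : ContDiff ℝ ∞ fun v : F => e.symm (a.1, v) := by fun_prop
    exact ((hφ _ (hball hv)).contMDiffAt (φ.open_target.mem_nhds (hball hv))).comp v
      h1.contMDiff.contMDiffAt
  have hfγ (v : F) (hv : v ∈ Metric.ball a.2 ε) : f (γ v) = f x := by
    obtain ⟨h3, h4⟩ := h _ (φ.map_target (hball hv))
    refine ψ.injOn h3 hfx ?_
    rw [h4, φ.right_inv (hball hv), (h x hx).2]
    simp [ha]
  -- `u` is constant along the slice `γ` of the fiber
  have hconst (v : F) (hv : v ∈ Metric.ball a.2 ε) : u (γ v) = u (γ a.2) := by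
    have hd (v : F) (hv : v ∈ Metric.ball a.2 ε) : MDifferentiableAt 𝓘(ℝ, F) 𝓘(ℝ, ℝ) (u ∘ γ) v :=
      ((hu.contMDiffAt).comp v (hγs v hv)).mdifferentiableAt (by simp)
    refine Metric.isOpen_ball.is_const_of_fderiv_eq_zero (𝕜 := ℝ) (f := u ∘ γ)
      (convex_ball a.2 ε).isPreconnected (fun v hv => ?_) (fun v hv => ?_) hv
      (Metric.mem_ball_self hε)
    · exact (hd v hv).differentiableAt.differentiableWithinAt
    · rw [← mfderiv_eq_fderiv]
      ext w
      have h5 := mfderiv_comp_apply v ((hu (γ v)).mdifferentiableAt (by simp))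
        ((hγs v hv).mdifferentiableAt (by simp)) w
      refine h5.trans (h0 _ _ ?_)
      have h6 := mfderiv_comp_apply v ((hf.contMDiff (γ v)).mdifferentiableAt (by simp))
        ((hγs v hv).mdifferentiableAt (by simp)) w
      have h7 : f ∘ γ =ᶠ[𝓝 v] fun _ => f x := by
        filter_upwards [Metric.isOpen_ball.mem_nhds hv] with v' hv' using hfγ v' hv'
      rw [h7.mfderiv_eq, mfderiv_const] at h6
      exact h6.symm
  have hcont : ContinuousAt (fun y => (e (φ y)).2) x :=
    (continuous_snd.comp e.continuous).continuousAt.comp (φ.continuousAt hx)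
  filter_upwards [φ.open_source.mem_nhds hx, hcont.eventually_mem (Metric.ball_mem_nhds _ hε)]
    with y hy hyb hyf
  have h8 : (e (φ y)).1 = a.1 := by rw [← (h y hy).2, hyf, (h x hx).2]
  have h9 : γ (e (φ y)).2 = y := by
    simp only [hγ, ← h8]
    simp [φ.left_inv hy]
  have h10 : γ a.2 = x := by simp [hγ, ha, φ.left_inv hx]
  rw [← h9, hconst _ hyb, h10]

/-- A function whose differential vanishes on the kernel of the differential of a surjective
submersion with connected fibers is the pullback of a smooth function. -/
theorem exists_eq_comp_of_mfderiv_eq_zero (hf : Manifold.IsSubmersion (𝓡 d) (𝓡 q) ∞ f)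
    (hsurj : Function.Surjective f) (hconn : ∀ z, IsConnected (f ⁻¹' {z}))
    {u : N → ℝ} (hu : ContMDiff (𝓡 d) 𝓘(ℝ, ℝ) ∞ u)
    (h0 : ∀ y (w : TangentSpace (𝓡 d) y), mfderiv (𝓡 d) (𝓡 q) f y w = 0 →
      mfderiv (𝓡 d) 𝓘(ℝ, ℝ) u y w = 0) : ∃ h : SmoothFun q Q, ∀ y, u y = h (f y) := by
  have hc (x y : N) (hxy : f x = f y) : u x = u y := by
    have : PreconnectedSpace (f ⁻¹' {f y}) :=
      isPreconnected_iff_preconnectedSpace.1 (hconn (f y)).isPreconnected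
    have hl : IsLocallyConstant fun z : f ⁻¹' {f y} => u z := by
      rw [IsLocallyConstant.iff_eventually_eq]
      intro z
      have h1 := eventually_eq_of_mfderiv_eq_zero hf hu h0 (z : N)
      have h2 : Filter.Tendsto (Subtype.val : f ⁻¹' {f y} → N) (𝓝 z) (𝓝 (z : N)) :=
        continuous_subtype_val.continuousAt
      filter_upwards [h2.eventually h1] with w hw
      exact hw ((w.2 : f w = f y).trans (z.2 : f z = f y).symm)
    exact hl.apply_eq_of_preconnectedSpace ⟨x, hxy⟩ ⟨y, rfl⟩
  choose t ht using hsurj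
  refine ⟨⟨fun z => u (t z), fun z => ?_⟩, fun y => hc _ _ (ht _).symm⟩
  obtain ⟨s, hs, hs1, hs2⟩ := exists_localSection hf (t z)
  rw [ht] at hs hs1 hs2
  have h1 : ContMDiffAt (𝓡 q) 𝓘(ℝ, ℝ) ∞ (fun w => u (s w)) z := hu.contMDiffAt.comp z hs1
  refine h1.congr_of_eventuallyEq ?_
  filter_upwards [hs2] with w hw
  exact hc _ _ (by rw [ht, hw])

end Submersion

end

/-! ### Functions on the quotient -/

section

namespace GradedSubmanifold

variable {n : ℕ} {M : Type*} [TopologicalSpace M] [ChartedSpace (EuclideanSpace ℝ (Fin n)) M]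
  [IsManifold (𝓡 n) ∞ M] {𝒞 : GradedSubmanifold n M} {q : ℕ} {Q : Type*} [TopologicalSpace Q]
  [ChartedSpace (EuclideanSpace ℝ (Fin q)) Q] {pr : 𝒞.body → Q}

/-- A function on `M` whose differential annihilates `E ∩ TC` restricts on `C` to the pullback of a
function on the quotient. -/
theorem IsSmoothQuotient.exists_descent (hpr : 𝒞.IsSmoothQuotient q pr) (u : SmoothFun n M)
    (hu : ∀ c ∈ 𝒞.body, ∀ v ∈ 𝒞.fiber c, v ∈ 𝒞.tangent c → dAt c u v = 0) :
    ∃ h : SmoothFun q Q, ∀ y : 𝒞.body, u y = h (pr y) := by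
  refine exists_eq_comp_of_mfderiv_eq_zero hpr.isSubmersion hpr.surjective hpr.isConnected_fiber
    (u := fun y : 𝒞.body => u y) (u.contMDiff.comp 𝒞.isSmoothEmbedding.contMDiff) fun y w hw => ?_
  rw [hpr.ker_eq] at hw
  exact (𝒞.dAt_inclDeriv u y w).symm.trans
    (hu _ y.2 _ hw (𝒞.inclDeriv_mem_tangent y w))

theorem IsSmoothQuotient.finrank_ker (hpr : 𝒞.IsSmoothQuotient q pr) (y : 𝒞.body) :
    Module.finrank ℝ (LinearMap.ker (mfderiv (𝓡 𝒞.dim) (𝓡 q) pr y).toLinearMap) + q = 𝒞.dim := by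
  have : FiniteDimensional ℝ (TangentSpace (𝓡 𝒞.dim) y) :=
    inferInstanceAs (FiniteDimensional ℝ (EuclideanSpace ℝ (Fin 𝒞.dim)))
  have h1 := LinearMap.finrank_range_add_finrank_ker (mfderiv (𝓡 𝒞.dim) (𝓡 q) pr y).toLinearMap
  rw [LinearMap.range_eq_top.2 (surjective_mfderiv_of_isSubmersion hpr.isSubmersion y),
    finrank_top] at h1
  have h2 : Module.finrank ℝ (TangentSpace (𝓡 q) (pr y)) = q := finrank_euclideanSpace_fin
  have h3 : Module.finrank ℝ (TangentSpace (𝓡 𝒞.dim) y) = 𝒞.dim := finrank_euclideanSpace_fin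
  omega

theorem IsSmoothQuotient.dAt_inclDeriv_eq (hpr : 𝒞.IsSmoothQuotient q pr) {g : SmoothFun n M}
    {f : SmoothFun q Q} {y : 𝒞.body} (h : ∀ᶠ z : 𝒞.body in 𝓝 y, g z = f (pr z))
    (w : TangentSpace (𝓡 𝒞.dim) y) :
    dAt (y : M) g (𝒞.inclDeriv y w) = dAt (pr y) f (mfderiv (𝓡 𝒞.dim) (𝓡 q) pr y w) := by
  have h1 := mfderiv_comp_apply y (mdifferentiableAt_smoothFun f (pr y))
    ((hpr.isSubmersion.contMDiff y).mdifferentiableAt (by simp)) w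
  have h2 : (fun z : 𝒞.body => g z) =ᶠ[𝓝 y] f ∘ pr := h
  have h3 := h2.mfderiv_eq (I := 𝓡 𝒞.dim) (I' := 𝓘(ℝ, ℝ))
  exact (𝒞.dAt_inclDeriv g y w).trans ((congrArg (fun L => (L w : ℝ)) h3).trans h1)

variable [T2Space M]

/-- Local lifts: an extension `g₀` of the pullback is corrected by a combination of functions `κ l`
vanishing on `C`, so that its differential annihilates `E`. The coefficients solve a linear system
of constant rank, since `E ∩ TC` is the kernel of `d pr`. -/
theorem IsSmoothQuotient.exists_local_lift (hpr : 𝒞.IsSmoothQuotient q pr) (f : SmoothFun q Q)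
    {c : M} (hc : c ∈ 𝒞.body) : ∃ g : SmoothFun n M, ∀ᶠ y in 𝓝[𝒞.body] c,
      (∀ hy : y ∈ 𝒞.body, g y = f (pr ⟨y, hy⟩)) ∧ ∀ e ∈ 𝒞.fiber y, dAt y g e = 0 := by
  obtain ⟨W, hW, hcW, p, hp, hpW⟩ := 𝒞.exists_retraction ⟨c, hc⟩
  obtain ⟨g₀, hg₀⟩ := exists_smoothFun_eventuallyEq (n := n) hW hcW
    (g := fun z => f (pr (p z))) ((f.contMDiff.comp hpr.isSubmersion.contMDiff).comp_contMDiffOn hp)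
  have hg₁ : ∀ᶠ y in 𝓝 c, ∀ hy : y ∈ 𝒞.body, g₀ y = f (pr ⟨y, hy⟩) := by
    filter_upwards [hg₀, hW.mem_nhds hcW] with y hy hyW hyC
    rw [hy, hpW ⟨y, hyC⟩ hyW]
  obtain ⟨κ, hκ, hκC⟩ := 𝒞.exists_conormalFrame hc
  obtain ⟨r, X, hX, hXs⟩ := 𝒞.exists_fiberFrame hc
  let N : Matrix (Fin r) (Fin n) (SmoothFun n M) := fun k l => X k (κ l)
  let b : Fin r → SmoothFun n M := fun k => X k g₀
  -- the left kernel of the matrix is isomorphic to `E ∩ TC`, hence to the kernel of `d pr`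
  have key : ∀ᶠ y in 𝓝[𝒞.body] c,
      Module.finrank ℝ (LinearMap.ker (N.map fun f => f y).vecMulLinear) + q = 𝒞.dim ∧
      ∀ a : Fin r → ℝ, Matrix.vecMul a (N.map fun f => f y) = 0 → ∑ k, a k * b k y = 0 := by
    filter_upwards [hXs, hκC, eventually_nhdsWithin_of_eventually_nhds hg₁.eventually_nhds,
      self_mem_nhdsWithin] with y ⟨s, hs, hsE, hsX⟩ hy2 hy3 hy
    let L : (Fin r → ℝ) →ₗ[ℝ] TangentSpace (𝓡 n) y := Fintype.linearCombination ℝ s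
    have hL (a : Fin r → ℝ) : L a = ∑ k, a k • s k := rfl
    have hLinj : Function.Injective L := by
      rw [← LinearMap.ker_eq_bot, LinearMap.ker_eq_bot']
      exact fun a ha => funext fun k => Fintype.linearIndependent_iff.1 hs a ha k
    have hLE (a : Fin r → ℝ) : L a ∈ 𝒞.fiber y := by
      rw [← hsE, hL]
      exact Submodule.sum_mem _ fun k _ =>
        Submodule.smul_mem _ _ (Submodule.subset_span ⟨k, rfl⟩)
    have hd (a : Fin r → ℝ) (g : SmoothFun n M) : dAt y g (L a) = ∑ k, a k * X k g y := by
      rw [hL, map_sum]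
      simp [hsX]
    have hker (a : Fin r → ℝ) : a ∈ LinearMap.ker (N.map fun f => f y).vecMulLinear ↔
        L a ∈ 𝒞.tangent y := by
      have h1 : a ∈ LinearMap.ker (N.map fun f => f y).vecMulLinear ↔
          ∀ l, dAt y (κ l) (L a) = 0 := by
        simp only [hd]
        exact funext_iff
      rw [h1]
      refine ⟨hy2 _, fun h l => ?_⟩
      rw [𝒞.dAt_tangent_congr (g := 0) h hy (by
        filter_upwards [self_mem_nhdsWithin] with z hz using hκ l z hz)]
      simp
    have htan (v : TangentSpace (𝓡 n) y) : v ∈ 𝒞.tangent y ↔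
        ∃ w, 𝒞.inclDeriv ⟨y, hy⟩ w = v := by
      rw [𝒞.tangent_coe ⟨y, hy⟩]
      rfl
    constructor
    · rw [← hpr.finrank_ker ⟨y, hy⟩]
      congr 1
      rw [(Submodule.equivMapOfInjective L hLinj _).finrank_eq,
        (Submodule.equivMapOfInjective (𝒞.inclDeriv ⟨y, hy⟩).toLinearMap
          (𝒞.inclDeriv_injective ⟨y, hy⟩) _).finrank_eq]
      refine congrArg (fun S : Submodule ℝ (TangentSpace (𝓡 n) y) => Module.finrank ℝ S) ?_
      ext v
      constructor
      · rintro ⟨a, ha, rfl⟩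
        obtain ⟨w, hw⟩ := (htan _).1 ((hker a).1 ha)
        refine ⟨w, ?_, hw⟩
        refine (hpr.ker_eq _ w).2 ?_
        rw [hw]
        exact hLE a
      · rintro ⟨w, hw, rfl⟩
        have h4 : 𝒞.inclDeriv ⟨y, hy⟩ w ∈ 𝒞.fiber y := (hpr.ker_eq ⟨y, hy⟩ w).1 hw
        have h5 := h4
        rw [← hsE] at h5
        obtain ⟨a, ha⟩ := (Submodule.mem_span_range_iff_exists_fun ℝ).1 h5
        refine ⟨a, (hker a).2 ((htan _).2 ⟨w, ?_⟩), ha⟩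
        exact ha.symm
    · intro a ha
      obtain ⟨w, hw⟩ := (htan _).1 ((hker a).1 ha)
      have h4 : mfderiv (𝓡 𝒞.dim) (𝓡 q) pr ⟨y, hy⟩ w = 0 := by
        refine (hpr.ker_eq _ w).2 ?_
        rw [hw]
        exact hLE a
      have h5 := hpr.dAt_inclDeriv_eq (g := g₀) (f := f) (y := ⟨y, hy⟩) (by
        have h6 : Filter.Tendsto (Subtype.val : 𝒞.body → M) (𝓝 ⟨y, hy⟩) (𝓝 y) :=
          continuous_subtype_val.continuousAt
        filter_upwards [h6.eventually hy3] with z hz using hz z.2) w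
      rw [h4, map_zero] at h5
      rw [← hd, ← hw]
      exact h5
  obtain ⟨a₀, h₀⟩ := mem_range_mulVecLin (N.map fun f => f c) (fun k => b k c)
    (key.self_of_nhdsWithin hc).2
  obtain ⟨a, -, ha⟩ := exists_smooth_solution N b (by
      filter_upwards [key] with y hy
      have := (key.self_of_nhdsWithin hc).1
      have := hy.1
      omega) (key.mono fun y hy => hy.2) a₀ fun k => congrFun h₀ k
  refine ⟨g₀ - ∑ l, a l * κ l, ?_⟩
  filter_upwards [ha, hXs, eventually_nhdsWithin_of_eventually_nhds hg₁, self_mem_nhdsWithin]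
    with y hy1 ⟨s, hs, hsE, hsX⟩ hy3 hy
  constructor
  · intro hy'
    have : (∑ l, a l * κ l) y = 0 := by
      rw [smoothFun_sum_apply]
      refine Finset.sum_eq_zero fun l _ => ?_
      change a l y * κ l y = 0
      rw [hκ l y hy, mul_zero]
    change g₀ y - (∑ l, a l * κ l) y = _
    rw [this, sub_zero, hy3]
  · intro e he
    rw [← hsE] at he
    obtain ⟨t, rfl⟩ := (Submodule.mem_span_range_iff_exists_fun ℝ).1 he
    rw [map_sum]
    refine Finset.sum_eq_zero fun k _ => ?_
    have h1 (l : Fin n) : dAt y (a l * κ l) (s k) = X k (κ l) y * a l y := by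
      rw [dAt_mul, hκ l y hy, zero_smul, add_zero, hsX]
      exact mul_comm _ _
    have h2 : dAt y (∑ l, a l * κ l) (s k) = ∑ l, X k (κ l) y * a l y := by
      rw [map_sum]
      simp [h1]
    have h3 : dAt y (g₀ - ∑ l, a l * κ l) (s k) = 0 := by
      rw [map_sub]
      change dAt y g₀ (s k) - dAt y (∑ l, a l * κ l) (s k) = 0
      rw [h2, ← hsX, hy1 k]
      exact sub_self _
    rw [map_smul, h3, smul_zero]

/-- Every function on the quotient has a lift: a function on `M` which restricts to its pullback on
`C` and whose differential annihilates `E`. -/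
theorem IsSmoothQuotient.exists_lift [SigmaCompactSpace M] (hpr : 𝒞.IsSmoothQuotient q pr)
    (f : SmoothFun q Q) : ∃ g : SmoothFun n M, (∀ y : 𝒞.body, g y = f (pr y)) ∧
      ∀ c ∈ 𝒞.body, ∀ e ∈ 𝒞.fiber c, dAt c g e = 0 := by
  have hloc (x : M) : ∃ (U : Set M) (g : SmoothFun n M), IsOpen U ∧ x ∈ U ∧
      ∀ y ∈ U, ∀ hy : y ∈ 𝒞.body, g y = f (pr ⟨y, hy⟩) ∧ ∀ e ∈ 𝒞.fiber y, dAt y g e = 0 := by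
    by_cases hx : x ∈ 𝒞.body
    · obtain ⟨g, hg⟩ := hpr.exists_local_lift f hx
      obtain ⟨U, hU, hUo, hxU⟩ := eventually_nhds_iff.1 (eventually_nhdsWithin_iff.1 hg)
      exact ⟨U, g, hUo, hxU, fun y hyU hy => ⟨(hU y hyU hy).1 hy, (hU y hyU hy).2⟩⟩
    · exact ⟨𝒞.bodyᶜ, 0, 𝒞.isClosed_body.isOpen_compl, hx, fun y hyU hy => absurd hy hyU⟩
  choose U g hUo hxU hg using hloc
  obtain ⟨ρ, hρ⟩ := SmoothPartitionOfUnity.exists_isSubordinate (𝓡 n) isClosed_univ U hUo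
    fun x _ => Set.mem_iUnion.2 ⟨x, hxU x⟩
  let G : SmoothFun n M := ⟨fun y => ∑ᶠ i, ρ i y • g i y,
    ρ.contMDiff_finsum_smul fun i x _ => (g i).contMDiff x⟩
  have hG (x : M) : G =ᶠ[𝓝 x] (∑ i ∈ ρ.fintsupport x, ρ i * g i : SmoothFun n M) ∧
      (1 : SmoothFun n M) =ᶠ[𝓝 x] (∑ i ∈ ρ.fintsupport x, ρ i : SmoothFun n M) := by
    constructor
    · filter_upwards [ρ.eventually_finsupport_subset x] with y hy
      rw [smoothFun_sum_apply]
      refine (ρ.sum_finsupport_smul_eq_finsum y (fun i => g i)).symm.trans ?_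
      refine Finset.sum_subset hy fun i _ hi => ?_
      rw [ρ.mem_finsupport, Function.notMem_support] at hi
      rw [hi, zero_smul]
    · filter_upwards [ρ.eventually_finsupport_subset x] with y hy
      rw [smoothFun_sum_apply]
      exact (ρ.sum_finsupport' y (Set.mem_univ y) hy).symm
  have hU (c : M) (i : M) (hi : i ∈ ρ.fintsupport c) : c ∈ U i :=
    hρ i ((ρ.mem_fintsupport_iff c i).1 hi)
  refine ⟨G, fun y => ?_, fun c hc e he => ?_⟩
  · have h1 := (hG y).1.self_of_nhds
    have h2 := (hG y).2.self_of_nhds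
    rw [smoothFun_sum_apply] at h1 h2
    rw [h1]
    have h3 : ∀ i ∈ ρ.fintsupport (y : M), (ρ i * g i : SmoothFun n M) y = ρ i y * f (pr y) := by
      intro i hi
      rw [← (hg i y (hU y i hi) y.2).1]
      rfl
    rw [Finset.sum_congr rfl h3, ← Finset.sum_mul, ← h2]
    exact one_mul _
  -- the local lifts have the same value at `c`, and the differentials of the `ρ i` have sum zero
  · rw [dAt_congr (hG c).1]
    have h2 := congr($(dAt_congr (hG c).2) e)
    rw [map_sum] at h2 ⊢
    have h3 : ∀ i ∈ ρ.fintsupport c, dAt c (ρ i * g i : SmoothFun n M) e =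
        f (pr ⟨c, hc⟩) * dAt c (ρ i) e := by
      intro i hi
      obtain ⟨h4, h5⟩ := hg i c (hU c i hi) hc
      rw [dAt_mul, ← h4]
      change ρ i c * dAt c (g i) e + _ * _ = _
      rw [h5 e he, mul_zero, zero_add]
      rfl
    have h6 : dAt c (1 : SmoothFun n M) = 0 := dAt_const _ _
    rw [h6] at h2
    simp only [sum_apply] at h2 ⊢
    rw [Finset.sum_congr rfl h3, ← Finset.mul_sum, ← h2]
    exact mul_zero _

/-- At a point of `C`, the differential of a function which annihilates `E` agrees on `TC` with that
of a lift. -/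
theorem IsSmoothQuotient.exists_lift_dAt_eq [IsManifold (𝓡 q) ∞ Q] [T2Space Q]
    [SigmaCompactSpace M] (hpr : 𝒞.IsSmoothQuotient q pr) (u : SmoothFun n M) {c : M}
    (hc : c ∈ 𝒞.body) (hu : ∀ e ∈ 𝒞.fiber c, dAt c u e = 0) :
    ∃ (f : SmoothFun q Q) (g : SmoothFun n M), (∀ y : 𝒞.body, g y = f (pr y)) ∧
      (∀ c ∈ 𝒞.body, ∀ e ∈ 𝒞.fiber c, dAt c g e = 0) ∧
      ∀ v ∈ 𝒞.tangent c, dAt c g v = dAt c u v := by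
  obtain ⟨t, ht⟩ :=
    (mfderiv (𝓡 𝒞.dim) (𝓡 q) pr ⟨c, hc⟩).toLinearMap.exists_rightInverse_of_surjective
    (LinearMap.range_eq_top.2 (surjective_mfderiv_of_isSubmersion hpr.isSubmersion ⟨c, hc⟩))
  obtain ⟨f, hf⟩ := exists_dAt_eq ((dAt c u).toLinearMap ∘ₗ
    (𝒞.inclDeriv ⟨c, hc⟩).toLinearMap ∘ₗ t)
  obtain ⟨g, hg1, hg2⟩ := hpr.exists_lift f
  refine ⟨f, g, hg1, hg2, fun v hv => ?_⟩
  rw [𝒞.tangent_coe ⟨c, hc⟩] at hv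
  obtain ⟨w, rfl⟩ := hv
  refine (hpr.dAt_inclDeriv_eq (.of_forall hg1) w).trans ((hf _).trans ?_)
  have h1 : mfderiv (𝓡 𝒞.dim) (𝓡 q) pr ⟨c, hc⟩
      (t (mfderiv (𝓡 𝒞.dim) (𝓡 q) pr ⟨c, hc⟩ w) - w) = 0 := by
    rw [map_sub, sub_eq_zero]
    exact LinearMap.congr_fun ht _
  have h2 := hu _ ((hpr.ker_eq _ _).1 h1)
  rw [map_sub, map_sub, sub_eq_zero] at h2
  exact h2

end GradedSubmanifold

end

/-! ### The vanishing ideal and its normalizer -/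

section

theorem update_vec2_zero {A : Type*} (x y g : A) : Function.update ![y, g] 0 x = ![x, g] := by
  funext i
  fin_cases i <;> rfl

section Algebra
variable {A : Type*} [CommRing A] [Algebra ℝ A]

/-- For an alternating map the Leibniz rule may be checked in the first argument. -/
theorem isMultiderivation_of_cons {m : ℕ} {P : A [⋀^Fin (m + 1)]→ₗ[ℝ] A}
    (h : ∀ (f : Fin m → A) (a b : A),
      P (Fin.cons (a * b) f) = a * P (Fin.cons b f) + b * P (Fin.cons a f)) :
    IsMultiderivation P := by
  intro v i a b
  set τ := Equiv.swap (0 : Fin (m + 1)) i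
  have key (x : A) : P (Function.update v i x) =
      Equiv.Perm.sign τ • P (Fin.cons x (Fin.tail (v ∘ τ))) := by
    have h1 : Function.update v i x ∘ τ = Fin.cons x (Fin.tail (v ∘ τ)) := by
      funext j
      refine Fin.cases ?_ (fun j => ?_) j
      · simp [τ]
      · have : τ j.succ ≠ i := by
          intro h
          have : j.succ = τ i := by rw [← h]; simp [τ]
          simp [τ] at this
        simp [this, Fin.tail]
    rw [← h1, P.map_perm, smul_smul, Int.units_mul_self, one_smul]
  rw [key, key, key, h, smul_add, mul_smul_comm, mul_smul_comm]

theorem IsMultiderivation.cons {m : ℕ} {P : A [⋀^Fin (m + 1)]→ₗ[ℝ] A} (h : IsMultiderivation P)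
    (g : A) (v : Fin m → A) (i : Fin m) (a b : A) :
    P (Fin.cons g (Function.update v i (a * b))) =
      a * P (Fin.cons g (Function.update v i b)) + b * P (Fin.cons g (Function.update v i a)) := by
  simp only [Fin.cons_update]
  exact h _ _ _ _

section Two
variable (B : A [⋀^Fin 2]→ₗ[ℝ] A)

theorem map_vec2_swap (a b : A) : B ![a, b] = - B ![b, a] := by
  have := B.map_swap ![b, a] (i := 0) (j := 1) (by simp)
  rw [← this]
  congr 1
  funext i
  fin_cases i <;> rfl

theorem map_vec2_add (a b g : A) : B ![a + b, g] = B ![a, g] + B ![b, g] := by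
  have := B.map_update_add ![0, g] 0 a b
  rwa [update_vec2_zero, update_vec2_zero, update_vec2_zero] at this

theorem map_vec2_sub (a b g : A) : B ![a - b, g] = B ![a, g] - B ![b, g] := by
  have := B.map_update_sub ![0, g] 0 a b
  rwa [update_vec2_zero, update_vec2_zero, update_vec2_zero] at this

theorem map_vec2_smul (t : ℝ) (a g : A) : B ![t • a, g] = t • B ![a, g] := by
  have := B.map_update_smul ![0, g] 0 t a
  rwa [update_vec2_zero, update_vec2_zero] at this

variable {B}

theorem IsMultiderivation.vec2_mul (hB : IsMultiderivation B) (a b g : A) :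
    B ![a * b, g] = a * B ![b, g] + b * B ![a, g] := by
  have := hB ![0, g] 0 a b
  rwa [update_vec2_zero, update_vec2_zero, update_vec2_zero] at this

theorem IsMultiderivation.vec2_mul_right (hB : IsMultiderivation B) (a b g : A) :
    B ![g, a * b] = a * B ![g, b] + b * B ![g, a] := by
  rw [map_vec2_swap, hB.vec2_mul, map_vec2_swap B b, map_vec2_swap B a]
  ring

/-- The Jacobiator of a biderivation is a derivation in its first argument. -/
theorem jacobiator_mul (hB : IsMultiderivation B) (a b g h : A) :
    B ![B ![a * b, g], h] + B ![B ![g, h], a * b] + B ![B ![h, a * b], g] =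
      a * (B ![B ![b, g], h] + B ![B ![g, h], b] + B ![B ![h, b], g]) +
      b * (B ![B ![a, g], h] + B ![B ![g, h], a] + B ![B ![h, a], g]) := by
  simp only [hB.vec2_mul_right, hB.vec2_mul, map_vec2_add]
  linear_combination B ![a, g] * map_vec2_swap B h b + B ![b, g] * map_vec2_swap B h a

end Two

end Algebra

variable {n : ℕ} {M : Type*} [TopologicalSpace M] [ChartedSpace (EuclideanSpace ℝ (Fin n)) M]

theorem bracket_self_mem_functions {P : Cochain n M} (hP : P ∈ functions n M)
    (hP2 : IsHomogeneous 2 P) : bracket P P ∈ functions n M := by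
  intro k
  by_cases hk : k = 3
  · subst hk
    refine isMultiderivation_of_cons fun f a b => ?_
    have h (x : SmoothFun n M) : (Fin.cons x f : Fin 3 → SmoothFun n M) = ![x, f 0, f 1] := by
      funext i
      fin_cases i <;> rfl
    rw [h, h, h]
    rw [bracket_self_three P hP2, bracket_self_three P hP2, bracket_self_three P hP2,
      jacobiator_mul (hP 2), smul_add, mul_smul_comm, mul_smul_comm]
  · rw [bracket_self_of_ne P hP2 k hk]
    intro v i a b
    simp

theorem bracket_ofFun_mem_functions {P : Cochain n M} (hP : P ∈ functions n M)
    (g : SmoothFun n M) : bracket (ofFun g) P ∈ functions n M := by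
  intro k v i a b
  simp only [bracket_ofFun_left]
  rw [(hP (k + 1)).cons, smul_add, neg_add, mul_neg, mul_neg, mul_smul_comm, mul_smul_comm]

variable [IsManifold (𝓡 n) ∞ M]

namespace GradedSubmanifold

variable (𝒞 : GradedSubmanifold n M)

/-- `g` is basic for `𝒞 = E°[1]` if its differential annihilates `E`. The basic functions are the
functions of degree zero in the normalizer of the vanishing ideal. -/
def IsBasic (g : SmoothFun n M) : Prop := ∀ c ∈ 𝒞.body, ∀ e ∈ 𝒞.fiber c, dAt c g e = 0

variable {𝒞}

theorem IsBasic.mul {f g : SmoothFun n M} (hf : 𝒞.IsBasic f) (hg : 𝒞.IsBasic g) :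
    𝒞.IsBasic (f * g) := by
  intro c hc e he
  rw [dAt_mul]
  change f c * dAt c g e + g c * dAt c f e = 0
  rw [hf c hc e he, hg c hc e he, mul_zero, mul_zero, add_zero]

variable [T2Space M]

theorem ofFun_mem_ideal {g : SmoothFun n M} (hg : ∀ y ∈ 𝒞.body, g y = 0) : ofFun g ∈ 𝒞.ideal := by
  refine 𝒞.mem_ideal_of_apply_eq_zero (ofFun_mem_functions g) fun m f c hc _ => ?_
  cases m with
  | zero => rw [ofFun_zero]; exact hg c hc
  | succ m => rw [ofFun_succ]; rfl

theorem mem_ideal_of_mem_tangentFields {X : Cochain n M} (hX : X ∈ 𝒞.tangentFields) :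
    X ∈ 𝒞.ideal := by
  obtain ⟨hX1, hX2, hX3⟩ := hX
  refine 𝒞.mem_ideal_of_apply_eq_zero hX1 fun m f c hc hf => ?_
  by_cases hm : m = 1
  · subst hm
    obtain ⟨v, hv, h⟩ := hX3 c hc
    have : f = ![f 0] := by
      funext i
      rw [Subsingleton.elim i 0]
      rfl
    rw [this, h]
    exact hf 0 v hv
  · rw [hX2 m hm]; rfl

/-- The vanishing ideal is graded. -/
theorem mem_ideal_of_forall_smul {P R : Cochain n M} (hR : R ∈ 𝒞.ideal)
    (h : ∀ m, ∃ a : ℝ, P m = a • R m) : P ∈ 𝒞.ideal := by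
  refine 𝒞.mem_ideal_of_apply_eq_zero (fun k v i a b => ?_) fun m f c hc hf => ?_
  · obtain ⟨t, ht⟩ := h k
    simp only [ht, AlternatingMap.smul_apply, hR.1 k v i a b, smul_add, mul_smul_comm]
  · obtain ⟨t, ht⟩ := h m
    rw [ht]
    change t * R m f c = 0
    rw [𝒞.apply_eq_zero_of_mem_ideal hR f hc hf, mul_zero]

theorem single_mem_ideal {P : Cochain n M} (hP : P ∈ 𝒞.ideal) (m : ℕ) :
    Pi.single m (P m) ∈ 𝒞.ideal := by
  refine mem_ideal_of_forall_smul hP fun k => ?_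
  by_cases hk : k = m
  · subst hk
    exact ⟨1, by simp⟩
  · exact ⟨0, by simp [hk]⟩

theorem body_subset_of_ideal_le {𝒜 : GradedSubmanifold n M} (h : 𝒜.ideal ≤ 𝒞.ideal) :
    𝒞.body ⊆ 𝒜.body := by
  intro c hc
  by_contra hcA
  obtain ⟨χ, h1, h2⟩ := exists_bump (n := n) (𝒜.isClosed_body.isOpen_compl.mem_nhds hcA)
  have h3 : ofFun χ ∈ 𝒞.ideal := h (ofFun_mem_ideal fun y hy =>
    image_eq_zero_of_notMem_tsupport fun h => h2 h hy)
  have h4 := 𝒞.apply_eq_zero_of_mem_ideal h3 (m := 0) ![] hc fun i => i.elim0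
  rw [ofFun_zero] at h4
  have h5 : χ c = 1 := h1.self_of_nhds
  rw [h5] at h4
  exact one_ne_zero h4

theorem fiber_le_of_ideal_le {𝒜 : GradedSubmanifold n M} (h : 𝒜.ideal ≤ 𝒞.ideal) {c : M}
    (hc : c ∈ 𝒞.body) : 𝒜.fiber c ≤ 𝒞.fiber c := by
  intro e he
  obtain ⟨X, hX, hXe⟩ := 𝒜.exists_tangentField_eq (body_subset_of_ideal_le h hc) he
  have hX' := h (mem_ideal_of_mem_tangentFields hX)
  by_contra hne
  obtain ⟨ξ, hξ, hξ0⟩ := Submodule.exists_dual_map_eq_bot_of_notMem hne inferInstance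
  obtain ⟨f, hf⟩ := exists_dAt_eq ξ
  have h4 := 𝒞.apply_eq_zero_of_mem_ideal hX' (m := 1) ![f] hc fun i e he => by
    have : ξ e ∈ (𝒞.fiber c).map ξ := ⟨e, he, rfl⟩
    rw [hξ0] at this
    simpa [hf] using this
  rw [ofDeriv_one] at h4
  exact hξ (((hf e).symm.trans (hXe f).symm).trans h4)

theorem isBasic_of_mem_normalizer {g : SmoothFun n M} (hg : ofFun g ∈ normalizer 𝒞.ideal) :
    𝒞.IsBasic g := by
  intro c hc e he
  obtain ⟨X, hX, hXe⟩ := 𝒞.exists_tangentField_eq hc he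
  have h1 := hg.2 _ (mem_ideal_of_mem_tangentFields hX)
  have h4 := 𝒞.apply_eq_zero_of_mem_ideal h1 (m := 0) ![] hc fun i => i.elim0
  rw [bracket_ofFun_left, show ofDeriv X (0 + 1) = derivHom X from ofDeriv_one X] at h4
  have h5 : -((-1 : ℝ) ^ 0 * X g c) = 0 := h4
  rw [← hXe]
  simpa using h5

/-- Functions vanishing on `C` whose differentials annihilate `D` along `C` are in the relative
normalizer. -/
theorem ofFun_mem_relNormalizer {𝒜 : GradedSubmanifold n M} (h𝒞𝒜 : 𝒜.ideal ≤ 𝒞.ideal)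
    {g : SmoothFun n M} (hg : ∀ c ∈ 𝒞.body, ∀ e ∈ 𝒜.fiber c, dAt c g e = 0) :
    ofFun g ∈ relNormalizer 𝒞.ideal 𝒜.ideal := by
  refine ⟨ofFun_mem_functions g, fun G hG => ?_⟩
  refine 𝒞.mem_ideal_of_apply_eq_zero (bracket_ofFun_mem_functions hG.1 g) fun m f c hc hf => ?_
  rw [bracket_ofFun_left]
  have := 𝒜.apply_eq_zero_of_mem_ideal hG (Fin.cons g f) (body_subset_of_ideal_le h𝒞𝒜 hc)
    fun i => by
      refine Fin.cases ?_ (fun i => ?_) i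
      · exact hg c hc
      · exact fun e he => hf i e (fiber_le_of_ideal_le h𝒞𝒜 hc he)
  change -((-1 : ℝ) ^ m * G (m + 1) (Fin.cons g f) c) = 0
  rw [this, mul_zero, neg_zero]

theorem IsBasic.ofFun_mem_normalizer {g : SmoothFun n M} (hg : 𝒞.IsBasic g) :
    ofFun g ∈ normalizer 𝒞.ideal :=
  ofFun_mem_relNormalizer le_rfl hg

end GradedSubmanifold

end

/-! ### The reduced bivector field -/

section

namespace GradedSubmanifold

variable {n : ℕ} {M : Type*} [TopologicalSpace M] [ChartedSpace (EuclideanSpace ℝ (Fin n)) M]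
  [IsManifold (𝓡 n) ∞ M] [T2Space M] {𝒞 : GradedSubmanifold n M} {F : Cochain n M}

/-- As `{F, κ}` is in the ideal for `κ` vanishing on `C`, so is the contraction of `F` with `dκ`. -/
theorem apply_cons_eq_zero_of_mem_normalizer (hF : F ∈ normalizer 𝒞.ideal) {κ : SmoothFun n M}
    (hκ : ∀ y ∈ 𝒞.body, κ y = 0) {m : ℕ} (f : Fin m → SmoothFun n M) {c : M} (hc : c ∈ 𝒞.body)
    (hf : ∀ i, ∀ e ∈ 𝒞.fiber c, dAt c (f i) e = 0) : F (m + 1) (Fin.cons κ f) c = 0 := by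
  have := 𝒞.apply_eq_zero_of_mem_ideal (hF.2 _ (ofFun_mem_ideal hκ)) f hc hf
  rwa [bracket_ofFun_right] at this

theorem apply_two_eq_zero_of_mem_normalizer (hF : F ∈ normalizer 𝒞.ideal) {κ g : SmoothFun n M}
    (hκ : ∀ y ∈ 𝒞.body, κ y = 0) {c : M} (hc : c ∈ 𝒞.body)
    (hg : ∀ e ∈ 𝒞.fiber c, dAt c g e = 0) : F 2 ![κ, g] c = 0 :=
  apply_cons_eq_zero_of_mem_normalizer hF hκ ![g] hc (by simpa using hg)

/-- The operations in the normalizer preserve basic functions: for a section `X` of `E`, the element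
`{F, X}` of the ideal has on basic functions the value `-X(F(f, g))`, the other terms involving
`X(f)` and `X(g)`, which vanish on `C`. -/
theorem isBasic_apply_two (hF : F ∈ normalizer 𝒞.ideal) {f g : SmoothFun n M} (hf : 𝒞.IsBasic f)
    (hg : 𝒞.IsBasic g) : 𝒞.IsBasic (F 2 ![f, g]) := by
  intro c hc e he
  obtain ⟨X, hX, hXe⟩ := 𝒞.exists_tangentField_eq hc he
  have h1 := 𝒞.apply_eq_zero_of_mem_ideal (hF.2 _ (mem_ideal_of_mem_tangentFields hX)) ![f, g] hc
    (by simpa [Fin.forall_fin_two] using ⟨hf c hc, hg c hc⟩)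
  have h1' := bracket_vectorField_two F (ofDeriv X) (isHomogeneous_single _ _) f g
  rw [ofDeriv_one] at h1'
  have h2 {u : SmoothFun n M} (hu : 𝒞.IsBasic u) (y : M) (hy : y ∈ 𝒞.body) : X u y = 0 := by
    obtain ⟨v, hv, h⟩ := (𝒞.ofDeriv_mem_tangentFields_iff X).1 hX y hy
    rw [h, hu y hy v hv]
  have h3 : F 2 ![X f, g] c - F 2 ![X g, f] c - X (F 2 ![f, g]) c = 0 :=
    (congrArg (fun u : SmoothFun n M => u c) h1').symm.trans h1
  rw [apply_two_eq_zero_of_mem_normalizer hF (h2 hf) hc (hg c hc),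
    apply_two_eq_zero_of_mem_normalizer hF (h2 hg) hc (hf c hc)] at h3
  rw [← hXe]
  simpa using h3

/-- On basic functions, the operations in the normalizer only depend on the restrictions to `C`. -/
theorem apply_two_congr (hF : F ∈ normalizer 𝒞.ideal) {f g f' g' : SmoothFun n M}
    (hf : ∀ y ∈ 𝒞.body, f y = f' y) (hg : ∀ y ∈ 𝒞.body, g y = g' y) {c : M} (hc : c ∈ 𝒞.body)
    (hf' : ∀ e ∈ 𝒞.fiber c, dAt c f' e = 0) (hgE : ∀ e ∈ 𝒞.fiber c, dAt c g e = 0) :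
    F 2 ![f, g] c = F 2 ![f', g'] c := by
  have h1 := apply_two_eq_zero_of_mem_normalizer hF (κ := f - f')
    (fun y hy => sub_eq_zero.2 (hf y hy)) hc hgE
  have h2 := apply_two_eq_zero_of_mem_normalizer hF (κ := g - g')
    (fun y hy => sub_eq_zero.2 (hg y hy)) hc hf'
  rw [map_vec2_sub] at h1 h2
  have h1 : F 2 ![f, g] c = F 2 ![f', g] c := sub_eq_zero.1 h1
  have h2 : F 2 ![g, f'] c = F 2 ![g', f'] c := sub_eq_zero.1 h2
  rw [h1, map_vec2_swap, map_vec2_swap (F 2) f']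
  exact congrArg Neg.neg h2

/-- The bivector part of an element of the normalizer is in the normalizer. -/
theorem single_two_mem_normalizer (hF : F ∈ normalizer 𝒞.ideal) :
    Pi.single 2 (F 2) ∈ normalizer 𝒞.ideal := by
  refine ⟨single_mem_functions (hF.1 2), fun G hG => ?_⟩
  have h (m : ℕ) := hF.2 _ (single_mem_ideal hG m)
  refine 𝒞.mem_ideal_of_apply_eq_zero (fun k => ?_) fun m f c hc hf => ?_
  · cases k with
    | zero =>
      rw [bracket_single_two_zero]
      intro v i
      exact i.elim0
    | succ k =>
      rw [bracket_single_two]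
      exact (h k).1 _
  · cases m with
    | zero =>
      rw [bracket_single_two_zero]
      rfl
    | succ m =>
      rw [bracket_single_two]
      exact 𝒞.apply_eq_zero_of_mem_ideal (h m) f hc hf

section Quotient
variable [SigmaCompactSpace M] {q : ℕ} {Q : Type*} [TopologicalSpace Q]
  [ChartedSpace (EuclideanSpace ℝ (Fin q)) Q] {pr : 𝒞.body → Q}

/-- The bivector part of an element of the normalizer induces a bivector field on the quotient. -/
theorem IsSmoothQuotient.exists_bivector (hpr : 𝒞.IsSmoothQuotient q pr)
    (hF : F ∈ normalizer 𝒞.ideal) :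
    ∃ σ : (SmoothFun q Q) [⋀^Fin 2]→ₗ[ℝ] (SmoothFun q Q), IsMultiderivation σ ∧
      ∀ (a b : SmoothFun n M) (f g : SmoothFun q Q), 𝒞.IsBasic a → 𝒞.IsBasic b →
        (∀ y : 𝒞.body, a y = f (pr y)) → (∀ y : 𝒞.body, b y = g (pr y)) →
        ∀ y : 𝒞.body, F 2 ![a, b] y = σ ![f, g] (pr y) := by
  -- the pairs of a function on the quotient and a lift
  let Γ : Submodule ℝ (SmoothFun n M × SmoothFun q Q) :=
    { carrier := {p | 𝒞.IsBasic p.1 ∧ ∀ y : 𝒞.body, p.1 y = p.2 (pr y)}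
      add_mem' := by
        rintro p p' ⟨h1, h2⟩ ⟨h1', h2'⟩
        refine ⟨fun c hc e he => ?_, fun y => congrArg₂ (· + ·) (h2 y) (h2' y)⟩
        rw [Prod.fst_add, map_add]
        change dAt c p.1 e + dAt c p'.1 e = 0
        rw [h1 c hc e he, h1' c hc e he, add_zero]
      zero_mem' := ⟨fun c hc e he => by rw [Prod.fst_zero, map_zero]; rfl, fun y => rfl⟩
      smul_mem' := by
        rintro t p ⟨h1, h2⟩
        refine ⟨fun c hc e he => ?_, fun y => congrArg (t * ·) (h2 y)⟩
        rw [Prod.smul_fst, map_smul]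
        change t * dAt c p.1 e = 0
        rw [h1 c hc e he, mul_zero] }
  -- a linear choice of lifts
  obtain ⟨t, ht⟩ := ((LinearMap.snd ℝ _ _).comp Γ.subtype).exists_rightInverse_of_surjective
    (LinearMap.range_eq_top.2 fun f => by
      obtain ⟨g, hg1, hg2⟩ := hpr.exists_lift f
      exact ⟨⟨(g, f), hg2, hg1⟩, rfl⟩)
  let lift : SmoothFun q Q →ₗ[ℝ] SmoothFun n M := (LinearMap.fst ℝ _ _).comp (Γ.subtype.comp t)
  have hl1 (f : SmoothFun q Q) : 𝒞.IsBasic (lift f) := (t f).2.1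
  have hl2 (f : SmoothFun q Q) (y : 𝒞.body) : lift f y = f (pr y) := by
    have h1 : (t f).1.2 = f := LinearMap.congr_fun ht f
    exact ((t f).2.2 y).trans (by rw [h1])
  let res : SmoothFun n M →ₗ[ℝ] (𝒞.body → ℝ) :=
    { toFun := fun g y => g y, map_add' := fun _ _ => rfl, map_smul' := fun _ _ => rfl }
  let pull : SmoothFun q Q →ₗ[ℝ] (𝒞.body → ℝ) :=
    { toFun := fun g y => g (pr y), map_add' := fun _ _ => rfl, map_smul' := fun _ _ => rfl }
  -- a linear left inverse of the pullback, which turns restrictions to `C` of basic functions into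
  -- functions on the quotient
  obtain ⟨l, hl⟩ := pull.exists_leftInverse_of_injective (LinearMap.ker_eq_bot.2 fun f g h => by
    ext z
    obtain ⟨y, rfl⟩ := hpr.surjective z
    exact congrFun h y)
  let σ : (SmoothFun q Q) [⋀^Fin 2]→ₗ[ℝ] (SmoothFun q Q) :=
    (l.comp res).compAlternatingMap ((F 2).compLinearMap lift)
  have hσ (f g : SmoothFun q Q) (y : 𝒞.body) :
      σ ![f, g] (pr y) = F 2 ![lift f, lift g] y := by
    obtain ⟨h, hh⟩ := hpr.exists_descent (F 2 ![lift f, lift g]) fun c hc v hv _ =>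
      isBasic_apply_two hF (hl1 f) (hl1 g) c hc v hv
    have h1 : res (F 2 ![lift f, lift g]) = pull h := funext hh
    have h2 : (fun i => lift (![f, g] i)) = ![lift f, lift g] := by
      funext i
      fin_cases i <;> rfl
    have h3 : σ ![f, g] = l (res (F 2 ![lift f, lift g])) := by
      rw [← h2]
      rfl
    have h4 : l (pull h) = h := LinearMap.congr_fun hl h
    rw [h3, h1, h4, hh]
  refine ⟨σ, isMultiderivation_of_cons fun v a b => ?_, fun a b f g ha hb haf hbg y => ?_⟩
  · have hv (x : SmoothFun q Q) : (Fin.cons x v : Fin 2 → SmoothFun q Q) = ![x, v 0] := by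
      funext i
      fin_cases i <;> rfl
    rw [hv, hv, hv]
    ext z
    obtain ⟨y, rfl⟩ := hpr.surjective z
    change _ = a (pr y) * σ ![b, v 0] (pr y) + b (pr y) * σ ![a, v 0] (pr y)
    rw [hσ, hσ, hσ, apply_two_congr hF (f' := lift a * lift b) (g' := lift (v 0))
      (fun y hy => ?_) (fun y hy => rfl) y.2 ((hl1 a).mul (hl1 b) y y.2) (hl1 _ y y.2),
      IsMultiderivation.vec2_mul (hF.1 2), ← hl2, ← hl2]
    · rfl
    · exact (hl2 (a * b) ⟨y, hy⟩).trans (congrArg₂ (· * ·) (hl2 a ⟨y, hy⟩) (hl2 b ⟨y, hy⟩)).symm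
  · rw [hσ]
    exact apply_two_congr hF (fun y hy => (haf ⟨y, hy⟩).trans (hl2 f ⟨y, hy⟩).symm)
      (fun y hy => (hbg ⟨y, hy⟩).trans (hl2 g ⟨y, hy⟩).symm) y.2 (hl1 f y y.2) (hb y y.2)

end Quotient
end GradedSubmanifold

end

/-! ### Adapted functions and vector fields at a point of the body -/

section

namespace GradedSubmanifold

variable {n : ℕ} {M : Type*} [TopologicalSpace M] [ChartedSpace (EuclideanSpace ℝ (Fin n)) M]
  [IsManifold (𝓡 n) ∞ M] {𝒞 𝒜 : GradedSubmanifold n M}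

/-- Modification of a function to second order at `c` so that given iterated derivatives vanish. -/
theorem exists_adjusted {s : ℕ} {c : M} (hc : c ∈ 𝒞.body)
    {X : Fin s → Derivation ℝ (SmoothFun n M) (SmoothFun n M)} {κ : Fin s → SmoothFun n M}
    (hκ : ∀ j, ∀ y ∈ 𝒞.body, κ j y = 0) (hXκ : ∀ i j, X i (κ j) c = if i = j then 1 else 0)
    (f : SmoothFun n M) (hf : ∀ i j, X i (X j f) c = X j (X i f) c) :
    ∃ f' : SmoothFun n M, (∀ y ∈ 𝒞.body, f' y = f y) ∧ (∀ y ∈ 𝒞.body, dAt y f' = dAt y f) ∧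
      ∀ i j, X i (X j f') c = 0 := by
  -- the second order Taylor polynomial of `f` in the directions `X i`, with the `κ` as
  -- coordinates
  let P : SmoothFun n M := ∑ a, ∑ b, (2⁻¹ * X a (X b f) c) • (κ a * κ b)
  have hd (y : M) (hy : y ∈ 𝒞.body) : dAt y P = 0 := by
    simp only [P, map_sum, map_smul, dAt_mul, hκ _ y hy, zero_smul, add_zero, smul_zero,
      Finset.sum_const_zero]
  have h0 (y : M) (hy : y ∈ 𝒞.body) : P y = 0 := by
    refine (smoothFun_sum_apply _ _ _).trans (Finset.sum_eq_zero fun a _ => ?_)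
    refine (smoothFun_sum_apply _ _ _).trans (Finset.sum_eq_zero fun b _ => ?_)
    change _ * (κ a y * κ b y) = 0
    rw [hκ a y hy, zero_mul, mul_zero]
  refine ⟨f - P, fun y hy => ?_, fun y hy => ?_, fun i j => ?_⟩
  · change f y - P y = _
    rw [h0 y hy, sub_zero]
  · rw [map_sub, hd y hy, sub_zero]
  · have h1 (a b : Fin s) : X i (X j (κ a * κ b)) c =
        (if i = a then 1 else 0) * (if j = b then 1 else 0) +
        (if i = b then 1 else 0) * (if j = a then 1 else 0) := by
      rw [(X j).leibniz, map_add, smul_eq_mul, smul_eq_mul, (X i).leibniz, (X i).leibniz]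
      change κ a c * X i (X j (κ b)) c + X j (κ b) c * X i (κ a) c +
        (κ b c * X i (X j (κ a)) c + X j (κ a) c * X i (κ b) c) = _
      rw [hκ a c hc, hκ b c hc, hXκ, hXκ, hXκ, hXκ]
      ring
    have h2 : X i (X j P) c = ∑ a, ∑ b, (2⁻¹ * X a (X b f) c) * X i (X j (κ a * κ b)) c := by
      simp only [P, map_sum, Derivation.map_smul, smoothFun_sum_apply]
      rfl
    rw [map_sub, map_sub]
    change X i (X j f) c - X i (X j P) c = 0
    rw [h2]
    simp only [h1, mul_add, Finset.sum_add_distrib]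
    simp
    rw [hf j i]
    ring

variable [T2Space M]

/-- If `D ∩ TC` has constant rank, every covector which annihilates `TC` and `D` at a point of `C`
is the differential of a function which vanishes on `C` and whose differential annihilates `D`
along `C`. -/
theorem exists_conormal_of_constantRank (hCA : 𝒞.body ⊆ 𝒜.body)
    (hrank : 𝒞.HasConstantRank fun x => 𝒜.fiber x ⊓ 𝒞.tangent x) {c : M} (hc : c ∈ 𝒞.body)
    (ξ : TangentSpace (𝓡 n) c →ₗ[ℝ] ℝ) (hξC : ∀ v ∈ 𝒞.tangent c, ξ v = 0)
    (hξD : ∀ v ∈ 𝒜.fiber c, ξ v = 0) :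
    ∃ κ : SmoothFun n M, (∀ y ∈ 𝒞.body, κ y = 0) ∧
      (∀ y ∈ 𝒞.body, ∀ e ∈ 𝒜.fiber y, dAt y κ e = 0) ∧ ∀ v, dAt c κ v = ξ v := by
  obtain ⟨κ, hκ, hκC⟩ := 𝒞.exists_conormalFrame hc
  obtain ⟨r, Y, hY, hYs⟩ := 𝒜.exists_fiberFrame (hCA hc)
  replace hYs := hYs.filter_mono (nhdsWithin_mono c hCA)
  let N : Matrix (Fin r) (Fin n) (SmoothFun n M) := fun k l => Y k (κ l)
  have hspan : ξ ∈ Submodule.span ℝ (Set.range fun l => (dAt c (κ l)).toLinearMap) := by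
    refine mem_span_of_iInf_ker_le_ker fun v hv =>
      hξC v (hκC.self_of_nhdsWithin hc v fun l => ?_)
    exact LinearMap.mem_ker.1 (Submodule.mem_iInf _ |>.1 hv l)
  obtain ⟨a₀, ha₀⟩ := (Submodule.mem_span_range_iff_exists_fun ℝ).1 hspan
  have ha₀' (v : TangentSpace (𝓡 n) c) : ∑ l, a₀ l * dAt c (κ l) v = ξ v := by
    rw [← ha₀]
    simp
  -- the left kernel of the matrix is isomorphic to `D ∩ TC`
  have key : ∀ᶠ y in 𝓝[𝒞.body] c,
      Module.finrank ℝ (LinearMap.ker (N.map fun f => f y).vecMulLinear) =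
        Module.finrank ℝ (𝒜.fiber y ⊓ 𝒞.tangent y : Submodule ℝ (TangentSpace (𝓡 n) y)) := by
    filter_upwards [hYs, hκC, self_mem_nhdsWithin] with y ⟨s, hs, hsE, hsX⟩ hy2 hy
    let L : (Fin r → ℝ) →ₗ[ℝ] TangentSpace (𝓡 n) y := Fintype.linearCombination ℝ s
    have hL (a : Fin r → ℝ) : L a = ∑ k, a k • s k := rfl
    have hLinj : Function.Injective L := by
      rw [← LinearMap.ker_eq_bot, LinearMap.ker_eq_bot']
      exact fun a ha => funext fun k => Fintype.linearIndependent_iff.1 hs a ha k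
    have hLE (v : TangentSpace (𝓡 n) y) : v ∈ 𝒜.fiber y ↔ ∃ a, L a = v := by
      rw [← hsE]
      exact Submodule.mem_span_range_iff_exists_fun ℝ
    have hd (a : Fin r → ℝ) (g : SmoothFun n M) : dAt y g (L a) = ∑ k, a k * Y k g y := by
      rw [hL, map_sum]
      simp [hsX]
    have hker (a : Fin r → ℝ) : a ∈ LinearMap.ker (N.map fun f => f y).vecMulLinear ↔
        L a ∈ 𝒞.tangent y := by
      have h1 : a ∈ LinearMap.ker (N.map fun f => f y).vecMulLinear ↔
          ∀ l, dAt y (κ l) (L a) = 0 := by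
        simp only [hd]
        exact funext_iff
      rw [h1]
      refine ⟨hy2 _, fun h l => ?_⟩
      rw [𝒞.dAt_tangent_congr (g := 0) h hy (by
        filter_upwards [self_mem_nhdsWithin] with z hz using hκ l z hz)]
      simp
    rw [(Submodule.equivMapOfInjective L hLinj _).finrank_eq]
    refine congrArg (fun S : Submodule ℝ (TangentSpace (𝓡 n) y) => Module.finrank ℝ S) ?_
    ext v
    constructor
    · rintro ⟨a, ha, rfl⟩
      exact ⟨(hLE _).2 ⟨a, rfl⟩, (hker a).1 ha⟩
    · rintro ⟨hv1, hv2⟩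
      obtain ⟨a, rfl⟩ := (hLE v).1 hv1
      exact ⟨a, (hker a).2 hv2, rfl⟩
  obtain ⟨a, ha1, ha2⟩ := exists_smooth_solution N 0 (by
      filter_upwards [key, hrank c hc] with y hy hy'
      rw [hy, hy', ← key.self_of_nhdsWithin hc])
    (.of_forall fun y a _ => Finset.sum_eq_zero fun k _ => mul_zero _) a₀ (fun k => by
      obtain ⟨s, -, hs, hsX⟩ := hYs.self_of_nhdsWithin hc
      have h1 : s k ∈ 𝒜.fiber c := by
        rw [← hs]
        exact Submodule.subset_span ⟨k, rfl⟩
      refine Eq.trans ?_ (hξD _ h1)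
      rw [← ha₀']
      refine Finset.sum_congr rfl fun l _ => ?_
      rw [← hsX, mul_comm])
  let K : SmoothFun n M := ∑ l, a l * κ l
  have hK (y : M) (hy : y ∈ 𝒞.body) : K y = 0 := by
    refine (smoothFun_sum_apply _ _ _).trans (Finset.sum_eq_zero fun l _ => ?_)
    change a l y * κ l y = 0
    rw [hκ l y hy, mul_zero]
  have hdK (y : M) (hy : y ∈ 𝒞.body) (v : TangentSpace (𝓡 n) y) :
      dAt y K v = ∑ l, a l y * dAt y (κ l) v := by
    have h (l : Fin n) : dAt y (a l * κ l) v = a l y * dAt y (κ l) v := by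
      rw [dAt_mul, hκ l y hy, zero_smul, add_zero]
      rfl
    rw [map_sum, sum_apply]
    exact Finset.sum_congr rfl fun l _ => h l
  have hKD : ∀ᶠ y in 𝓝[𝒞.body] c, ∀ e ∈ 𝒜.fiber y, dAt y K e = 0 := by
    filter_upwards [ha2, hYs, self_mem_nhdsWithin] with y hy1 ⟨s, hs, hsE, hsX⟩ hy e he
    rw [← hsE] at he
    obtain ⟨t, rfl⟩ := (Submodule.mem_span_range_iff_exists_fun ℝ).1 he
    rw [map_sum]
    refine Finset.sum_eq_zero fun k _ => ?_
    have h3 : dAt y K (s k) = 0 := by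
      rw [hdK y hy]
      refine Eq.trans ?_ (hy1 k)
      refine Finset.sum_congr rfl fun l _ => ?_
      rw [← hsX, mul_comm]
    rw [map_smul, h3, smul_zero]
  obtain ⟨W, hW, hWo, hcW⟩ := eventually_nhds_iff.1 (eventually_nhdsWithin_iff.1 hKD)
  obtain ⟨χ, hχ1, hχW⟩ := exists_bump (n := n) (hWo.mem_nhds hcW)
  have hd (y : M) (hy : y ∈ 𝒞.body) (v : TangentSpace (𝓡 n) y) :
      dAt y (χ * K) v = χ y * dAt y K v := by
    rw [dAt_mul, hK y hy, zero_smul, add_zero]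
    rfl
  refine ⟨χ * K, fun y hy => ?_, fun y hy e he => ?_, fun v => ?_⟩
  · change χ y * K y = 0
    rw [hK y hy, mul_zero]
  · rw [hd y hy]
    by_cases hyW : y ∈ W
    · rw [hW y hyW hy e he, mul_zero]
    · rw [image_eq_zero_of_notMem_tsupport fun h => hyW (hχW h), zero_mul]
  · rw [hd c hc, hdK c hc, ← ha₀', hχ1.self_of_nhds]
    simp only [ha1]
    exact one_mul _

/-- Sections of `D` whose values at `c` form a basis of a complement of `TC` in `TC + D`, together
with dual functions vanishing on `C`. -/
theorem exists_transverse_fields {c : M} (hc : c ∈ 𝒞.body) (hcA : c ∈ 𝒜.body) :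
    ∃ (s : ℕ) (X : Fin s → Derivation ℝ (SmoothFun n M) (SmoothFun n M))
      (κ : Fin s → SmoothFun n M), (∀ i, ofDeriv (X i) ∈ 𝒜.tangentFields) ∧
      (∀ j, ∀ y ∈ 𝒞.body, κ j y = 0) ∧ (∀ i j, X i (κ j) c = if i = j then 1 else 0) ∧
      ∀ v ∈ 𝒞.tangent c ⊔ 𝒜.fiber c, ∃ a : Fin s → ℝ, ∃ t ∈ 𝒞.tangent c,
        ∀ f, dAt c f v = dAt c f t + ∑ i, a i * X i f c := by
  have : FiniteDimensional ℝ (TangentSpace (𝓡 n) c) :=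
    inferInstanceAs (FiniteDimensional ℝ (EuclideanSpace ℝ (Fin n)))
  let T := 𝒞.tangent c
  -- a basis of the image of `D` in the normal space
  let D' : Submodule ℝ (TangentSpace (𝓡 n) c ⧸ T) := (𝒜.fiber c).map T.mkQ
  let b := Module.finBasis ℝ D'
  have hb (i) : ∃ w ∈ 𝒜.fiber c, T.mkQ w = (b i : TangentSpace (𝓡 n) c ⧸ T) := (b i).2
  choose w hwD hw using hb
  choose X hX hXw using fun i => 𝒜.exists_tangentField_eq hcA (hwD i)
  choose ξ hξ using fun j => (b.coord j).exists_extend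
  have hξb (i j) : ξ j (b i) = if i = j then 1 else 0 := by
    have : ξ j (b i) = b.coord j (b i) := LinearMap.congr_fun (hξ j) (b i)
    rw [this, b.coord_apply, b.repr_self, Finsupp.single_apply]
  choose κ hκ hκξ using fun j => 𝒞.exists_conormal hc (ξ j ∘ₗ T.mkQ) fun v hv => by
    rw [LinearMap.comp_apply, Submodule.mkQ_apply, (Submodule.Quotient.mk_eq_zero T).2 hv, map_zero]
  refine ⟨_, X, κ, hX, hκ, fun i j => ?_, fun v hv => ?_⟩
  · rw [hXw, hκξ, LinearMap.comp_apply, hw, hξb]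
  · have hvD : T.mkQ v ∈ D' := by
      obtain ⟨t, ht, e, he, rfl⟩ := Submodule.mem_sup.1 hv
      rw [map_add, Submodule.mkQ_apply, (Submodule.Quotient.mk_eq_zero T).2 ht, zero_add]
      exact ⟨e, he, rfl⟩
    refine ⟨fun i => b.repr ⟨_, hvD⟩ i, v - ∑ i, b.repr ⟨_, hvD⟩ i • w i, ?_, fun f => ?_⟩
    · rw [← Submodule.Quotient.mk_eq_zero T]
      change T.mkQ _ = 0
      have h1 := congrArg D'.subtype (b.sum_repr ⟨_, hvD⟩)
      rw [map_sum] at h1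
      rw [map_sub, map_sum, sub_eq_zero]
      refine h1.symm.trans (Finset.sum_congr rfl fun i _ => ?_)
      rw [map_smul, map_smul, hw]
      rfl
    · rw [map_sub, map_sum]
      simp [hXw, -Module.Basis.sum_repr]

end GradedSubmanifold

end

/-! ### The Jacobi identity for the reduced bracket -/

section

namespace GradedSubmanifold

variable {n : ℕ} {M : Type*} [TopologicalSpace M] [ChartedSpace (EuclideanSpace ℝ (Fin n)) M]
  [IsManifold (𝓡 n) ∞ M] [T2Space M] {𝒞 𝒜 : GradedSubmanifold n M} {S F : Cochain n M}

/-- The Hamiltonian vector at `c` of a function whose differential annihilates `E` lies in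
`TC + D`: it is annihilated by the covectors `dκ` for `κ` of degree zero in the ideal and in the
relative normalizer, and by constant rank these are all the covectors annihilating `TC + D`. -/
theorem exists_hamiltonianVector (h𝒞𝒜 : 𝒜.ideal ≤ 𝒞.ideal)
    (hrank : 𝒞.HasConstantRank fun x => 𝒜.fiber x ⊓ 𝒞.tangent x) (hS : S ∈ functions n M)
    (hS_half : ∀ k ∈ (𝒞.ideal : Set (Cochain n M)) ∩ relNormalizer 𝒞.ideal 𝒜.ideal,
      IsHomogeneous 0 k → bracket S k ∈ 𝒞.ideal) {c : M} (hc : c ∈ 𝒞.body) (g : SmoothFun n M)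
    (hg : ∀ e ∈ 𝒞.fiber c, dAt c g e = 0) :
    ∃ V ∈ 𝒞.tangent c ⊔ 𝒜.fiber c, ∀ f, S 2 ![f, g] c = dAt c f V := by
  let D : SmoothFun n M →ₗ[ℝ] ℝ :=
    { toFun := fun f => S 2 ![f, g] c
      map_add' := fun a b => by rw [map_vec2_add]; rfl
      map_smul' := fun t a => by rw [map_vec2_smul]; rfl }
  obtain ⟨V, hV⟩ := exists_tangentVector (x := c) (D := D) fun a b =>
    congrArg (fun u : SmoothFun n M => u c) (IsMultiderivation.vec2_mul (hS 2) a b g)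
  refine ⟨V, ?_, hV⟩
  by_contra hne
  obtain ⟨ξ, hξ, hξ0⟩ := Submodule.exists_dual_map_eq_bot_of_notMem hne inferInstance
  have hξ1 (v) (hv : v ∈ 𝒞.tangent c ⊔ 𝒜.fiber c) : ξ v = 0 := by
    have : ξ v ∈ (𝒞.tangent c ⊔ 𝒜.fiber c).map ξ := ⟨v, hv, rfl⟩
    rwa [hξ0] at this
  obtain ⟨κ, hκ, hκD, hκξ⟩ := exists_conormal_of_constantRank (body_subset_of_ideal_le h𝒞𝒜) hrank hc
    ξ (fun v hv => hξ1 v (Submodule.mem_sup_left hv)) fun v hv =>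
      hξ1 v (Submodule.mem_sup_right hv)
  have h1 := hS_half (ofFun κ) ⟨ofFun_mem_ideal hκ, ofFun_mem_relNormalizer h𝒞𝒜 hκD⟩
    (isHomogeneous_ofFun κ)
  have h2 := 𝒞.apply_eq_zero_of_mem_ideal h1 ![g] hc (by simpa using hg)
  rw [bracket_ofFun_right] at h2
  exact hξ (((hκξ V).symm.trans (hV κ).symm).trans h2)

/-- The Jacobi identity for the reduced bracket. Its terms are computed with lifts adjusted at the
point `c`, for which the operation in the normalizer may be replaced with `S`. -/
theorem jacobiator_eq_zero (h𝒜 : 𝒜.IsCoisotropic) (h𝒞𝒜 : 𝒜.ideal ≤ 𝒞.ideal)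
    (hrank : 𝒞.HasConstantRank fun x => 𝒜.fiber x ⊓ 𝒞.tangent x) (hS : S ∈ functions n M)
    (hS_deg : IsHomogeneous 2 S) (hS_poisson : bracket S S = 0)
    (hS_norm : ∀ ψ ∈ 𝒜.ideal, bracket S ψ ∈ 𝒞.ideal)
    (hS_half : ∀ k ∈ (𝒞.ideal : Set (Cochain n M)) ∩ relNormalizer 𝒞.ideal 𝒜.ideal,
      IsHomogeneous 0 k → bracket S k ∈ 𝒞.ideal)
    (hF : F ∈ normalizer 𝒞.ideal) (hFS : F - S ∈ 𝒞.ideal) {f g h : SmoothFun n M}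
    (hf : 𝒞.IsBasic f) (hg : 𝒞.IsBasic g) (hh : 𝒞.IsBasic h) {c : M} (hc : c ∈ 𝒞.body) :
    F 2 ![F 2 ![f, g], h] c + F 2 ![F 2 ![g, h], f] c + F 2 ![F 2 ![h, f], g] c = 0 := by
  have hCA := body_subset_of_ideal_le h𝒞𝒜
  have hFS' (u v : SmoothFun n M) {y : M} (hy : y ∈ 𝒞.body) (hu : ∀ e ∈ 𝒞.fiber y, dAt y u e = 0)
      (hv : ∀ e ∈ 𝒞.fiber y, dAt y v e = 0) : F 2 ![u, v] y = S 2 ![u, v] y :=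
    sub_eq_zero.1 (𝒞.apply_eq_zero_of_mem_ideal hFS ![u, v] hy
      (by simpa [Fin.forall_fin_two] using ⟨hu, hv⟩))
  obtain ⟨s, X, κ, hX, hκ, hXκ, hspan⟩ := exists_transverse_fields (𝒜 := 𝒜) hc (hCA hc)
  -- basic functions are annihilated by the fields `X i` along `C`
  have hXb {u : SmoothFun n M} (hu : 𝒞.IsBasic u) (i : Fin s) (y : M) (hy : y ∈ 𝒞.body) :
      X i u y = 0 := by
    obtain ⟨v, hv, hXv⟩ := (𝒜.ofDeriv_mem_tangentFields_iff (X i)).1 (hX i) y (hCA hy)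
    rw [hXv, hu y hy v (fiber_le_of_ideal_le h𝒞𝒜 hy hv)]
  have hsym {u : SmoothFun n M} (hu : 𝒞.IsBasic u) (i j : Fin s) :
      X i (X j u) c = X j (X i u) c := by
    have h1 := h𝒞𝒜 (h𝒜 _ (mem_ideal_of_mem_tangentFields (hX i)) _
      (mem_ideal_of_mem_tangentFields (hX j)))
    have h2 := 𝒞.apply_eq_zero_of_mem_ideal h1 ![u] hc (by simpa using hu c hc)
    have h3 := bracket_vectorField_one (ofDeriv (X i)) (ofDeriv (X j)) (isHomogeneous_single _ _) u
    rw [ofDeriv_one, ofDeriv_one] at h3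
    exact sub_eq_zero.1 ((congrArg (fun w : SmoothFun n M => w c) h3).symm.trans h2)
  -- adjusted lifts
  have hadj {u : SmoothFun n M} (hu : 𝒞.IsBasic u) : ∃ u' : SmoothFun n M, 𝒞.IsBasic u' ∧
      (∀ y ∈ 𝒞.body, u y = u' y) ∧ ∀ i j, X i (X j u') c = 0 := by
    obtain ⟨u', h1, h2, h3⟩ := exists_adjusted hc hκ hXκ u (hsym hu)
    refine ⟨u', fun y hy e he => ?_, fun y hy => (h1 y hy).symm, h3⟩
    rw [h2 y hy, hu y hy e he]
  -- the Hamiltonian vectors are spanned by vectors tangent to `C` and the `X i`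
  have hvanish {u : SmoothFun n M} (hu : ∀ y ∈ 𝒞.body, u y = 0) (hXu : ∀ i, X i u c = 0)
      {v : SmoothFun n M} (hv : 𝒞.IsBasic v) : S 2 ![u, v] c = 0 := by
    obtain ⟨V, hV, hSV⟩ := exists_hamiltonianVector h𝒞𝒜 hrank hS hS_half hc v (hv c hc)
    obtain ⟨a, t, ht, hVt⟩ := hspan V hV
    rw [hSV, hVt, 𝒞.dAt_tangent_congr (g := 0) ht hc (by
      filter_upwards [self_mem_nhdsWithin] with z hz using hu z hz), map_zero]
    simp [hXu]
  -- the bracket of adjusted lifts is adjusted to first order, as `{S, X i}` is in the ideal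
  have hXS {u v : SmoothFun n M} (hu : 𝒞.IsBasic u) (hv : 𝒞.IsBasic v)
      (hu' : ∀ i j, X i (X j u) c = 0) (hv' : ∀ i j, X i (X j v) c = 0) (i : Fin s) :
      X i (S 2 ![u, v]) c = 0 := by
    have h1 := hS_norm _ (mem_ideal_of_mem_tangentFields (hX i))
    have h2 := 𝒞.apply_eq_zero_of_mem_ideal h1 ![u, v] hc
      (by simpa [Fin.forall_fin_two] using ⟨hu c hc, hv c hc⟩)
    have h3 := bracket_vectorField_two S (ofDeriv (X i)) (isHomogeneous_single _ _) u v
    rw [ofDeriv_one] at h3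
    have h4 : S 2 ![X i u, v] c - S 2 ![X i v, u] c - X i (S 2 ![u, v]) c = 0 :=
      (congrArg (fun w : SmoothFun n M => w c) h3).symm.trans h2
    rw [hvanish (hXb hu i) (fun j => hu' j i) hv, hvanish (hXb hv i) (fun j => hv' j i) hu] at h4
    simpa using h4
  obtain ⟨f', hf', hff', hfX⟩ := hadj hf
  obtain ⟨g', hg', hgg', hgX⟩ := hadj hg
  obtain ⟨h', hh', hhh', hhX⟩ := hadj hh
  -- iterated brackets of basic functions can be computed with `S` and adjusted lifts
  have key {u v w u' v' w' : SmoothFun n M} (hu : 𝒞.IsBasic u) (hv : 𝒞.IsBasic v)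
      (hw : 𝒞.IsBasic w) (hu' : 𝒞.IsBasic u') (hv' : 𝒞.IsBasic v') (hw' : 𝒞.IsBasic w')
      (huu' : ∀ y ∈ 𝒞.body, u y = u' y) (hvv' : ∀ y ∈ 𝒞.body, v y = v' y)
      (hww' : ∀ y ∈ 𝒞.body, w y = w' y) (huX : ∀ i j, X i (X j u') c = 0)
      (hvX : ∀ i j, X i (X j v') c = 0) :
      F 2 ![F 2 ![u, v], w] c = S 2 ![S 2 ![u', v'], w'] c := by
    have hb := isBasic_apply_two hF hu' hv'
    rw [apply_two_congr hF (fun y hy => apply_two_congr hF huu' hvv' hy (hu' y hy) (hv y hy))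
      hww' hc (hb c hc) (hw c hc), hFS' _ _ hc (hb c hc) (hw' c hc), ← sub_eq_zero]
    have h1 : S 2 ![F 2 ![u', v'] - S 2 ![u', v'], w'] c = 0 := by
      refine hvanish (fun y hy => ?_) (fun i => ?_) hw'
      · exact sub_eq_zero.2 (hFS' _ _ hy (hu' y hy) (hv' y hy))
      · rw [map_sub]
        change X i (F 2 ![u', v']) c - X i (S 2 ![u', v']) c = 0
        rw [hXb hb i c hc, hXS hu' hv' huX hvX, sub_zero]
    rw [map_vec2_sub] at h1
    exact h1
  rw [key hf hg hh hf' hg' hh' hff' hgg' hhh' hfX hgX,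
    key hg hh hf hg' hh' hf' hgg' hhh' hff' hgX hhX,
    key hh hf hg hh' hf' hg' hhh' hff' hgg' hhX hfX]
  have h1 := bracket_self_three S hS_deg f' g' h'
  rw [hS_poisson] at h1
  have h2 : (0 : ℝ) = 2 * (S 2 ![S 2 ![f', g'], h'] c + S 2 ![S 2 ![g', h'], f'] c +
    S 2 ![S 2 ![h', f'], g'] c) := congrArg (fun w : SmoothFun n M => w c) h1
  linarith

/-- An element of the normalizer which is a bivector field modulo the ideal commutes with itself
modulo the ideal as soon as the Jacobi identity holds for basic functions, provided that along `TC`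
the covectors annihilating `E` are differentials of basic functions. -/
theorem bracket_self_mem_ideal (hF : F ∈ normalizer 𝒞.ideal) (hFS : F - S ∈ 𝒞.ideal)
    (hS_deg : IsHomogeneous 2 S)
    (hjac : ∀ f g h : SmoothFun n M, 𝒞.IsBasic f → 𝒞.IsBasic g → 𝒞.IsBasic h → ∀ c ∈ 𝒞.body,
      F 2 ![F 2 ![f, g], h] c + F 2 ![F 2 ![g, h], f] c + F 2 ![F 2 ![h, f], g] c = 0)
    (hbasic : ∀ (u : SmoothFun n M), ∀ c ∈ 𝒞.body, (∀ e ∈ 𝒞.fiber c, dAt c u e = 0) →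
      ∃ g, 𝒞.IsBasic g ∧ ∀ v ∈ 𝒞.tangent c, dAt c g v = dAt c u v) :
    bracket F F ∈ 𝒞.ideal := by
  -- up to the ideal `F` is its bivector part `F₂`
  set F₂ : Cochain n M := Pi.single 2 (F 2) with hF₂
  have hF₂h : IsHomogeneous 2 F₂ := isHomogeneous_single _ _
  have hF₂2 : F₂ 2 = F 2 := by simp [hF₂]
  have hF₂N : F₂ ∈ normalizer 𝒞.ideal := single_two_mem_normalizer hF
  have hF' : F - F₂ ∈ 𝒞.ideal := by
    refine mem_ideal_of_forall_smul hFS fun m => ?_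
    by_cases hm : m = 2
    · subst hm
      exact ⟨0, by simp [hF₂2]⟩
    · exact ⟨1, by simp [hF₂h m hm, hS_deg m hm]⟩
  have h3 (a b d : SmoothFun n M) := bracket_self_three F₂ hF₂h a b d
  have hrot (a b d : SmoothFun n M) : bracket F₂ F₂ 3 ![a, b, d] = bracket F₂ F₂ 3 ![b, d, a] := by
    rw [h3, h3]
    congr 1
    abel
  have hRf : bracket F₂ F₂ ∈ functions n M := bracket_self_mem_functions hF₂N.1 hF₂h
  -- the bracket vanishes if one of the arguments vanishes on `C`
  have hκ (κ g h : SmoothFun n M) (hκ : ∀ y ∈ 𝒞.body, κ y = 0) (c : M) (hc : c ∈ 𝒞.body)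
      (hg : ∀ e ∈ 𝒞.fiber c, dAt c g e = 0) (hh : ∀ e ∈ 𝒞.fiber c, dAt c h e = 0) :
      bracket F₂ F₂ 3 ![κ, g, h] c = 0 := by
    set W := bracket F₂ (ofFun κ) with hW
    have hWI : W ∈ 𝒞.ideal := hF₂N.2 _ (ofFun_mem_ideal hκ)
    have hW1 (x : SmoothFun n M) : W 1 ![x] = F₂ 2 ![κ, x] := bracket_ofFun_right F₂ κ 1 ![x]
    have hWh : IsHomogeneous 1 W := by
      intro m hm
      ext f : 1
      rw [hW, bracket_ofFun_right, hF₂h (m + 1) (by omega)]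
      rfl
    have h4 := 𝒞.apply_eq_zero_of_mem_ideal (hF₂N.2 _ hWI) ![g, h] hc
      (by simpa [Fin.forall_fin_two] using ⟨hg, hh⟩)
    have h5 := bracket_vectorField_two F₂ W hWh g h
    rw [hW1, hW1, hW1, map_vec2_swap _ κ (F₂ 2 ![g, h]), map_vec2_swap _ κ h,
      ← zero_sub (F₂ 2 ![h, κ]), map_vec2_sub] at h5
    have h6 : F₂ 2 ![0, g] = 0 := by
      have := map_vec2_sub (F₂ 2) 0 0 g
      rwa [sub_self, sub_self] at this
    rw [h6] at h5
    have h7 : bracket F₂ F₂ 3 ![κ, g, h] = (2 : ℝ) • bracket F₂ W 2 ![g, h] := by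
      rw [h3, h5]
      congr 1
      abel
    rw [h7]
    change 2 * bracket F₂ W 2 ![g, h] c = 0
    have h8 : bracket F₂ W 2 ![g, h] c = 0 := h4
    rw [h8, mul_zero]
  -- hence an argument may be replaced with a basic function
  have hrep (u : SmoothFun n M) (c : M) (hc : c ∈ 𝒞.body) (hu : ∀ e ∈ 𝒞.fiber c, dAt c u e = 0) :
      ∃ b, 𝒞.IsBasic b ∧ ∀ g h : SmoothFun n M, (∀ e ∈ 𝒞.fiber c, dAt c g e = 0) →
        (∀ e ∈ 𝒞.fiber c, dAt c h e = 0) →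
        bracket F₂ F₂ 3 ![u, g, h] c = bracket F₂ F₂ 3 ![b, g, h] c := by
    obtain ⟨b, hb, hbu⟩ := hbasic u c hc hu
    obtain ⟨κ, hκ0, hκ1⟩ := 𝒞.exists_conormal hc (dAt c (u - b)).toLinearMap fun v hv => by
      rw [map_sub]
      exact sub_eq_zero.2 (hbu v hv).symm
    refine ⟨b, hb, fun g h hg hh => ?_⟩
    have h4 : dAt c u = dAt c (b + κ) := by
      ext v
      rw [map_add]
      change dAt c u v = dAt c b v + dAt c κ v
      rw [hκ1, map_sub]
      exact (add_sub_cancel _ _).symm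
    have h5 : bracket F₂ F₂ 3 ![u, g, h] c = bracket F₂ F₂ 3 ![b + κ, g, h] c := by
      refine multiderivation_congr (hRf 3) fun i => ?_
      fin_cases i
      · exact h4
      · rfl
      · rfl
    have h6 : bracket F₂ F₂ 3 ![b + κ, g, h] =
        bracket F₂ F₂ 3 ![b, g, h] + bracket F₂ F₂ 3 ![κ, g, h] := by
      have hu (x : SmoothFun n M) : Function.update ![0, g, h] 0 x = ![x, g, h] := by
        funext i
        fin_cases i <;> rfl
      have := (bracket F₂ F₂ 3).map_update_add ![0, g, h] 0 b κ
      rwa [hu, hu, hu] at this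
    rw [h5, h6]
    change _ + bracket F₂ F₂ 3 ![κ, g, h] c = _
    rw [hκ κ g h hκ0 c hc hg hh, add_zero]
  have hR : bracket F₂ F₂ ∈ 𝒞.ideal := by
    refine 𝒞.mem_ideal_of_apply_eq_zero hRf fun m f c hc hf => ?_
    by_cases hm : m = 3
    · subst hm
      have hfe : f = ![f 0, f 1, f 2] := by
        funext i
        fin_cases i <;> rfl
      obtain ⟨a, ha, ha'⟩ := hrep (f 0) c hc (hf 0)
      obtain ⟨b, hb, hb'⟩ := hrep (f 1) c hc (hf 1)
      obtain ⟨d, hd, hd'⟩ := hrep (f 2) c hc (hf 2)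
      rw [hfe, ha' _ _ (hf 1) (hf 2), hrot, hb' _ _ (hf 2) (ha c hc), hrot,
        hd' _ _ (ha c hc) (hb c hc), hrot, h3, hF₂2]
      have h4 := hjac a b d ha hb hd c hc
      change 2 * (F 2 ![F 2 ![a, b], d] c + F 2 ![F 2 ![b, d], a] c + F 2 ![F 2 ![d, a], b] c) = 0
      rw [h4, mul_zero]
    · rw [bracket_self_of_ne F₂ hF₂h m hm]
      rfl
  have hFF₂ : bracket F F₂ ∈ 𝒞.ideal := by
    have h4 : bracket F₂ F ∈ 𝒞.ideal := by
      have : bracket F₂ F = bracket F₂ F₂ + bracket F₂ (F - F₂) := by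
        rw [← bracket_add_right, add_sub_cancel]
      rw [this]
      exact Submodule.add_mem _ hR (hF₂N.2 _ hF')
    exact mem_ideal_of_forall_smul h4 fun m => ⟨-((-1) ^ m),
      (bracket_comm_of_bivector F F₂ hF₂h m).trans (neg_smul _ _).symm⟩
  have : bracket F F = bracket F F₂ + bracket F (F - F₂) := by
    rw [← bracket_add_right, add_sub_cancel]
  rw [this]
  exact Submodule.add_mem _ hFF₂ (hF.2 _ hF')

end GradedSubmanifold

end

end GradedReduction

end

/-! ### Reduction of the Poisson structure -/

theorem mainTheorem4 {n : ℕ} {M : Type*} [TopologicalSpace M] [T2Space M] [SigmaCompactSpace M]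
    [ChartedSpace (EuclideanSpace ℝ (Fin n)) M] [IsManifold (𝓡 n) ∞ M]
    -- the Poisson structure of `M`, as a self-commuting function of degree two on `T^*[1]M`
    (S : GradedReduction.Cochain n M) (hS : S ∈ GradedReduction.functions n M)
    (hS_deg : GradedReduction.IsHomogeneous 2 S)
    (hS_poisson : GradedReduction.bracket S S = 0)
    -- the presymplectic submanifold `𝒞` and its smooth quotient `T^*[1]Q`
    (𝒞 : GradedReduction.GradedSubmanifold n M) (h𝒞 : 𝒞.IsPresymplectic)
    {q : ℕ} {Q : Type*} [TopologicalSpace Q] [T2Space Q] [SigmaCompactSpace Q]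
    [ChartedSpace (EuclideanSpace ℝ (Fin q)) Q] [IsManifold (𝓡 q) ∞ Q]
    (pr : 𝒞.body → Q) (hpr : 𝒞.IsSmoothQuotient q pr)
    -- the coisotropic submanifold `𝒜` containing `𝒞`
    (𝒜 : GradedReduction.GradedSubmanifold n M) (h𝒜 : 𝒜.IsCoisotropic)
    (h𝒞𝒜 : 𝒜.ideal ≤ 𝒞.ideal) (hcomp : 𝒞.Compatible 𝒜)
    (hS_desc : S ∈ GradedReduction.normalizer 𝒞.ideal + (𝒞.ideal : Set (GradedReduction.Cochain n M)))
    (hS_norm : ∀ ψ ∈ 𝒜.ideal, GradedReduction.bracket S ψ ∈ 𝒞.ideal)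
    (hS_half : ∀ k ∈ (𝒞.ideal : Set (GradedReduction.Cochain n M)) ∩
      GradedReduction.relNormalizer 𝒞.ideal 𝒜.ideal,
      GradedReduction.IsHomogeneous 0 k → GradedReduction.bracket S k ∈ 𝒞.ideal) :
    -- `S` descends to a unique function `σ` of degree two on the quotient, and `{σ, σ} = 0`
    (∃ σ : GradedReduction.Cochain q Q, σ ∈ GradedReduction.functions q Q ∧
      GradedReduction.IsHomogeneous 2 σ ∧ 𝒞.DescendsTo pr S σ ∧
      (∀ τ ∈ GradedReduction.functions q Q, 𝒞.DescendsTo pr S τ → τ = σ) ∧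
      GradedReduction.bracket σ σ = 0) ∧
    -- the class of `S` in `N(I) / (N(I) ∩ I)` commutes with itself
    (∀ F ∈ GradedReduction.normalizer 𝒞.ideal, F - S ∈ 𝒞.ideal →
      GradedReduction.bracket F F ∈ 𝒞.ideal) := by
  obtain ⟨F, hF, G, hG, hFG⟩ := hS_desc
  have hFS : F - S ∈ 𝒞.ideal := by
    have : F - S = -G := by rw [← hFG]; simp
    rw [this]
    exact Submodule.neg_mem _ hG
  have hjac (F : GradedReduction.Cochain n M) (hF : F ∈ GradedReduction.normalizer 𝒞.ideal)
      (hFS : F - S ∈ 𝒞.ideal) (f g h : GradedReduction.SmoothFun n M) (hf : 𝒞.IsBasic f)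
      (hg : 𝒞.IsBasic g) (hh : 𝒞.IsBasic h) (c : M) (hc : c ∈ 𝒞.body) :
      F 2 ![F 2 ![f, g], h] c + F 2 ![F 2 ![g, h], f] c + F 2 ![F 2 ![h, f], g] c = 0 :=
    GradedReduction.GradedSubmanifold.jacobiator_eq_zero h𝒜 h𝒞𝒜 hcomp.constantRank_inf_tangent_body
      hS hS_deg hS_poisson hS_norm hS_half hF hFS hf hg hh hc
  refine ⟨?_, fun F hF hFS => ?_⟩
  · obtain ⟨σ₂, hσ₂, hσF⟩ := hpr.exists_bivector hF
    set σ : GradedReduction.Cochain q Q := Pi.single 2 σ₂ with hσ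
    have hσ2 : σ 2 = σ₂ := by simp [hσ]
    have hσh : GradedReduction.IsHomogeneous 2 σ := GradedReduction.isHomogeneous_single _ _
    have hred : 𝒞.ReducesTo pr F σ := by
      intro k g f hg hgf y
      have hgb (i) := GradedReduction.GradedSubmanifold.isBasic_of_mem_normalizer (hg i)
      -- the components of `F` in degrees other than two are in the ideal
      by_cases hk : k = 2
      · subst hk
        have hg2 : g = ![g 0, g 1] := by funext i; fin_cases i <;> rfl
        have hf2 : f = ![f 0, f 1] := by funext i; fin_cases i <;> rfl
        rw [hσ2, hg2, hf2]
        exact hσF _ _ _ _ (hgb 0) (hgb 1) (hgf 0) (hgf 1) y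
      · have h1 := 𝒞.apply_eq_zero_of_mem_ideal hFS g y.2 fun i => hgb i y y.2
        rw [Pi.sub_apply, hS_deg k hk, sub_zero] at h1
        rw [h1, hσh k hk]
        rfl
    refine ⟨σ, GradedReduction.single_mem_functions hσ₂, hσh, ⟨F, hF, hFS, hred⟩, ?_, ?_⟩
    -- uniqueness: functions on the quotient have lifts, on which elements of the ideal vanish
    · rintro τ hτ ⟨F', hF', hFS', hred'⟩
      funext k
      ext f z
      obtain ⟨y, rfl⟩ := hpr.surjective z
      choose g hg hgb using fun i => hpr.exists_lift (f i)
      have hgN (i) : GradedReduction.ofFun (g i) ∈ GradedReduction.normalizer 𝒞.ideal :=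
        GradedReduction.GradedSubmanifold.IsBasic.ofFun_mem_normalizer (hgb i)
      have h1 : F' - F ∈ 𝒞.ideal := by
        rw [← sub_sub_sub_cancel_right F' F S]
        exact Submodule.sub_mem _ hFS' hFS
      have h2 : F' k g y = F k g y :=
        sub_eq_zero.1 (𝒞.apply_eq_zero_of_mem_ideal h1 g y.2 fun i => hgb i y y.2)
      rw [← hred' k g f hgN hg y, h2, hred k g f hgN hg y]
    -- the Jacobi identity on the quotient is the one for lifts
    · funext m
      by_cases hm : m = 3
      · subst hm
        ext f z
        obtain ⟨y, rfl⟩ := hpr.surjective z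
        have hf3 : f = ![f 0, f 1, f 2] := by funext i; fin_cases i <;> rfl
        choose g hg hgb using fun i => hpr.exists_lift (f i)
        have hpull (i j) (y) := hσF _ _ _ _ (hgb i) (hgb j) (hg i) (hg j) y
        have hpull3 (i j k) := hσF _ _ _ _
          (GradedReduction.GradedSubmanifold.isBasic_apply_two hF (hgb i) (hgb j)) (hgb k)
          (hpull i j) (hg k) y
        have h1 := hjac F hF hFS _ _ _ (hgb 0) (hgb 1) (hgb 2) y y.2
        rw [hpull3, hpull3, hpull3] at h1
        rw [hf3, GradedReduction.bracket_self_three σ hσh, hσ2]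
        refine Eq.trans ?_ (mul_zero (2 : ℝ))
        rw [← h1]
        rfl
      · exact GradedReduction.bracket_self_of_ne σ hσh m hm
  · refine GradedReduction.GradedSubmanifold.bracket_self_mem_ideal hF hFS hS_deg (hjac F hF hFS)
      fun u c hc hu => ?_
    obtain ⟨f, g, -, hgb, hgu⟩ := hpr.exists_lift_dAt_eq u hc hu
    exact ⟨g, hgb, hgu⟩
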